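/- \textbf{Setting.} Let $F^*$ be a countable set with at least two points, let $Q_{i,j}\ge 0$ ($i\neq j$ in $F^*$) be jump rates and let $p_0:F^*\to[0,\infty)$ be a killing rate. (Irreducibility or recurrence of $Q$ is not needed.) Assume $$(A)\qquad \mathbf{Q_1}=\sup_{i}\sum_{j\neq i}Q_{i,j}<\infty ,\qquad \mathbf p=\sup_i p_0(i)<\infty .$$ Let $(X_t)_{t\ge0}$ be the Markov chain on $F^*\cup\{0\}$ that jumps from $i$ to $j$ at rate $Q_{i,j}$ and from $i$ to the absorbing state $0$ at rate $p_0(i)$. For a probability measure $\mu$ on $F^*$, let $\mu T_t$ be the law of $X_t$, started from $\mu$, conditioned on $X_t\ne 0$, and write $\mu T_t\varphi=\int\varphi\,d(\mu T_t)$. A quasi-stationary distribution is a probability measure $\nu_{\mathrm{qs}}$ on $F^*$ with $\nu_{\mathrm{qs}}T_t=\nu_{\mathrm{qs}}$ for all $t\ge 0$. For $N\ge 2$ let $E^{(N)}=\{\eta:F^*\to\mathbb N:\ \sum_i\eta(i)=N\}$, and let $(\eta_t)_{t\ge0}$ be the Fleming--Viot particle system, i.e. the Markov chain on $E^{(N)}$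 in which, for $i\ne j$, a particle moves from $i$ to $j$ (the configuration $\eta$ becomes $\eta-\mathbf 1_i+\mathbf 1_j$) at rate $\eta(i)\bigl(Q_{i,j}+p_0(i)\frac{\eta(j)}{N-1}\bigr)$. Let $\mathbb E_\eta$ be the expectation for $\eta_0=\eta$, let $m(\eta)=\frac1N\sum_k\eta(k)\delta_k$ and $m(\eta)(\varphi)=\int\varphi\,dm(\eta)$. Put $$\lambda=\inf_{i\neq i'}\Bigl(Q_{i,i'}+Q_{i',i}+\sum_{j\ne i,i'}Q_{i,j}\wedge Q_{i',j}\Bigr),\qquad \rho=\lambda-(\sup p_0-\inf p_0),$$ and, when $\rho>0$, $$B=\mathbf{Q_1}+2\mathbf p,\quad C=\sqrt{\frac{2(\mathbf{Q_1}+\mathbf p)}{\rho}}+\frac{2\mathbf p}{B}+2\mathbf p\sqrt{\frac{2}{B\rho}},\quad \gamma=\frac{\rho}{2(B+\rho)},\quad K_0=\frac{2(B+\rho)}{B}\Bigl(\frac{BC}{\sqrt2\,\rho}\Bigr)^{\rho/(B+\rho)} .$$ \textbf{Statement.} Suppose that $(A)$ holds and $\rho>0$. Then $K_0,\gamma>0$;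 neither constant depends on $N$. The laws $\mu T_t$ (for every probability measure $\mu$ on $F^*$) and the law of $\eta_t$ (for every starting configuration) are well-defined probability measures for all $t\ge0$, and for every $N\ge2$ and every $\eta\in E^{(N)}$, $$\sup_{t\ge0}\ \sup_{\|\varphi\|_\infty\le1}\mathbb E_\eta\bigl[\,|m(\eta_t)(\varphi)-m(\eta)T_t\varphi|\,\bigr]\le\frac{K_0}{N^\gamma}.$$ Moreover there is a unique quasi-stationary distribution $\nu_{\mathrm{qs}}$; for every $N\ge2$ the particle system has a unique invariant probability measure $\nu_N$; and $$\int_{E^{(N)}}|m(\xi)(\varphi)-\nu_{\mathrm{qs}}(\varphi)|\,\nu_N(d\xi)\le\frac{K_0}{N^\gamma}\qquad\text{for all }\varphi:F^*\to\mathbb R\text{ with }\|\varphi\|_\infty\le1 .$$ -/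

import Mathlib

open MeasureTheory ProbabilityTheory
open scoped ENNReal NNReal

noncomputable section

namespace FlemingViot

/-! ### Continuous-time Markov chains on a countable space -/

section Chain

variable {E : Type*}

open Classical in
/-- Total rate at which a chain with jump rates `q` leaves `x`. Only the values `q x z` with `z ≠ x`
are jump rates; the diagonal of `q` is never used. -/
def exitRate (q : E → E → ℝ≥0∞) (x : E) : ℝ≥0∞ :=
  ∑' z, if z = x then 0 else q x z

open Classical in
/-- Probability that the chain with jump rates `q`, started at `x`, is at `y` at time `t` after at
most `n` jumps. It is computed by conditioning on the time `s` and the target `z` of the first jump: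
the chain waits at `x` for an exponential time of parameter `exitRate q x`, and it then
jumps to `z` with probability `q x z / exitRate q x`. -/
def transProbAux (q : E → E → ℝ≥0∞) : ℕ → ℝ → E → E → ℝ≥0∞
  | 0, t, x, y => if x = y then ENNReal.ofReal (Real.exp (-(exitRate q x).toReal * t)) else 0
  | n + 1, t, x, y =>
      (if x = y then ENNReal.ofReal (Real.exp (-(exitRate q x).toReal * t)) else 0) +
        ∫⁻ s in Set.Ioc 0 t, ENNReal.ofReal (Real.exp (-(exitRate q x).toReal * s)) *
          ∑' z, (if z = x then 0 else q x z) * transProbAux q n (t - s) z y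

/-- Transition probabilities of the (minimal) pure jump Markov process with jump rates `q`. -/
def transProb (q : E → E → ℝ≥0∞) (t : ℝ) (x y : E) : ℝ≥0∞ :=
  ⨆ n, transProbAux q n t x y

/-- Law at time `t` of the Markov chain with jump rates `q` started at `x`. -/
def chainLaw [MeasurableSpace E] (q : E → E → ℝ≥0∞) (t : ℝ) (x : E) : Measure E :=
  Measure.sum fun y => transProb q t x y • Measure.dirac y

/-- Law at time `t` of the Markov chain with jump rates `q` and initial law `μ`. -/
def chainLawFrom [MeasurableSpace E] (q : E → E → ℝ≥0∞) (t : ℝ) (μ : Measure E) : Measure E :=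
  μ.bind (chainLaw q t)

end Chain

variable {S : Type*}

/-! ### The killed chain and the conditioned semigroup -/

/-- Jump rates of the killed chain on `Option S`; `none` is the absorbing cemetery state. -/
def killedRate (Q : S → S → ℝ≥0) (p₀ : S → ℝ≥0) : Option S → Option S → ℝ≥0∞
  | some i, some j => Q i j
  | some i, none => p₀ i
  | none, _ => 0

instance optionMeasurableSpace : MeasurableSpace (Option S) := ⊤

instance : DiscreteMeasurableSpace (Option S) := ⟨fun _ => trivial⟩

/-- `μ T_t`: the law at time `t` of the killed chain started from `μ`, conditioned on
non-absorption up to time `t`, as a measure on `S`. -/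
def condLaw [MeasurableSpace S] (Q : S → S → ℝ≥0) (p₀ : S → ℝ≥0) (t : ℝ) (μ : Measure S) :
    Measure S :=
  (cond (chainLawFrom (killedRate Q p₀) t (μ.map some)) {none}ᶜ).comap some

/-- Quasi-stationary distributions. -/
def IsQSD [MeasurableSpace S] (Q : S → S → ℝ≥0) (p₀ : S → ℝ≥0) (ν : Measure S) : Prop :=
  IsProbabilityMeasure ν ∧ ∀ t : ℝ, 0 ≤ t → condLaw Q p₀ t ν = ν

/-! ### The particle system -/

/-- Configurations of `N` indistinguishable particles: `η k` is the number of particles at `k`. -/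
def Config (S : Type*) (N : ℕ) : Type _ := {η : S →₀ ℕ // η.degree = N}

instance {N : ℕ} : MeasurableSpace (Config S N) := ⊤

instance {N : ℕ} : DiscreteMeasurableSpace (Config S N) := ⟨fun _ => trivial⟩

open Classical in
/-- Jump rates of the Fleming–Viot particle system: for all sites `i`, `j`, the configuration `η`
jumps to `T_{i → j} η` at rate `η(i) (Q i j + p₀(i) η(j) / (N - 1))`. The condition
`ξ + 1_i = η + 1_j` says that `ξ = T_{i → j} η`. -/
def fvRate {N : ℕ} (Q : S → S → ℝ≥0) (p₀ : S → ℝ≥0) (η ξ : Config S N) : ℝ≥0∞ :=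
  ∑' (i : S) (j : S),
    if ξ.1 + Finsupp.single i 1 = η.1 + Finsupp.single j 1 then
      (η.1 i : ℝ≥0∞) * ((Q i j : ℝ≥0∞) + (p₀ i : ℝ≥0∞) * ((η.1 j : ℝ≥0∞) / ((N : ℝ≥0∞) - 1)))
    else 0

/-- Law of `η_t` for the Fleming–Viot particle system started from `η`. -/
def fvLaw {N : ℕ} (Q : S → S → ℝ≥0) (p₀ : S → ℝ≥0) (t : ℝ) (η : Config S N) :
    Measure (Config S N) :=
  chainLaw (fvRate Q p₀) t η

/-- Invariant laws of the Fleming–Viot particle system. -/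
def IsInvariantLaw {N : ℕ} (Q : S → S → ℝ≥0) (p₀ : S → ℝ≥0) (ν : Measure (Config S N)) : Prop :=
  IsProbabilityMeasure ν ∧ ∀ t : ℝ, 0 ≤ t → chainLawFrom (fvRate Q p₀) t ν = ν

/-- Empirical measure `m(η)` of a configuration. -/
def emp [MeasurableSpace S] {N : ℕ} (η : Config S N) : Measure S :=
  (N : ℝ≥0∞)⁻¹ • ∑ k ∈ η.1.support, (η.1 k : ℝ≥0∞) • Measure.dirac k

/-! ### Parameters -/

open Classical in
/-- `Q₁ = sup_i ∑_{j ≠ i} Q i j`. -/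
def supRate (Q : S → S → ℝ≥0) : ℝ≥0∞ :=
  ⨆ i, ∑' j, if j = i then 0 else (Q i j : ℝ≥0∞)

/-- `p = sup p₀`. -/
def supKill (p₀ : S → ℝ≥0) : ℝ≥0∞ := ⨆ i, (p₀ i : ℝ≥0∞)

/-- `inf p₀`. -/
def infKill (p₀ : S → ℝ≥0) : ℝ≥0∞ := ⨅ i, (p₀ i : ℝ≥0∞)

/-- The boundedness assumption: `Q₁` and `p` are finite. -/
def BoundedRates (Q : S → S → ℝ≥0) (p₀ : S → ℝ≥0) : Prop :=
  supRate Q < ∞ ∧ supKill p₀ < ∞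

open Classical in
/-- `lam = inf_{i ≠ i'} (Q i i' + Q i' i + ∑_{j ≠ i, i'} min (Q i j) (Q i' j))`. -/
def lam (Q : S → S → ℝ≥0) : ℝ≥0∞ :=
  ⨅ (i : S) (i' : S) (_ : i ≠ i'),
    (Q i i' : ℝ≥0∞) + Q i' i + ∑' j, if j = i ∨ j = i' then 0 else min (Q i j : ℝ≥0∞) (Q i' j)

/-- `ρ = lam - (sup p₀ - inf p₀)`. -/
def rho (Q : S → S → ℝ≥0) (p₀ : S → ℝ≥0) : ℝ :=
  (lam Q).toReal - ((supKill p₀).toReal - (infKill p₀).toReal)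

/-- `B = Q₁ + 2 p`. -/
def constB (Q : S → S → ℝ≥0) (p₀ : S → ℝ≥0) : ℝ :=
  (supRate Q).toReal + 2 * (supKill p₀).toReal

/-- `C = √(2 (Q₁ + p) / ρ) + 2 p / B + 2 p √(2 / (B ρ))`. -/
def constC (Q : S → S → ℝ≥0) (p₀ : S → ℝ≥0) : ℝ :=
  √(2 * ((supRate Q).toReal + (supKill p₀).toReal) / rho Q p₀) +
    2 * (supKill p₀).toReal / constB Q p₀ +
    2 * (supKill p₀).toReal * √(2 / (constB Q p₀ * rho Q p₀))

/-- The rate exponent `γ = ρ / (2 (B + ρ))`. -/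
def gammaExp (Q : S → S → ℝ≥0) (p₀ : S → ℝ≥0) : ℝ :=
  rho Q p₀ / (2 * (constB Q p₀ + rho Q p₀))

/-- The constant `K₀ = 2 ((B + ρ) / B) (B C / (√2 ρ)) ^ (ρ / (B + ρ))`. -/
def constK (Q : S → S → ℝ≥0) (p₀ : S → ℝ≥0) : ℝ :=
  2 * ((constB Q p₀ + rho Q p₀) / constB Q p₀) *
    (constB Q p₀ * constC Q p₀ / (√2 * rho Q p₀)) ^ (rho Q p₀ / (constB Q p₀ + rho Q p₀))

end FlemingViot

end

open FlemingViot

/-!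
# Uniform propagation of chaos for Fleming–Viot particle systems

Everything takes place in the Banach space `Bdd E` of bounded functions. All rates are bounded, so
the chains have bounded generators `A`, their semigroups are `exp (t A)`, and `exp (t A)` is the
limit of the powers `(1 + (t / n) A) ^ n` of transition operators of discrete-time chains. A
Picard iteration identifies `exp (t A)` with the transition probabilities obtained by counting
jumps (`tsum_transProb_mul`). The estimates are proved for the discrete-time chains with a small
mesh `δ`, where each of them is an induction on the number of steps, and they pass to the limit.

*Killed chain.* Two copies of the chain can be coupled so as to meet at rate `lam`, and to be
killed together at rate `inf p₀`. Hence one step contracts by `1 - δ (lam + inf p₀)` the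
oscillation of functions that vanish at the cemetery, provided that the value `0` at the cemetery
lies in their range; this holds for functions whose image has mean zero under some law. The
survival probability decays at rate at most `sup p₀`, so the conditioned semigroup contracts at
rate `ρ = lam + inf p₀ - sup p₀` (`abs_condMean_sub_le`). Existence and uniqueness of the
quasi-stationary distribution follow. By the same contraction the survival probabilities from
different points stay comparable: they differ by at most `(sup p₀ / ρ)` times the smallest one
(`killedStep_pow_alive_sub_le`).

*Particle system.* Configurations are described by labelled particles `x : Fin N → S`. If two
systems differ in one particle, the two versions of this particle can be coupled so as to meet at
rate at least `lam + inf p₀`, while a discrepancy is copied at rate at most `sup p₀`, when other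
particles jump onto it. So Lipschitz constants with respect to the displacement of one particle
contract at the same rate `ρ` (`LipschitzInParticles.fvStep`), and the invariant law exists and is
unique.

*Comparison.* Let `F = m(·)(φ)`. The variance of `F` at time `t` is a sum over the past of the
variances created by single jumps, which the contraction makes summable: it is at most
`2 (Q₁ + p) / (ρ N)` (`fvSemigroup_mul_self_sub_le`). For the bias, the mean of `F` is compared
with the nonlinear flow `η ↦ m(η) T_t φ`. A jump of one particle changes this ratio of means
linearly in `1 / N` up to terms of order `1 / N²`, and the linear part reproduces the derivative
of the flow up to the term due to the factor `N / (N - 1)`. One step therefore creates an error of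
order `δ / N`, multiplied by the contraction of the conditioned semigroup
(`abs_fvStep_empFlow_sub_le`); summing over the steps gives a bias of order `1 / N`, uniformly in
time (`abs_fvSemigroup_empMean_sub_le`).

The resulting bound decays like `1 / √N`, which is faster than `1 / N ^ γ`, and
`min_two_le_mul_rpow` compares the constants. The bound for the invariant law is the limit `t → ∞`.
-/

noncomputable section

namespace FlemingViot

open Filter Topology

/-! ### Exponentials as limits of powers -/

section ExpLimit

variable {𝔸 : Type*} [NormedRing 𝔸] [NormedAlgebra ℝ 𝔸] [CompleteSpace 𝔸]

lemma norm_pow_sub_pow_le {𝔸 : Type*} [NormedRing 𝔸] {X Y : 𝔸} {M β : ℝ}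
    (hβ : 0 ≤ β) (hY : ‖Y‖ ≤ 1 + β)
    {n : ℕ} (hX : ∀ k ≤ n, ‖X ^ k‖ ≤ M) :
    ∀ k ≤ n, ‖X ^ k - Y ^ k‖ ≤ k * (M * (1 + β) ^ k * ‖X - Y‖) := by
  intro k
  induction k with
  | zero => intro _; simp
  | succ k ih =>
    intro hk
    have hM : 0 ≤ M := (norm_nonneg _).trans (hX k (by omega))
    have h1 : X ^ (k + 1) - Y ^ (k + 1) = X ^ k * (X - Y) + (X ^ k - Y ^ k) * Y := by
      rw [pow_succ, pow_succ]; noncomm_ring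
    have h2 : ‖X ^ k * (X - Y)‖ ≤ M * ‖X - Y‖ :=
      (norm_mul_le _ _).trans (by gcongr; exact hX k (by omega))
    have h3 : ‖(X ^ k - Y ^ k) * Y‖ ≤ k * (M * (1 + β) ^ k * ‖X - Y‖) * (1 + β) :=
      (norm_mul_le _ _).trans (by gcongr; exact ih (by omega))
    have h4 : (1 : ℝ) ≤ (1 + β) ^ (k + 1) := one_le_pow₀ (by linarith)
    have h5 : 0 ≤ M * ‖X - Y‖ := by positivity
    calc ‖X ^ (k + 1) - Y ^ (k + 1)‖ ≤ M * ‖X - Y‖ + k * (M * (1 + β) ^ k * ‖X - Y‖) * (1 + β) := by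
          rw [h1]; exact (norm_add_le _ _).trans (add_le_add h2 h3)
      _ ≤ M * ‖X - Y‖ * (1 + β) ^ (k + 1) + k * (M * (1 + β) ^ k * ‖X - Y‖) * (1 + β) := by
          exact add_le_add_left (le_mul_of_one_le_right h5 h4) _
      _ = _ := by push_cast; ring

/-- Euler's limit formula `exp (t a) = lim (1 + (t / n) a) ^ n` in a Banach algebra. -/
theorem tendsto_one_add_smul_pow_exp (h1 : ‖(1 : 𝔸)‖ ≤ 1) (a : 𝔸) (t : ℝ) :
    Tendsto (fun n : ℕ => (1 + (t / n) • a) ^ n) atTop (𝓝 (NormedSpace.exp (t • a))) := by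
  let _ : NormedAlgebra ℚ 𝔸 := NormedAlgebra.restrictScalars ℚ ℝ 𝔸
  obtain ⟨M, hM⟩ : ∃ M, ∀ s ∈ Set.Icc (-|t|) |t|, ‖NormedSpace.exp (s • a)‖ ≤ M := by
    have hc : Continuous fun s : ℝ => NormedSpace.exp (s • a) :=
      continuous_iff_continuousAt.2 fun s => (hasDerivAt_exp_smul_const a s).continuousAt
    exact isCompact_Icc.exists_bound_of_continuousOn hc.continuousOn
  have hd : HasDerivAt (fun s : ℝ => NormedSpace.exp ((s * t) • a)) (t • a) 0 := by
    have := (hasDerivAt_exp_smul_const a ((0 : ℝ) * t)).scomp (0 : ℝ)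
      ((hasDerivAt_id (0 : ℝ)).mul_const t)
    simpa [Function.comp_def] using this
  -- the one-step error `exp ((t / n) a) - 1 - (t / n) a` is `o (1 / n)`
  have hsmall : Tendsto (fun n : ℕ => (n : ℝ) *
      ‖NormedSpace.exp ((t / n) • a) - (1 + (t / n) • a)‖) atTop (𝓝 0) := by
    have h2 := hd.tendsto_slope_zero
    have h3 : Tendsto (fun n : ℕ => ((n : ℝ))⁻¹) atTop (𝓝[≠] 0) := by
      refine tendsto_nhdsWithin_iff.2 ⟨tendsto_inv_atTop_nhds_zero_nat, ?_⟩
      filter_upwards [eventually_gt_atTop 0] with n hn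
      simp; omega
    have h4 := ((h2.comp h3).sub_const (t • a)).norm
    simp only [sub_self, norm_zero] at h4
    refine h4.congr' ?_
    filter_upwards [eventually_gt_atTop 0] with n hn
    have hn' : (0 : ℝ) < n := by exact_mod_cast hn
    rw [← abs_of_pos hn', ← Real.norm_eq_abs, ← norm_smul, Real.norm_eq_abs, abs_of_pos hn']
    congr 1
    simp only [Function.comp_apply, inv_inv, zero_add, zero_mul, zero_smul, NormedSpace.exp_zero,
      smul_sub, smul_add, smul_smul]
    rw [show (n : ℝ)⁻¹ * t = t / n by field_simp, show (n : ℝ) * (t / n) = t by field_simp]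
    abel
  have hbound : ∀ᶠ n : ℕ in atTop, ‖NormedSpace.exp (t • a) - (1 + (t / n) • a) ^ n‖ ≤
      (M * Real.exp (|t| * ‖a‖)) * ((n : ℝ) *
        ‖NormedSpace.exp ((t / n) • a) - (1 + (t / n) • a)‖) := by
    filter_upwards [eventually_gt_atTop 0] with n hn
    have hn' : (0 : ℝ) < n := by exact_mod_cast hn
    have hX : ∀ k ≤ n, ‖NormedSpace.exp ((t / n) • a) ^ k‖ ≤ M := by
      intro k hk
      rw [← NormedSpace.exp_nsmul, ← Nat.cast_smul_eq_nsmul ℝ, smul_smul]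
      apply hM
      rw [Set.mem_Icc, ← abs_le, abs_mul, abs_div, Nat.abs_cast, Nat.abs_cast]
      have : (k : ℝ) ≤ n := by exact_mod_cast hk
      rw [mul_div_assoc', div_le_iff₀ hn', mul_comm]
      gcongr
    have hY : ‖1 + (t / n) • a‖ ≤ 1 + |t| * ‖a‖ / n := by
      refine (norm_add_le _ _).trans (add_le_add h1 ?_)
      rw [norm_smul, Real.norm_eq_abs, abs_div, Nat.abs_cast]
      apply le_of_eq; ring
    have h5 := norm_pow_sub_pow_le (by positivity) hY hX n le_rfl
    rw [← NormedSpace.exp_nsmul, ← Nat.cast_smul_eq_nsmul ℝ, smul_smul,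
      show (n : ℝ) * (t / n) = t by field_simp] at h5
    have hM0 : 0 ≤ M := (norm_nonneg _).trans (hX 0 (by omega))
    have h6 : (1 + |t| * ‖a‖ / n) ^ n ≤ Real.exp (|t| * ‖a‖) := by
      calc (1 + |t| * ‖a‖ / n) ^ n ≤ Real.exp (|t| * ‖a‖ / n) ^ n := by
            gcongr; linarith [Real.add_one_le_exp (|t| * ‖a‖ / n)]
        _ = _ := by rw [← Real.exp_nat_mul]; congr 1; field_simp
    calc _ ≤ _ := h5
      _ ≤ n * (M * Real.exp (|t| * ‖a‖) *
          ‖NormedSpace.exp ((t / n) • a) - (1 + (t / n) • a)‖) := by gcongr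
      _ = _ := by ring
  have h7 : Tendsto (fun n : ℕ => NormedSpace.exp (t • a) - (1 + (t / n) • a) ^ n) atTop (𝓝 0) := by
    refine squeeze_zero_norm' hbound ?_
    simpa using hsmall.const_mul (M * Real.exp (|t| * ‖a‖))
  simpa using (tendsto_const_nhds (x := NormedSpace.exp (t • a))).sub h7

theorem exp_add_smul (a : 𝔸) (s t : ℝ) :
    NormedSpace.exp ((s + t) • a) = NormedSpace.exp (s • a) * NormedSpace.exp (t • a) := by
  let _ : NormedAlgebra ℚ 𝔸 := NormedAlgebra.restrictScalars ℚ ℝ 𝔸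
  rw [add_smul, NormedSpace.exp_add_of_commute]
  exact ((Commute.refl _).smul_left _).smul_right _

end ExpLimit

/-! ### Generators with bounded rates -/

/-- Bounded real functions on `E`, with the supremum norm. -/
abbrev Bdd (E : Type*) : Type _ := lp (fun _ : E => ℝ) ∞

variable {E : Type*}

-- shortcut instances: search through the subtype `lp` is slow
instance : NormedAddCommGroup (Bdd E) := inferInstance
instance : NormedSpace ℝ (Bdd E) := inferInstance
instance : AddCommGroup (Bdd E) := inferInstance
instance : Module ℝ (Bdd E) := inferInstance
instance : CompleteSpace (Bdd E) := inferInstance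
instance : One (Bdd E) := inferInstance
instance : NormedRing (Bdd E →L[ℝ] Bdd E) := ContinuousLinearMap.toNormedRing
instance : Ring (Bdd E →L[ℝ] Bdd E) := ContinuousLinearMap.toNormedRing.toRing
instance : Semiring (Bdd E →L[ℝ] Bdd E) := ContinuousLinearMap.toNormedRing.toRing.toSemiring
instance : NormedAlgebra ℝ (Bdd E →L[ℝ] Bdd E) := ContinuousLinearMap.toNormedAlgebra
instance : Module ℝ (Bdd E →L[ℝ] Bdd E) := NormedSpace.toModule
instance : CompleteSpace (Bdd E →L[ℝ] Bdd E) := inferInstance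

namespace Bdd

/-- A bounded function as an element of `Bdd E`. -/
def mk (f : E → ℝ) (C : ℝ) (h : ∀ x, |f x| ≤ C) : Bdd E :=
  ⟨f, memℓp_infty ⟨C, by rintro _ ⟨x, rfl⟩; exact h x⟩⟩

@[simp] lemma mk_apply (f : E → ℝ) (C : ℝ) (h : ∀ x, |f x| ≤ C) (x : E) : mk f C h x = f x := rfl

lemma abs_apply_le (f : Bdd E) (x : E) : |f x| ≤ ‖f‖ :=
  lp.norm_apply_le_norm ENNReal.top_ne_zero f x

lemma norm_le {f : Bdd E} {C : ℝ} (hC : 0 ≤ C) (h : ∀ x, |f x| ≤ C) : ‖f‖ ≤ C :=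
  lp.norm_le_of_forall_le hC h

@[simp] lemma add_apply (f g : Bdd E) (x : E) : (f + g) x = f x + g x := rfl
@[simp] lemma sub_apply (f g : Bdd E) (x : E) : (f - g) x = f x - g x := rfl
@[simp] lemma smul_apply (c : ℝ) (f : Bdd E) (x : E) : (c • f) x = c * f x := rfl
@[simp] lemma one_apply (x : E) : (1 : Bdd E) x = 1 := rfl
@[simp] lemma mul_apply (f g : Bdd E) (x : E) : (f * g) x = f x * g x := rfl

lemma tendsto_apply {f : ℕ → Bdd E} {g : Bdd E} (h : Tendsto f atTop (𝓝 g)) (x : E) :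
    Tendsto (fun n => f n x) atTop (𝓝 (g x)) :=
  ((lp.evalCLM ℝ (fun _ : E => ℝ) ∞ x).continuous.tendsto g).comp h

end Bdd

section Generator

open Classical in
/-- The jump rate from `x` to `z` as a real number, set to zero on the diagonal. -/
def offRate (q : E → E → ℝ≥0∞) (x z : E) : ℝ := (if z = x then 0 else q x z).toReal

lemma offRate_nonneg (q : E → E → ℝ≥0∞) (x z : E) : 0 ≤ offRate q x z := ENNReal.toReal_nonneg

variable {q : E → E → ℝ≥0∞} {Λ : ℝ≥0}

lemma summable_offRate (hq : ∀ x, exitRate q x ≤ Λ) (x : E) : Summable (offRate q x) :=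
  ENNReal.summable_toReal ((hq x).trans_lt ENNReal.coe_lt_top).ne

lemma offRate_ne_top (hq : ∀ x, exitRate q x ≤ Λ) (x z : E) :
    (open Classical in if z = x then 0 else q x z) ≠ ∞ :=
  ENNReal.ne_top_of_tsum_ne_top ((hq x).trans_lt ENNReal.coe_lt_top).ne z

lemma tsum_offRate (hq : ∀ x, exitRate q x ≤ Λ) (x : E) :
    ∑' z, offRate q x z = (exitRate q x).toReal :=
  (ENNReal.tsum_toReal_eq (offRate_ne_top hq x)).symm

lemma exitRate_toReal_le (hq : ∀ x, exitRate q x ≤ Λ) (x : E) : (exitRate q x).toReal ≤ Λ := by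
  simpa using ENNReal.toReal_mono ENNReal.coe_ne_top (hq x)

lemma summable_mul_of_bdd {a f : E → ℝ} (ha : Summable a) (ha0 : ∀ z, 0 ≤ a z) {C : ℝ}
    (hf : ∀ z, |f z| ≤ C) : Summable fun z => a z * f z := by
  refine Summable.of_norm_bounded (ha.mul_right C) fun z => ?_
  rw [Real.norm_eq_abs, abs_mul, abs_of_nonneg (ha0 z)]
  exact mul_le_mul_of_nonneg_left (hf z) (ha0 z)

lemma abs_tsum_mul_le {a f : E → ℝ} (ha : Summable a) (ha0 : ∀ z, 0 ≤ a z) {C : ℝ}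
    (hf : ∀ z, |f z| ≤ C) : |∑' z, a z * f z| ≤ (∑' z, a z) * C := by
  rw [← tsum_mul_right, ← Real.norm_eq_abs]
  refine tsum_of_norm_bounded (ha.mul_right C).hasSum fun z => ?_
  rw [Real.norm_eq_abs, abs_mul, abs_of_nonneg (ha0 z)]
  exact mul_le_mul_of_nonneg_left (hf z) (ha0 z)

lemma summable_offRate_mul (hq : ∀ x, exitRate q x ≤ Λ) (x : E) (f : Bdd E) :
    Summable fun z => offRate q x z * f z :=
  summable_mul_of_bdd (summable_offRate hq x) (offRate_nonneg q x) f.abs_apply_le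

lemma abs_sub_le_two_norm (f : Bdd E) (x z : E) : |f z - f x| ≤ 2 * ‖f‖ := by
  have := f.abs_apply_le x; have := f.abs_apply_le z
  exact (abs_sub _ _).trans (by linarith)

lemma summable_offRate_mul_sub (hq : ∀ x, exitRate q x ≤ Λ) (x : E) (f : Bdd E) :
    Summable fun z => offRate q x z * (f z - f x) :=
  summable_mul_of_bdd (summable_offRate hq x) (offRate_nonneg q x) (abs_sub_le_two_norm f x)

/-- The generator `A f x = ∑ z, q x z (f z - f x)` of a chain whose total jump rates are bounded,
as a bounded operator on bounded functions. -/
def jumpGen (q : E → E → ℝ≥0∞) (Λ : ℝ≥0) (hq : ∀ x, exitRate q x ≤ Λ) : Bdd E →L[ℝ] Bdd E :=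
  LinearMap.mkContinuous
    { toFun := fun f => Bdd.mk (fun x => ∑' z, offRate q x z * (f z - f x)) (Λ * (2 * ‖f‖)) fun x =>
        (abs_tsum_mul_le (summable_offRate hq x) (offRate_nonneg q x)
          (abs_sub_le_two_norm f x)).trans (by
            rw [tsum_offRate hq]; gcongr; exact exitRate_toReal_le hq x)
      map_add' := fun f g => by
        ext x
        simp only [Bdd.mk_apply, Bdd.add_apply]
        rw [← (summable_offRate_mul_sub hq x f).tsum_add (summable_offRate_mul_sub hq x g)]
        exact tsum_congr fun z => by ring
      map_smul' := fun c f => by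
        ext x
        simp only [Bdd.mk_apply, Bdd.smul_apply, RingHom.id_apply]
        rw [← tsum_mul_left]
        exact tsum_congr fun z => by ring }
    (Λ * 2) fun f => Bdd.norm_le (by positivity) fun x => by
        rw [mul_assoc]
        exact (abs_tsum_mul_le (summable_offRate hq x) (offRate_nonneg q x)
          (abs_sub_le_two_norm f x)).trans (by
            rw [tsum_offRate hq]; gcongr; exact exitRate_toReal_le hq x)

variable (hq : ∀ x, exitRate q x ≤ Λ)

lemma jumpGen_apply (f : Bdd E) (x : E) :
    jumpGen q Λ hq f x = ∑' z, offRate q x z * (f z - f x) := rfl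

lemma jumpGen_apply' (f : Bdd E) (x : E) :
    jumpGen q Λ hq f x = ∑' z, offRate q x z * f z - (exitRate q x).toReal * f x := by
  rw [jumpGen_apply, ← tsum_offRate hq, ← tsum_mul_right,
    ← (summable_offRate_mul hq x f).tsum_sub ((summable_offRate hq x).mul_right _)]
  exact tsum_congr fun z => by ring

lemma jumpGen_one : jumpGen q Λ hq 1 = 0 := by
  ext x; simp [jumpGen_apply]

/-- One step of the discrete-time chain that approximates the chain with rates `q`:
`f ↦ f + δ A f`. -/
def eulerStep (δ : ℝ) : Bdd E →L[ℝ] Bdd E := 1 + δ • jumpGen q Λ hq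

lemma eulerStep_one (δ : ℝ) : eulerStep hq δ 1 = 1 := by
  simp [eulerStep, jumpGen_one]

lemma eulerStep_pow_succ (δ : ℝ) (n : ℕ) (f : Bdd E) :
    (eulerStep hq δ ^ (n + 1)) f = eulerStep hq δ ((eulerStep hq δ ^ n) f) := by
  rw [pow_succ']; rfl

lemma eulerStep_pow_one (δ : ℝ) (n : ℕ) : (eulerStep hq δ ^ n) (1 : Bdd E) = 1 := by
  induction n with
  | zero => rfl
  | succ n ih => rw [eulerStep_pow_succ, ih, eulerStep_one]

lemma eulerStep_mono {δ : ℝ} (hδ : 0 ≤ δ) (hδΛ : δ * Λ ≤ 1) {f g : Bdd E} (h : ∀ x, f x ≤ g x)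
    (x : E) : eulerStep hq δ f x ≤ eulerStep hq δ g x := by
  have h1 : eulerStep hq δ g x - eulerStep hq δ f x = eulerStep hq δ (g - f) x := by
    rw [map_sub]; rfl
  have h2 : eulerStep hq δ (g - f) x = (1 - δ * (exitRate q x).toReal) * (g x - f x) +
      δ * ∑' z, offRate q x z * (g z - f z) := by
    change (g - f) x + δ * jumpGen q Λ hq (g - f) x = _
    rw [jumpGen_apply']
    simp only [Bdd.sub_apply]; ring
  have h3 : 0 ≤ ∑' z, offRate q x z * (g z - f z) :=
    tsum_nonneg fun z => mul_nonneg (offRate_nonneg q x z) (sub_nonneg.2 (h z))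
  have h4 : δ * (exitRate q x).toReal ≤ 1 :=
    (mul_le_mul_of_nonneg_left (exitRate_toReal_le hq x) hδ).trans hδΛ
  have h5 := mul_nonneg (sub_nonneg.2 h4) (sub_nonneg.2 (h x))
  have h6 := mul_nonneg hδ h3
  linarith

lemma eulerStep_pow_mono {δ : ℝ} (hδ : 0 ≤ δ) (hδΛ : δ * Λ ≤ 1) {f g : Bdd E}
    (h : ∀ x, f x ≤ g x) (n : ℕ) (x : E) :
    (eulerStep hq δ ^ n) f x ≤ (eulerStep hq δ ^ n) g x := by
  induction n generalizing x with
  | zero => exact h x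
  | succ n ih =>
    rw [eulerStep_pow_succ, eulerStep_pow_succ]
    exact eulerStep_mono hq hδ hδΛ ih x

lemma eulerStep_pow_le {δ : ℝ} (hδ : 0 ≤ δ) (hδΛ : δ * Λ ≤ 1) {f : Bdd E} {C : ℝ}
    (h : ∀ x, f x ≤ C) (n : ℕ) (x : E) : (eulerStep hq δ ^ n) f x ≤ C := by
  have := eulerStep_pow_mono hq hδ hδΛ (f := f) (g := C • 1) (by simpa using h) n x
  rw [map_smul, eulerStep_pow_one] at this
  simpa using this

lemma eulerStep_pow_abs_le {δ : ℝ} (hδ : 0 ≤ δ) (hδΛ : δ * Λ ≤ 1) {f : Bdd E} {C : ℝ}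
    (h : ∀ x, |f x| ≤ C) (n : ℕ) (x : E) : |(eulerStep hq δ ^ n) f x| ≤ C := by
  rw [abs_le']
  refine ⟨eulerStep_pow_le hq hδ hδΛ (fun x => (le_abs_self _).trans (h x)) n x, ?_⟩
  have := eulerStep_pow_le hq hδ hδΛ (f := -f) (C := C) (fun x => (neg_le_abs _).trans (h x)) n x
  rwa [map_neg] at this

/-- The semigroup `exp (t A)` of the chain with rates `q`. -/
def jumpSemigroup (t : ℝ) : Bdd E →L[ℝ] Bdd E := NormedSpace.exp (t • jumpGen q Λ hq)

lemma tendsto_eulerStep_pow (t : ℝ) (f : Bdd E) (x : E) :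
    Tendsto (fun n : ℕ => (eulerStep hq (t / n) ^ n) f x) atTop (𝓝 (jumpSemigroup hq t f x)) := by
  apply Bdd.tendsto_apply
  have := tendsto_one_add_smul_pow_exp ContinuousLinearMap.norm_id_le (jumpGen q Λ hq) t
  exact ((ContinuousLinearMap.apply ℝ (Bdd E) f).continuous.tendsto _).comp this

/-- For `n` large, the mesh `t / n` is small. -/
lemma eventually_mesh_le {t : ℝ} (c : ℝ) {ε : ℝ} (hε : 0 < ε) :
    ∀ᶠ n : ℕ in atTop, t / n * c ≤ ε := by
  have h : Tendsto (fun n : ℕ => t / n * c) atTop (𝓝 (0 * c)) :=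
    (tendsto_const_div_atTop_nhds_zero_nat t).mul_const c
  rw [zero_mul] at h
  exact (h.eventually (eventually_lt_nhds hε)).mono fun _ h => h.le

lemma jumpSemigroup_mono {t : ℝ} (ht : 0 ≤ t) {f g : Bdd E} (h : ∀ x, f x ≤ g x) (x : E) :
    jumpSemigroup hq t f x ≤ jumpSemigroup hq t g x := by
  refine le_of_tendsto_of_tendsto (tendsto_eulerStep_pow hq t f x)
    (tendsto_eulerStep_pow hq t g x) ?_
  filter_upwards [eventually_mesh_le (t := t) Λ one_pos] with n hn
  exact eulerStep_pow_mono hq (by positivity) hn h n x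

lemma jumpSemigroup_one (t : ℝ) : jumpSemigroup hq t (1 : Bdd E) = 1 := by
  ext x
  refine tendsto_nhds_unique (tendsto_eulerStep_pow hq t 1 x) ?_
  simp only [eulerStep_pow_one]
  exact tendsto_const_nhds

lemma jumpSemigroup_nonneg {t : ℝ} (ht : 0 ≤ t) {f : Bdd E} (h : ∀ x, 0 ≤ f x) (x : E) :
    0 ≤ jumpSemigroup hq t f x := by
  have := jumpSemigroup_mono hq ht (f := 0) (g := f) h x
  rwa [map_zero] at this

lemma jumpSemigroup_le {t : ℝ} (ht : 0 ≤ t) {f : Bdd E} {C : ℝ} (h : ∀ x, f x ≤ C) (x : E) :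
    jumpSemigroup hq t f x ≤ C := by
  have := jumpSemigroup_mono hq ht (f := f) (g := C • 1) (by simpa using h) x
  rw [map_smul, jumpSemigroup_one] at this
  simpa using this

lemma jumpSemigroup_zero (f : Bdd E) : jumpSemigroup hq 0 f = f := by
  rw [jumpSemigroup, zero_smul, NormedSpace.exp_zero]
  rfl

lemma jumpSemigroup_add (s t : ℝ) (f : Bdd E) :
    jumpSemigroup hq (s + t) f = jumpSemigroup hq s (jumpSemigroup hq t f) := by
  rw [jumpSemigroup, exp_add_smul]
  rfl

lemma hasDerivAt_jumpSemigroup (f : Bdd E) (t : ℝ) :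
    HasDerivAt (fun t => jumpSemigroup hq t f) (jumpGen q Λ hq (jumpSemigroup hq t f)) t :=
  (ContinuousLinearMap.apply ℝ (Bdd E) f).hasFDerivAt.comp_hasDerivAt t
    (hasDerivAt_exp_smul_const' (jumpGen q Λ hq) t)

end Generator

/-! ### The transition probabilities are the kernel of the semigroup -/

section Transition

variable {E : Type*} {q : E → E → ℝ≥0∞} {Λ : ℝ≥0}

lemma measurable_transProbAux [Countable E] (q : E → E → ℝ≥0∞) (n : ℕ) (x y : E) :
    Measurable fun t => transProbAux q n t x y := by
  have h0 : Measurable fun t : ℝ => (open Classical in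
      if x = y then ENNReal.ofReal (Real.exp (-(exitRate q x).toReal * t)) else 0) := by
    split_ifs <;> fun_prop
  induction n generalizing x y with
  | zero => exact h0
  | succ n ih =>
    refine h0.add ?_
    have hint : Measurable fun p : ℝ × ℝ => {p : ℝ × ℝ | 0 < p.2 ∧ p.2 ≤ p.1}.indicator
        (fun p => ENNReal.ofReal (Real.exp (-(exitRate q x).toReal * p.2)) *
          ∑' z, (open Classical in if z = x then 0 else q x z) *
            transProbAux q n (p.1 - p.2) z y) p := by
      refine Measurable.indicator ?_ ?_
      · refine Measurable.mul (by fun_prop) (Measurable.tsum fun z => ?_)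
        refine Measurable.const_mul ?_ _
        exact (ih z y (by split_ifs <;> fun_prop)).comp (measurable_fst.sub measurable_snd)
      · exact (measurableSet_lt measurable_const measurable_snd).inter
          (measurableSet_le measurable_snd measurable_fst)
    have h1 := hint.lintegral_prod_right' (ν := volume)
    convert h1 using 2 with t
    rw [← lintegral_indicator measurableSet_Ioc]
    rfl

/-- The `n`-th Picard approximation of the semigroup applied to a nonnegative function. -/
def picard (q : E → E → ℝ≥0∞) (f : E → ℝ≥0∞) (n : ℕ) (t : ℝ) (x : E) : ℝ≥0∞ :=
  ∑' y, transProbAux q n t x y * f y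

open Classical in
lemma tsum_ite_mul (c : ℝ≥0∞) (f : E → ℝ≥0∞) (x : E) :
    ∑' y, (if x = y then c else 0) * f y = c * f x := by
  rw [tsum_eq_single x fun y hy => by rw [if_neg (Ne.symm hy), zero_mul], if_pos rfl]

lemma picard_zero (f : E → ℝ≥0∞) (t : ℝ) (x : E) :
    picard q f 0 t x = ENNReal.ofReal (Real.exp (-(exitRate q x).toReal * t)) * f x :=
  tsum_ite_mul _ f x

open Classical in
lemma picard_succ [Countable E] (f : E → ℝ≥0∞) (n : ℕ) (t : ℝ) (x : E) :
    picard q f (n + 1) t x = ENNReal.ofReal (Real.exp (-(exitRate q x).toReal * t)) * f x +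
      ∫⁻ s in Set.Ioc 0 t, ENNReal.ofReal (Real.exp (-(exitRate q x).toReal * s)) *
        ∑' z, (if z = x then 0 else q x z) * picard q f n (t - s) z := by
  have hm : ∀ y, Measurable fun s => ENNReal.ofReal (Real.exp (-(exitRate q x).toReal * s)) *
      ∑' z, (if z = x then 0 else q x z) * transProbAux q n (t - s) z y := fun y => by
    refine Measurable.mul (by fun_prop) (Measurable.tsum fun z => Measurable.const_mul ?_ _)
    exact (measurable_transProbAux q n z y).comp (measurable_const.sub measurable_id)
  simp only [picard, transProbAux, add_mul]
  rw [ENNReal.tsum_add, tsum_ite_mul]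
  congr 1
  simp_rw [← lintegral_mul_const _ (hm _)]
  rw [← lintegral_tsum fun y => ((hm y).mul_const _).aemeasurable]
  refine lintegral_congr fun s => ?_
  simp_rw [mul_assoc, ENNReal.tsum_mul_left]
  congr 1
  simp_rw [← ENNReal.tsum_mul_right, ← ENNReal.tsum_mul_left]
  rw [ENNReal.tsum_comm]
  simp_rw [mul_assoc]

lemma transProbAux_mono (q : E → E → ℝ≥0∞) (t : ℝ) (x y : E) :
    Monotone fun n => transProbAux q n t x y := by
  refine monotone_nat_of_le_succ fun n => ?_
  induction n generalizing t x y with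
  | zero => exact le_self_add
  | succ n ih =>
    refine add_le_add le_rfl (lintegral_mono fun s => ?_)
    gcongr
    exact ih _ _ _

lemma iSup_picard (f : E → ℝ≥0∞) (t : ℝ) (x : E) :
    ⨆ n, picard q f n t x = ∑' y, transProb q t x y * f y := by
  simp only [picard, transProb, ENNReal.iSup_mul]
  rw [ENNReal.tsum_eq_iSup_sum]
  simp_rw [ENNReal.tsum_eq_iSup_sum]
  rw [iSup_comm]
  congr 1; ext s
  rw [ENNReal.finsetSum_iSup_of_monotone]
  exact fun y m n h => mul_le_mul_left (transProbAux_mono q t x y h) _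

variable (hq : ∀ x, exitRate q x ≤ Λ)

lemma continuous_jumpSemigroup (f : Bdd E) : Continuous fun t => jumpSemigroup hq t f :=
  continuous_iff_continuousAt.2 fun t => (hasDerivAt_jumpSemigroup hq f t).continuousAt

lemma hasDerivAt_jumpSemigroup_apply (f : Bdd E) (t : ℝ) (x : E) :
    HasDerivAt (fun t => jumpSemigroup hq t f x) (jumpGen q Λ hq (jumpSemigroup hq t f) x) t :=
  (lp.evalCLM ℝ (fun _ : E => ℝ) ∞ x).hasFDerivAt.comp_hasDerivAt t
    (hasDerivAt_jumpSemigroup hq f t)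

lemma continuous_backward_integrand (f : Bdd E) (t : ℝ) (x : E) :
    Continuous fun s : ℝ => Real.exp (-(exitRate q x).toReal * s) *
      ∑' z, offRate q x z * jumpSemigroup hq (t - s) f z := by
  refine Continuous.mul (by fun_prop) ?_
  have h1 : Continuous fun s : ℝ => jumpSemigroup hq (t - s) f :=
    (continuous_jumpSemigroup hq f).comp (continuous_const.sub continuous_id)
  have h2 : ∀ s : ℝ, ∑' z, offRate q x z * jumpSemigroup hq (t - s) f z =
      lp.evalCLM ℝ (fun _ : E => ℝ) ∞ x (jumpGen q Λ hq (jumpSemigroup hq (t - s) f)) +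
      (exitRate q x).toReal * lp.evalCLM ℝ (fun _ : E => ℝ) ∞ x
        (jumpSemigroup hq (t - s) f) := fun s => by
    have := jumpGen_apply' hq (jumpSemigroup hq (t - s) f) x
    change _ = jumpGen q Λ hq (jumpSemigroup hq (t - s) f) x +
      (exitRate q x).toReal * jumpSemigroup hq (t - s) f x
    linarith
  simp_rw [h2]
  exact ((lp.evalCLM ℝ (fun _ : E => ℝ) ∞ x).continuous.comp
    ((jumpGen q Λ hq).continuous.comp h1)).add
    (((lp.evalCLM ℝ (fun _ : E => ℝ) ∞ x).continuous.comp h1).const_mul _)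

/-- The backward equation for the semigroup, integrated along the time of the first jump. -/
lemma jumpSemigroup_eq_integral (f : Bdd E) (t : ℝ) (x : E) :
    jumpSemigroup hq t f x = Real.exp (-(exitRate q x).toReal * t) * f x +
      ∫ s in 0..t, Real.exp (-(exitRate q x).toReal * s) *
        ∑' z, offRate q x z * jumpSemigroup hq (t - s) f z := by
  set r := (exitRate q x).toReal with hr
  have hG : ∀ s : ℝ, HasDerivAt (fun s => -(Real.exp (-r * s) * jumpSemigroup hq (t - s) f x))
      (Real.exp (-r * s) * ∑' z, offRate q x z * jumpSemigroup hq (t - s) f z) s := fun s => by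
    have h1 : HasDerivAt (fun s => Real.exp (-r * s)) (Real.exp (-r * s) * (-r)) s := by
      simpa using ((hasDerivAt_id s).const_mul (-r)).exp
    have h2 : HasDerivAt (fun s => jumpSemigroup hq (t - s) f x) _ s :=
      (hasDerivAt_jumpSemigroup_apply hq f (t - s) x).scomp s ((hasDerivAt_id s).const_sub t)
    refine (h1.mul h2).neg.congr_deriv ?_
    rw [jumpGen_apply', ← hr, smul_eq_mul]
    ring
  have := intervalIntegral.integral_eq_sub_of_hasDerivAt (a := 0) (b := t) (fun s _ => hG s)
    ((continuous_backward_integrand hq f t x).intervalIntegrable _ _)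
  rw [this]
  simp [jumpSemigroup_zero]

open Classical in
lemma ofReal_tsum_offRate_mul (hq : ∀ x, exitRate q x ≤ Λ) {g : Bdd E} (hg : ∀ x, 0 ≤ g x)
    (x : E) :
    ENNReal.ofReal (∑' z, offRate q x z * g z) =
      ∑' z, (if z = x then 0 else q x z) * ENNReal.ofReal (g z) := by
  rw [ENNReal.ofReal_tsum_of_nonneg (fun z => mul_nonneg (offRate_nonneg q x z) (hg z))
    (summable_offRate_mul hq x g)]
  refine tsum_congr fun z => ?_
  rw [ENNReal.ofReal_mul (offRate_nonneg q x z)]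
  congr 1
  exact ENNReal.ofReal_toReal (offRate_ne_top hq x z)

open Classical in
lemma ofReal_jumpSemigroup_eq {f : Bdd E} (hf : ∀ x, 0 ≤ f x) {t : ℝ}
    (ht : 0 ≤ t) (x : E) :
    ENNReal.ofReal (jumpSemigroup hq t f x) =
      ENNReal.ofReal (Real.exp (-(exitRate q x).toReal * t)) * ENNReal.ofReal (f x) +
      ∫⁻ s in Set.Ioc 0 t, ENNReal.ofReal (Real.exp (-(exitRate q x).toReal * s)) *
        ∑' z, (if z = x then 0 else q x z) * ENNReal.ofReal (jumpSemigroup hq (t - s) f z) := by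
  have hnn : ∀ s ∈ Set.Ioc 0 t, 0 ≤ Real.exp (-(exitRate q x).toReal * s) *
      ∑' z, offRate q x z * jumpSemigroup hq (t - s) f z := fun s hs =>
    mul_nonneg (Real.exp_pos _).le (tsum_nonneg fun z => mul_nonneg (offRate_nonneg q x z)
      (jumpSemigroup_nonneg hq (sub_nonneg.2 hs.2) hf z))
  rw [jumpSemigroup_eq_integral hq f t x, intervalIntegral.integral_of_le ht,
    ENNReal.ofReal_add (mul_nonneg (Real.exp_pos _).le (hf x))
      (setIntegral_nonneg measurableSet_Ioc hnn), ENNReal.ofReal_mul (Real.exp_pos _).le]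
  congr 1
  rw [ofReal_integral_eq_lintegral_ofReal]
  · refine setLIntegral_congr_fun measurableSet_Ioc fun s hs => ?_
    simp only
    rw [ENNReal.ofReal_mul (Real.exp_pos _).le, ofReal_tsum_offRate_mul hq
      (jumpSemigroup_nonneg hq (sub_nonneg.2 hs.2) hf)]
  · exact ((continuous_backward_integrand hq f t x).integrableOn_Ioc)
  · exact (ae_restrict_iff' measurableSet_Ioc).2 (ae_of_all _ hnn)

lemma picard_le_jumpSemigroup [Countable E] {f : Bdd E} (hf : ∀ x, 0 ≤ f x) (n : ℕ) {t : ℝ}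
    (ht : 0 ≤ t) (x : E) : picard q (fun y => ENNReal.ofReal (f y)) n t x ≤
      ENNReal.ofReal (jumpSemigroup hq t f x) := by
  induction n generalizing t x with
  | zero => rw [picard_zero, ofReal_jumpSemigroup_eq hq hf ht]; exact le_self_add
  | succ n ih =>
    rw [picard_succ, ofReal_jumpSemigroup_eq hq hf ht]
    refine add_le_add le_rfl (setLIntegral_mono' measurableSet_Ioc fun s hs => ?_)
    gcongr
    exact ih (sub_nonneg.2 hs.2) _

lemma lintegral_picard_error (C : ℝ≥0) (n : ℕ) {t : ℝ} (ht : 0 ≤ t) :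
    ∫⁻ s in Set.Ioc 0 t, (Λ : ℝ≥0∞) * ENNReal.ofReal (C * (Λ * (t - s)) ^ n / n.factorial) =
      ENNReal.ofReal (C * (Λ * t) ^ (n + 1) / (n + 1).factorial) := by
  have hd : ∀ s : ℝ, HasDerivAt (fun s => -(C * (Λ * (t - s)) ^ (n + 1) / (n + 1).factorial : ℝ))
      (Λ * (C * (Λ * (t - s)) ^ n / n.factorial)) s := fun s => by
    have h1 : HasDerivAt (fun s : ℝ => Λ * (t - s)) (Λ * (-1) : ℝ) s :=
      ((hasDerivAt_id s).const_sub t).const_mul _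
    refine (((h1.pow (n + 1)).const_mul (C : ℝ)).div_const _).neg.congr_deriv ?_
    rw [Nat.factorial_succ]
    push_cast
    field_simp
  have hc : Continuous fun s : ℝ => (Λ * (C * (Λ * (t - s)) ^ n / n.factorial) : ℝ) := by
    fun_prop
  have h := intervalIntegral.integral_eq_sub_of_hasDerivAt (a := 0) (b := t) (fun s _ => hd s)
    (hc.intervalIntegrable _ _)
  have h0 : -(C * (Λ * (t - t)) ^ (n + 1) / (n + 1).factorial : ℝ) -
      -(C * (Λ * (t - 0)) ^ (n + 1) / (n + 1).factorial : ℝ) =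
      C * (Λ * t) ^ (n + 1) / (n + 1).factorial := by simp
  rw [h0, intervalIntegral.integral_of_le ht] at h
  rw [← h, ofReal_integral_eq_lintegral_ofReal hc.integrableOn_Ioc]
  · refine lintegral_congr fun s => ?_
    rw [ENNReal.ofReal_mul Λ.coe_nonneg, ENNReal.ofReal_coe_nnreal]
  · refine (ae_restrict_iff' measurableSet_Ioc).2 (ae_of_all _ fun s hs => ?_)
    have : 0 ≤ t - s := sub_nonneg.2 hs.2
    simp only [Pi.zero_apply]
    positivity

/-- The Picard approximations converge at the rate of the exponential series. -/
lemma jumpSemigroup_le_picard_add [Countable E] {f : Bdd E} (hf : ∀ x, 0 ≤ f x) {C : ℝ≥0}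
    (hC : ∀ x, f x ≤ C) (n : ℕ) {t : ℝ} (ht : 0 ≤ t) (x : E) :
    ENNReal.ofReal (jumpSemigroup hq t f x) ≤ picard q (fun y => ENNReal.ofReal (f y)) n t x +
      ENNReal.ofReal (C * (Λ * t) ^ n / n.factorial) := by
  classical
  induction n generalizing t x with
  | zero =>
    refine le_add_left (ENNReal.ofReal_le_ofReal ?_)
    simpa using jumpSemigroup_le hq ht hC x
  | succ n ih =>
    have hmeas : Measurable fun s : ℝ =>
        (Λ : ℝ≥0∞) * ENNReal.ofReal (C * (Λ * (t - s)) ^ n / n.factorial) := by fun_prop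
    rw [picard_succ, ofReal_jumpSemigroup_eq hq hf ht, add_assoc,
      ← lintegral_picard_error C n ht, ← lintegral_add_right _ hmeas]
    refine add_le_add le_rfl (setLIntegral_mono' measurableSet_Ioc fun s hs => ?_)
    have hs' : 0 ≤ t - s := sub_nonneg.2 hs.2
    have hexp : ENNReal.ofReal (Real.exp (-(exitRate q x).toReal * s)) ≤ 1 := by
      rw [ENNReal.ofReal_le_one, Real.exp_le_one_iff]
      nlinarith [hs.1, ENNReal.toReal_nonneg (a := exitRate q x)]
    calc _ ≤ ENNReal.ofReal (Real.exp (-(exitRate q x).toReal * s)) *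
          ∑' z, (if z = x then 0 else q x z) *
            (picard q (fun y => ENNReal.ofReal (f y)) n (t - s) z +
              ENNReal.ofReal (C * (Λ * (t - s)) ^ n / n.factorial)) := by
          gcongr with z; exact ih hs' z
      _ = ENNReal.ofReal (Real.exp (-(exitRate q x).toReal * s)) *
          ∑' z, (if z = x then 0 else q x z) *
            picard q (fun y => ENNReal.ofReal (f y)) n (t - s) z +
          ENNReal.ofReal (Real.exp (-(exitRate q x).toReal * s)) * (exitRate q x *
              ENNReal.ofReal (C * (Λ * (t - s)) ^ n / n.factorial)) := by
          simp_rw [mul_add]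
          rw [ENNReal.tsum_add, mul_add, ENNReal.tsum_mul_right]
          rfl
      _ ≤ _ := by
          refine add_le_add le_rfl ?_
          calc _ ≤ 1 * (Λ * ENNReal.ofReal (C * (Λ * (t - s)) ^ n / n.factorial)) := by
                gcongr; exact hq x
            _ = _ := one_mul _

/-- The transition probabilities defined by counting jumps are the kernel of `exp (t A)`. -/
theorem tsum_transProb_mul [Countable E] {f : Bdd E} (hf : ∀ x, 0 ≤ f x) {t : ℝ}
    (ht : 0 ≤ t) (x : E) :
    ∑' y, transProb q t x y * ENNReal.ofReal (f y) = ENNReal.ofReal (jumpSemigroup hq t f x) := by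
  rw [← iSup_picard]
  refine le_antisymm (iSup_le fun n => picard_le_jumpSemigroup hq hf n ht x) ?_
  have hC : ∀ x, f x ≤ (⟨‖f‖, norm_nonneg f⟩ : ℝ≥0) := fun x =>
    (le_abs_self _).trans (f.abs_apply_le x)
  set C : ℝ≥0 := ⟨‖f‖, norm_nonneg f⟩
  have hlim : Tendsto (fun n : ℕ => (⨆ n, picard q (fun y => ENNReal.ofReal (f y)) n t x) +
      ENNReal.ofReal (C * (Λ * t) ^ n / n.factorial)) atTop
      (𝓝 ((⨆ n, picard q (fun y => ENNReal.ofReal (f y)) n t x) + ENNReal.ofReal (C * 0))) := by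
    refine Tendsto.const_add _ (ENNReal.tendsto_ofReal ?_)
    simp_rw [mul_div_assoc]
    exact (FloorSemiring.tendsto_pow_div_factorial_atTop _).const_mul _
  rw [mul_zero, ENNReal.ofReal_zero, add_zero] at hlim
  exact ge_of_tendsto' hlim fun n => (jumpSemigroup_le_picard_add hq hf hC n ht x).trans
    (add_le_add (le_iSup (fun n => picard q (fun y => ENNReal.ofReal (f y)) n t x) n) le_rfl)

end Transition

/-! ### Laws of the chain -/

section Laws

variable {E : Type*} [MeasurableSpace E] [DiscreteMeasurableSpace E]
  {q : E → E → ℝ≥0∞} {Λ : ℝ≥0} (hq : ∀ x, exitRate q x ≤ Λ)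

lemma lintegral_chainLaw [Countable E] {f : Bdd E} (hf : ∀ x, 0 ≤ f x) {t : ℝ}
    (ht : 0 ≤ t) (x : E) :
    ∫⁻ y, ENNReal.ofReal (f y) ∂chainLaw q t x = ENNReal.ofReal (jumpSemigroup hq t f x) := by
  rw [chainLaw, lintegral_sum_measure, ← tsum_transProb_mul hq hf ht]
  refine tsum_congr fun y => ?_
  rw [lintegral_smul_measure, lintegral_dirac, smul_eq_mul]

lemma lintegral_chainLawFrom [Countable E] {f : Bdd E} (hf : ∀ x, 0 ≤ f x) {t : ℝ} (ht : 0 ≤ t)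
    (μ : Measure E) : ∫⁻ y, ENNReal.ofReal (f y) ∂chainLawFrom q t μ =
      ∫⁻ x, ENNReal.ofReal (jumpSemigroup hq t f x) ∂μ := by
  rw [chainLawFrom, Measure.lintegral_bind Measurable.of_discrete.aemeasurable
    Measurable.of_discrete.aemeasurable]
  exact lintegral_congr fun x => lintegral_chainLaw hq hf ht x

theorem isProbabilityMeasure_chainLawFrom [Countable E] (hq : ∀ x, exitRate q x ≤ Λ) {t : ℝ}
    (ht : 0 ≤ t) (μ : Measure E) [IsProbabilityMeasure μ] :
    IsProbabilityMeasure (chainLawFrom q t μ) := by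
  constructor
  have := lintegral_chainLawFrom hq (f := 1) (fun _ => zero_le_one) ht μ
  simpa [jumpSemigroup_one] using this

lemma Bdd.integrable (f : Bdd E) (μ : Measure E) [IsFiniteMeasure μ] :
    Integrable (fun x => f x) μ :=
  Integrable.of_bound Measurable.of_discrete.aestronglyMeasurable ‖f‖
    (ae_of_all _ f.abs_apply_le)

theorem integral_chainLawFrom [Countable E] (f : Bdd E) {t : ℝ} (ht : 0 ≤ t) (μ : Measure E)
    [IsProbabilityMeasure μ] :
    ∫ y, f y ∂chainLawFrom q t μ = ∫ x, jumpSemigroup hq t f x ∂μ := by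
  have := isProbabilityMeasure_chainLawFrom hq ht μ
  have key : ∀ g : Bdd E, (∀ x, 0 ≤ g x) →
      ∫ y, g y ∂chainLawFrom q t μ = ∫ x, jumpSemigroup hq t g x ∂μ := fun g hg => by
    rw [integral_eq_lintegral_of_nonneg_ae (ae_of_all _ hg)
        Measurable.of_discrete.aestronglyMeasurable,
      integral_eq_lintegral_of_nonneg_ae (ae_of_all _ (jumpSemigroup_nonneg hq ht hg))
        Measurable.of_discrete.aestronglyMeasurable, lintegral_chainLawFrom hq hg ht]
  have h := key (f + ‖f‖ • 1) fun x => by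
    have := neg_le_of_abs_le (f.abs_apply_le x)
    simp only [Bdd.add_apply, Bdd.smul_apply, Bdd.one_apply]; linarith
  rw [map_add, map_smul, jumpSemigroup_one] at h
  simp only [Bdd.add_apply, Bdd.smul_apply, Bdd.one_apply, mul_one] at h
  rw [integral_add (f.integrable _) (integrable_const _),
    integral_add ((jumpSemigroup hq t f).integrable _) (integrable_const _)] at h
  simpa using h

lemma chainLawFrom_dirac (q : E → E → ℝ≥0∞) (t : ℝ) (x : E) :
    chainLawFrom q t (Measure.dirac x) = chainLaw q t x :=
  Measure.dirac_bind Measurable.of_discrete x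

theorem isProbabilityMeasure_chainLaw [Countable E] (hq : ∀ x, exitRate q x ≤ Λ) {t : ℝ}
    (ht : 0 ≤ t) (x : E) :
    IsProbabilityMeasure (chainLaw q t x) := by
  rw [← chainLawFrom_dirac]; exact isProbabilityMeasure_chainLawFrom hq ht _

theorem integral_chainLaw [Countable E] (f : Bdd E) {t : ℝ} (ht : 0 ≤ t) (x : E) :
    ∫ y, f y ∂chainLaw q t x = jumpSemigroup hq t f x := by
  rw [← chainLawFrom_dirac, integral_chainLawFrom hq f ht, integral_dirac]

end Laws

/-! ### Convergence in total variation -/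

section TotalVariation

variable {E : Type*}

open Classical in
/-- The indicator of a point. -/
def Bdd.single (ξ : E) : Bdd E := Bdd.mk (fun x => if x = ξ then 1 else 0) 1 fun x => by
  split_ifs <;> simp

lemma Bdd.abs_single_le (ξ x : E) : |Bdd.single ξ x| ≤ 1 := by
  unfold Bdd.single; rw [Bdd.mk_apply]; split_ifs <;> simp

variable [Countable E] [MeasurableSpace E] [DiscreteMeasurableSpace E]

lemma Bdd.integral_single (ξ : E) (μ : Measure E) [IsFiniteMeasure μ] :
    ∫ x, Bdd.single ξ x ∂μ = μ.real {ξ} := by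
  classical
  rw [← integral_indicator_one (measurableSet_singleton ξ)]
  refine integral_congr_ae (ae_of_all _ fun x => ?_)
  simp [Bdd.single, Set.indicator_apply]

lemma ext_of_integral_bdd {μ ν : Measure E} [IsFiniteMeasure μ] [IsFiniteMeasure ν]
    (h : ∀ f : Bdd E, (∀ x, |f x| ≤ 1) → ∫ x, f x ∂μ = ∫ x, f x ∂ν) : μ = ν := by
  refine Measure.ext_of_singleton fun ξ => ?_
  have := h (Bdd.single ξ) (Bdd.abs_single_le ξ)
  rw [Bdd.integral_single, Bdd.integral_single] at this
  exact (measureReal_eq_measureReal_iff).1 this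

lemma hasSum_integral_bdd (f : Bdd E) (μ : Measure E) [IsFiniteMeasure μ] :
    HasSum (fun x => μ.real {x} * f x) (∫ x, f x ∂μ) := by
  rw [integral_countable (f.integrable μ)]
  refine (Summable.hasSum ?_)
  refine summable_mul_of_bdd ?_ (fun _ => measureReal_nonneg) f.abs_apply_le
  refine ENNReal.summable_toReal ?_
  have := Measure.tsum_indicator_apply_singleton μ Set.univ MeasurableSet.univ
  rw [Set.indicator_univ] at this
  rw [this]
  exact measure_ne_top μ _

/-- A sequence of probability measures that is Cauchy in total variation converges. -/
theorem exists_limit_of_cauchy_tv (μ : ℕ → Measure E) [∀ n, IsProbabilityMeasure (μ n)]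
    {ε : ℕ → ℝ} (hε : Tendsto ε atTop (𝓝 0))
    (h : ∀ f : Bdd E, (∀ x, |f x| ≤ 1) → ∀ m n, n ≤ m →
      |∫ x, f x ∂μ m - ∫ x, f x ∂μ n| ≤ ε n) :
    ∃ ν : Measure E, IsProbabilityMeasure ν ∧
      ∀ f : Bdd E, Tendsto (fun n => ∫ x, f x ∂μ n) atTop (𝓝 (∫ x, f x ∂ν)) := by
  have hconv : ∀ f : Bdd E, (∀ x, |f x| ≤ 1) → ∃ l, Tendsto (fun n => ∫ x, f x ∂μ n) atTop (𝓝 l) ∧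
      ∀ n, |∫ x, f x ∂μ n - l| ≤ ε n := fun f hf => by
    have hle : ∀ n m, n ≤ m → dist (∫ x, f x ∂μ n) (∫ x, f x ∂μ m) ≤ ε n := fun n m hnm => by
      rw [dist_comm, Real.dist_eq]; exact h f hf m n hnm
    obtain ⟨l, hl⟩ := cauchySeq_tendsto_of_complete (cauchySeq_of_le_tendsto_0' ε hle hε)
    refine ⟨l, hl, fun n => ?_⟩
    refine le_of_tendsto ((hl.const_sub (∫ x, f x ∂μ n)).abs) ?_
    filter_upwards [eventually_ge_atTop n] with m hm
    exact hle n m hm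
  choose p hp _ using fun ξ => hconv (Bdd.single ξ) (Bdd.abs_single_le ξ)
  simp_rw [Bdd.integral_single] at hp
  have hp0 : ∀ ξ, 0 ≤ p ξ := fun ξ => ge_of_tendsto' (hp ξ) fun n => measureReal_nonneg
  -- the limit of the integrals of `f` is the integral of `f` against the limit of the weights
  have hsum : ∀ (f : Bdd E), (∀ x, |f x| ≤ 1) → ∀ l, Tendsto (fun n => ∫ x, f x ∂μ n) atTop (𝓝 l) →
      (∀ n, |∫ x, f x ∂μ n - l| ≤ ε n) → HasSum (fun x => p x * f x) l := by
    intro f hf l hl hln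
    classical
    rw [HasSum, Metric.tendsto_nhds]
    intro r hr
    obtain ⟨n, hn⟩ := (hε.eventually (gt_mem_nhds (show (0 : ℝ) < r / 4 by positivity))).exists
    filter_upwards [(Metric.tendsto_nhds.1 (hasSum_integral_bdd f (μ n))) (r / 4) (by positivity)]
      with s hs
    set g : Bdd E := Bdd.mk (fun x => if x ∈ s then f x else 0) 1 fun x => by
      split_ifs
      · exact hf x
      · simp
    have hg : ∀ m, ∫ x, g x ∂μ m = ∑ x ∈ s, (μ m).real {x} * f x := fun m => by
      refine (hasSum_integral_bdd g (μ m)).unique ?_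
      have := hasSum_sum_of_ne_finset_zero (L := .unconditional E)
        (f := fun x => (μ m).real {x} * g x) (s := s) fun x hx => by simp [g, hx]
      convert this using 1
      exact Finset.sum_congr rfl fun x hx => by simp [g, hx]
    have hgl : Tendsto (fun m => ∫ x, g x ∂μ m) atTop (𝓝 (∑ x ∈ s, p x * f x)) := by
      simp_rw [hg]
      exact tendsto_finsetSum _ fun x _ => (hp x).mul_const _
    obtain ⟨l', hl', hln'⟩ := hconv g fun x => by
      simp only [g, Bdd.mk_apply]; split_ifs
      · exact hf x
      · simp
    have h1 := hln' n
    rw [tendsto_nhds_unique hl' hgl, hg] at h1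
    rw [Real.dist_eq] at hs ⊢
    have h2 := hln n
    rw [abs_le] at h1 h2
    rw [abs_lt] at hs ⊢
    constructor <;> linarith
  have hone : ∀ x : E, |(1 : Bdd E) x| ≤ 1 := fun x => by simp
  have hp1 : HasSum p 1 := by
    obtain ⟨l, hl, hln⟩ := hconv 1 hone
    have h1 : l = 1 := tendsto_nhds_unique hl (by simp)
    simpa [h1] using hsum 1 hone l hl hln
  set ν : Measure E := Measure.sum fun x => ENNReal.ofReal (p x) • Measure.dirac x with hν
  have hνs : ∀ x, ν {x} = ENNReal.ofReal (p x) := fun x => Measure.sum_smul_dirac_singleton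
  have hprob : IsProbabilityMeasure ν := by
    constructor
    have := Measure.tsum_indicator_apply_singleton ν Set.univ MeasurableSet.univ
    rw [Set.indicator_univ] at this
    rw [← this]
    simp_rw [hνs]
    rw [← ENNReal.ofReal_tsum_of_nonneg hp0 hp1.summable, hp1.tsum_eq, ENNReal.ofReal_one]
  have hlim : ∀ f : Bdd E, (∀ x, |f x| ≤ 1) →
      Tendsto (fun n => ∫ x, f x ∂μ n) atTop (𝓝 (∫ x, f x ∂ν)) := fun f hf => by
    obtain ⟨l, hl, hln⟩ := hconv f hf
    convert hl using 2
    refine (hasSum_integral_bdd f ν).unique ?_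
    convert hsum f hf l hl hln using 3 with x
    rw [measureReal_def, hνs, ENNReal.toReal_ofReal (hp0 x)]
  refine ⟨ν, hprob, fun f => ?_⟩
  have hc : 0 < ‖f‖ + 1 := by positivity
  have h1 := (hlim ((‖f‖ + 1)⁻¹ • f) fun x => by
    rw [Bdd.smul_apply, abs_mul, abs_of_pos (inv_pos.2 hc), inv_mul_le_iff₀ hc]
    linarith [f.abs_apply_le x]).const_mul (‖f‖ + 1)
  simp only [Bdd.smul_apply, integral_const_mul] at h1
  simpa only [mul_inv_cancel_left₀ hc.ne'] using h1

end TotalVariation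

/-! ### The killed chain -/

lemma tsum_option {S : Type*} {f : Option S → ℝ} (hf : Summable f) :
    ∑' o, f o = f none + ∑' s, f (some s) := by
  classical
  rw [hf.tsum_eq_add_tsum_ite none, ← (Option.some_injective S).tsum_eq]
  · simp
  · intro o ho
    cases o with
    | none => simp at ho
    | some s => exact ⟨s, rfl⟩

lemma tsum_option_ennreal {S : Type*} (f : Option S → ℝ≥0∞) :
    ∑' o, f o = f none + ∑' s, f (some s) := by
  classical
  rw [ENNReal.tsum_eq_add_tsum_ite none, ← (Option.some_injective S).tsum_eq]
  · simp
  · intro o ho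
    cases o with
    | none => simp at ho
    | some s => exact ⟨s, rfl⟩

section Killed

variable {S : Type*} {Q : S → S → ℝ≥0} {p₀ : S → ℝ≥0}

open Classical in
/-- The rate `Q i j` as a real number, set to zero on the diagonal. -/
def offQ (Q : S → S → ℝ≥0) (i j : S) : ℝ := if j = i then 0 else (Q i j : ℝ)

lemma offQ_nonneg (Q : S → S → ℝ≥0) (i j : S) : 0 ≤ offQ Q i j := by
  unfold offQ; split_ifs <;> simp

lemma offQ_eq_toReal (i j : S) : offQ Q i j =
    (open Classical in if j = i then 0 else (Q i j : ℝ≥0∞)).toReal := by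
  unfold offQ; split_ifs <;> simp

/-- `Q₁ + p` bounds the total jump rates of the killed chain. -/
def killedBound (Q : S → S → ℝ≥0) (p₀ : S → ℝ≥0) : ℝ≥0 :=
  (supRate Q).toNNReal + (supKill p₀).toNNReal

lemma coe_killedBound (hA : BoundedRates Q p₀) :
    (killedBound Q p₀ : ℝ≥0∞) = supRate Q + supKill p₀ := by
  rw [killedBound, ENNReal.coe_add, ENNReal.coe_toNNReal hA.1.ne, ENNReal.coe_toNNReal hA.2.ne]

lemma killedBound_real : (killedBound Q p₀ : ℝ) = (supRate Q).toReal + (supKill p₀).toReal := rfl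

lemma exitRate_killedRate_le (hA : BoundedRates Q p₀) (o : Option S) :
    exitRate (killedRate Q p₀) o ≤ killedBound Q p₀ := by
  classical
  rw [coe_killedBound hA]
  cases o with
  | none => simp [exitRate, killedRate]
  | some i =>
    rw [exitRate, tsum_option_ennreal, add_comm]
    refine add_le_add ?_ ?_
    · refine le_trans (le_of_eq ?_) (le_iSup _ i)
      refine tsum_congr fun j => ?_
      simp [killedRate]
    · simpa [killedRate, supKill] using le_iSup (fun i => (p₀ i : ℝ≥0∞)) i

lemma summable_offQ (hA : BoundedRates Q p₀) (i : S) : Summable (offQ Q i) := by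
  simp_rw [funext (offQ_eq_toReal (Q := Q) i)]
  exact ENNReal.summable_toReal (((le_iSup _ i).trans_lt hA.1).ne)

lemma tsum_offQ_le (hA : BoundedRates Q p₀) (i : S) : ∑' j, offQ Q i j ≤ (supRate Q).toReal := by
  classical
  simp_rw [offQ_eq_toReal]
  have h : ∑' j, (if j = i then 0 else (Q i j : ℝ≥0∞)) ≤ supRate Q :=
    le_iSup (fun i => ∑' j, (if j = i then 0 else (Q i j : ℝ≥0∞))) i
  have hne := (h.trans_lt hA.1).ne
  rw [← ENNReal.tsum_toReal_eq fun j => ENNReal.ne_top_of_tsum_ne_top hne j]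
  exact ENNReal.toReal_mono hA.1.ne h

lemma kill_le (hA : BoundedRates Q p₀) (i : S) : (p₀ i : ℝ) ≤ (supKill p₀).toReal := by
  have := ENNReal.toReal_mono hA.2.ne (le_iSup (fun i => (p₀ i : ℝ≥0∞)) i)
  simpa using this

lemma infKill_le (i : S) : (infKill p₀).toReal ≤ p₀ i := by
  have := ENNReal.toReal_mono (ENNReal.coe_ne_top (r := p₀ i)) (iInf_le (fun i => (p₀ i : ℝ≥0∞)) i)
  exact this

/-- The generator of the killed chain, on bounded functions on `Option S`. -/
abbrev killedGen (hA : BoundedRates Q p₀) : Bdd (Option S) →L[ℝ] Bdd (Option S) :=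
  jumpGen (killedRate Q p₀) (killedBound Q p₀) (exitRate_killedRate_le hA)

lemma killedGen_some (hA : BoundedRates Q p₀) (f : Bdd (Option S)) (i : S) :
    killedGen hA f (some i) =
      ∑' j, offQ Q i j * (f (some j) - f (some i)) + p₀ i * (f none - f (some i)) := by
  rw [jumpGen_apply, tsum_option (summable_offRate_mul_sub (exitRate_killedRate_le hA) _ f),
    add_comm]
  congr 1
  · refine tsum_congr fun j => ?_
    by_cases h : j = i
    · simp [h]
    · simp [offRate, offQ, killedRate, h]
  · simp [offRate, killedRate]

lemma killedGen_none (hA : BoundedRates Q p₀) (f : Bdd (Option S)) :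
    killedGen hA f none = 0 := by
  rw [jumpGen_apply]
  simp [offRate, killedRate]

end Killed

/-! ### Coupling estimates -/

section Coupling

variable {S : Type*} {Q : S → S → ℝ≥0} {p₀ : S → ℝ≥0}

/-- Two particles at height `u` and `u'` that jump to the same height `v` at rates `a` and `b` can
be made to jump together at any rate `m ≤ min a b`. -/
lemma coupling_scalar {a b m u u' v L : ℝ} (hm : 0 ≤ m) (hma : m ≤ a) (hmb : m ≤ b)
    (h1 : v - u' ≤ L) (h2 : u - v ≤ L) (hD : u - u' ≤ L) :
    a * (v - u) - b * (v - u') ≤ -m * L + (a + b + m) * (L - (u - u')) := by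
  nlinarith [mul_nonneg (sub_nonneg.2 hma) (sub_nonneg.2 h1),
    mul_nonneg (sub_nonneg.2 hmb) (sub_nonneg.2 h2), mul_nonneg hm (sub_nonneg.2 hD)]

lemma offQ_self (i : S) : offQ Q i i = 0 := by simp [offQ]

open Classical in
/-- The rates at which the coupled motions of two particles at `i` and `i'` meet at `j`. -/
def meetRate (Q : S → S → ℝ≥0) (i i' j : S) : ℝ :=
  if j = i ∨ j = i' then offQ Q i j + offQ Q i' j else min (offQ Q i j) (offQ Q i' j)

lemma meetRate_nonneg (i i' j : S) : 0 ≤ meetRate Q i i' j := by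
  unfold meetRate
  have := offQ_nonneg Q i j; have := offQ_nonneg Q i' j
  split_ifs <;> positivity

lemma meetRate_le (i i' j : S) : meetRate Q i i' j ≤ offQ Q i j + offQ Q i' j := by
  unfold meetRate
  have := offQ_nonneg Q i j; have := offQ_nonneg Q i' j
  split_ifs
  · exact le_rfl
  · exact (min_le_left _ _).trans (by linarith)

lemma summable_meetRate (hA : BoundedRates Q p₀) (i i' : S) : Summable (meetRate Q i i') :=
  Summable.of_nonneg_of_le (meetRate_nonneg i i') (meetRate_le i i')
    ((summable_offQ hA i).add (summable_offQ hA i'))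

lemma tsum_meetRate_le (hA : BoundedRates Q p₀) (i i' : S) :
    ∑' j, meetRate Q i i' j ≤ 2 * (supRate Q).toReal := by
  refine ((summable_meetRate hA i i').tsum_le_tsum (meetRate_le i i')
    ((summable_offQ hA i).add (summable_offQ hA i'))).trans ?_
  rw [(summable_offQ hA i).tsum_add (summable_offQ hA i')]
  linarith [tsum_offQ_le hA i, tsum_offQ_le hA i']

lemma lam_le_tsum_meetRate (hA : BoundedRates Q p₀) {i i' : S} (h : i ≠ i') :
    (lam Q).toReal ≤ ∑' j, meetRate Q i i' j := by
  classical
  have h1 : lam Q ≤ ∑' j, ENNReal.ofReal (meetRate Q i i' j) := by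
    refine (iInf₂_le_of_le i i' (iInf_le_of_le h le_rfl)).trans ?_
    have hR : ∑' j, ENNReal.ofReal (meetRate Q i i' j) =
        ENNReal.ofReal (meetRate Q i i' i') + ENNReal.ofReal (meetRate Q i i' i) + ∑' j,
          if j = i then 0 else if j = i' then 0 else ENNReal.ofReal (meetRate Q i i' j) := by
      rw [ENNReal.tsum_eq_add_tsum_ite i', ENNReal.tsum_eq_add_tsum_ite i, if_neg h, add_assoc]
    rw [hR]
    refine add_le_add (add_le_add ?_ ?_) (ENNReal.tsum_le_tsum fun j => ?_)
    · simp [meetRate, offQ, h.symm]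
    · simp [meetRate, offQ, h]
    · by_cases h1 : j = i
      · simp [h1]
      by_cases h2 : j = i'
      · simp [h2]
      simp only [h1, h2, or_self, if_false, meetRate, offQ, ENNReal.ofReal_min,
        ENNReal.ofReal_coe_nnreal, le_refl]
  rw [← ENNReal.toReal_ofReal (tsum_nonneg (meetRate_nonneg i i')),
    ENNReal.ofReal_tsum_of_nonneg (meetRate_nonneg i i') (summable_meetRate hA i i')]
  refine ENNReal.toReal_mono ?_ h1
  rw [← ENNReal.ofReal_tsum_of_nonneg (meetRate_nonneg i i') (summable_meetRate hA i i')]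
  exact ENNReal.ofReal_ne_top

lemma lam_le_two_supRate [Nontrivial S] (hA : BoundedRates Q p₀) :
    (lam Q).toReal ≤ 2 * (supRate Q).toReal := by
  obtain ⟨i, i', h⟩ := exists_pair_ne S
  exact (lam_le_tsum_meetRate hA h).trans (tsum_meetRate_le hA i i')

/-- Two particles at `i ≠ i'` can be coupled so as to meet at rate at least `lam Q`. Here `v` is a
function of the position of a particle whose oscillation is at most `L`; as long as
`v i - v i'` is close to `L`, it decreases at rate `lam Q`. -/
lemma coupling_tsum (hA : BoundedRates Q p₀) {i i' : S} (h : i ≠ i') {v : S → ℝ} {C L : ℝ}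
    (hC : ∀ j, |v j| ≤ C) (hL : ∀ j k, v j - v k ≤ L) :
    ∑' j, offQ Q i j * (v j - v i) - ∑' j, offQ Q i' j * (v j - v i') ≤
      -(lam Q).toReal * L + 4 * (supRate Q).toReal * (L - (v i - v i')) := by
  have hD : 0 ≤ L - (v i - v i') := sub_nonneg.2 (hL i i')
  have hL0 : 0 ≤ L := by simpa using hL i i
  have hsub : ∀ k j, |v j - v k| ≤ 2 * C := fun k j =>
    (abs_sub _ _).trans (by linarith [hC j, hC k])
  have s1 := summable_mul_of_bdd (summable_offQ hA i) (offQ_nonneg Q i) (hsub i)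
  have s2 := summable_mul_of_bdd (summable_offQ hA i') (offQ_nonneg Q i') (hsub i')
  have sm := summable_meetRate hA i i'
  have sq := (summable_offQ hA i).add (summable_offQ hA i')
  rw [← s1.tsum_sub s2]
  calc _ ≤ ∑' j, (-(meetRate Q i i' j) * L + meetRate Q i i' j * (L - (v i - v i')) +
        (offQ Q i j + offQ Q i' j) * (L - (v i - v i'))) := by
        refine (s1.sub s2).tsum_le_tsum (fun j => ?_)
          (((sm.neg.mul_right L).add (sm.mul_right _)).add (sq.mul_right _))
        have ha := offQ_nonneg Q i j
        have hb := offQ_nonneg Q i' j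
        unfold meetRate
        split_ifs with hj
        · have hab := mul_nonneg (add_nonneg ha hb) hD
          rcases hj with rfl | rfl
          · rw [offQ_self] at *; linarith
          · rw [offQ_self] at *; linarith
        · have := coupling_scalar (le_min ha hb) (min_le_left _ _) (min_le_right _ _)
            (hL j i') (hL i j) (hL i i')
          linarith
    _ = (∑' j, meetRate Q i i' j) * (-L) + (∑' j, meetRate Q i i' j) * (L - (v i - v i')) +
        (∑' j, offQ Q i j + ∑' j, offQ Q i' j) * (L - (v i - v i')) := by
        rw [((sm.neg.mul_right L).add (sm.mul_right _)).tsum_add (sq.mul_right _),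
          (sm.neg.mul_right L).tsum_add (sm.mul_right _), tsum_mul_right, tsum_mul_right,
          tsum_mul_right, (summable_offQ hA i).tsum_add (summable_offQ hA i'), tsum_neg]
        ring
    _ ≤ (lam Q).toReal * (-L) + 2 * (supRate Q).toReal * (L - (v i - v i')) +
        ((supRate Q).toReal + (supRate Q).toReal) * (L - (v i - v i')) := by
        have h1 := mul_le_mul_of_nonneg_right (lam_le_tsum_meetRate hA h) hL0
        have h2 := mul_le_mul_of_nonneg_right (tsum_meetRate_le hA i i') hD
        have h3 := mul_le_mul_of_nonneg_right (add_le_add (tsum_offQ_le hA i)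
          (tsum_offQ_le hA i')) hD
        linarith
    _ = _ := by ring

end Coupling

/-! ### Contraction for the killed chain -/

section KilledContraction

variable {S : Type*} {Q : S → S → ℝ≥0} {p₀ : S → ℝ≥0} (hA : BoundedRates Q p₀) {δ : ℝ}

/-- A bound for the rates of the couplings of the killed chain. Meshes `δ` with
`δ * meshBound ≤ 1 / 2` are fine enough for all one-step estimates. -/
def meshBound (Q : S → S → ℝ≥0) (p₀ : S → ℝ≥0) : ℝ :=
  4 * (supRate Q).toReal + 3 * (supKill p₀).toReal

/-- Euler step of the killed chain. -/
abbrev killedStep (δ : ℝ) : Bdd (Option S) →L[ℝ] Bdd (Option S) :=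
  eulerStep (exitRate_killedRate_le hA) δ

lemma killedStep_some (f : Bdd (Option S)) (i : S) : killedStep hA δ f (some i) = f (some i) +
    δ * (∑' j, offQ Q i j * (f (some j) - f (some i)) + p₀ i * (f none - f (some i))) := by
  rw [← killedGen_some hA]; rfl

lemma killedStep_none (f : Bdd (Option S)) : killedStep hA δ f none = f none := by
  change f none + δ * killedGen hA f none = _
  rw [killedGen_none, mul_zero, add_zero]

lemma killedStep_pow_none (n : ℕ) (f : Bdd (Option S)) :
    (killedStep hA δ ^ n) f none = f none := by
  induction n with
  | zero => rfl
  | succ n ih => rw [eulerStep_pow_succ, killedStep_none hA, ih]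

lemma mul_killedBound_le (hδ0 : 0 ≤ δ) (hδ : δ * meshBound Q p₀ ≤ 1 / 2) :
    δ * killedBound Q p₀ ≤ 1 / 2 := by
  refine le_trans (mul_le_mul_of_nonneg_left ?_ hδ0) hδ
  rw [killedBound_real, meshBound]
  linarith [ENNReal.toReal_nonneg (a := supRate Q), ENNReal.toReal_nonneg (a := supKill p₀)]

lemma infKill_le_supKill [Nonempty S] (hA : BoundedRates Q p₀) :
    (infKill p₀).toReal ≤ (supKill p₀).toReal := by
  obtain ⟨i⟩ := ‹Nonempty S›
  exact (infKill_le i).trans (kill_le hA i)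

/-- One step of the killed chain contracts the oscillation of a function that vanishes at the
cemetery, the oscillation being computed with the cemetery included. -/
lemma killedStep_sub_le [Nontrivial S] (hδ0 : 0 ≤ δ) (hδ : δ * meshBound Q p₀ ≤ 1 / 2)
    {f : Bdd (Option S)} {L : ℝ} (hL : ∀ a b, f a - f b ≤ L) (x y : S) :
    killedStep hA δ f (some x) - killedStep hA δ f (some y) ≤
      (1 - δ * ((lam Q).toReal + (infKill p₀).toReal)) * L := by
  have hL0 : 0 ≤ L := by simpa using hL none none
  have hQ := ENNReal.toReal_nonneg (a := supRate Q)
  have hp := ENNReal.toReal_nonneg (a := supKill p₀)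
  have hpi := ENNReal.toReal_nonneg (a := infKill p₀)
  have hps := infKill_le_supKill hA
  unfold meshBound at hδ
  have hδQ := mul_nonneg hδ0 hQ
  have hδp := mul_nonneg hδ0 hp
  by_cases h : x = y
  · subst h
    rw [sub_self]
    refine mul_nonneg ?_ hL0
    have h1 := mul_le_mul_of_nonneg_left (lam_le_two_supRate hA) hδ0
    have h2 := mul_le_mul_of_nonneg_left hps hδ0
    linarith
  · have h1 := coupling_tsum hA h (v := fun j => f (some j)) (fun j => f.abs_apply_le _)
      (fun j k => hL _ _)
    have h2 := coupling_scalar hpi (infKill_le (p₀ := p₀) x) (infKill_le (p₀ := p₀) y)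
      (hL none (some y)) (hL (some x) none) (hL (some x) (some y))
    have hD : 0 ≤ L - (f (some x) - f (some y)) := sub_nonneg.2 (hL _ _)
    have h3 : (p₀ x + p₀ y + (infKill p₀).toReal) * (L - (f (some x) - f (some y))) ≤
        3 * (supKill p₀).toReal * (L - (f (some x) - f (some y))) :=
      mul_le_mul_of_nonneg_right (by linarith [kill_le hA x, kill_le hA y]) hD
    have h4 := mul_le_mul_of_nonneg_left (add_le_add h1 (h2.trans (add_le_add le_rfl h3))) hδ0
    have h5 := mul_le_mul_of_nonneg_right hδ hD
    simp only at h4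
    rw [killedStep_some, killedStep_some]
    linarith

lemma exists_nonneg_of_killedStep (hδ0 : 0 ≤ δ) (hδ : δ * meshBound Q p₀ ≤ 1 / 2)
    {f : Bdd (Option S)} (hf : f none = 0) (h : ∃ x, 0 ≤ killedStep hA δ f (some x)) :
    ∃ x, 0 ≤ f (some x) := by
  by_contra! hneg
  obtain ⟨x, hx⟩ := h
  have hq := exitRate_killedRate_le hA
  have h1 : killedStep hA δ f (some x) =
      (1 - δ * (exitRate (killedRate Q p₀) (some x)).toReal) * f (some x) +
        δ * ∑' z, offRate (killedRate Q p₀) (some x) z * f z := by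
    change f (some x) + δ * jumpGen _ _ hq f (some x) = _
    rw [jumpGen_apply']; ring
  have h2 : ∑' z, offRate (killedRate Q p₀) (some x) z * f z ≤ 0 := by
    refine tsum_nonpos fun z => mul_nonpos_of_nonneg_of_nonpos (offRate_nonneg _ _ _) ?_
    cases z with
    | none => exact hf.le
    | some z => exact (hneg z).le
  have h3 : δ * (exitRate (killedRate Q p₀) (some x)).toReal ≤ 1 / 2 :=
    (mul_le_mul_of_nonneg_left (exitRate_toReal_le hq _) hδ0).trans (mul_killedBound_le hδ0 hδ)
  have h4 := mul_nonpos_of_nonneg_of_nonpos hδ0 h2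
  have h5 : (1 - δ * (exitRate (killedRate Q p₀) (some x)).toReal) * f (some x) < 0 :=
    mul_neg_of_pos_of_neg (by linarith) (hneg x)
  linarith

/-- Oscillation on `S` of a function that takes both signs on `S` bounds the oscillation with the
value `0` at the cemetery included. -/
lemma sub_le_of_both_signs {f : Bdd (Option S)} {L : ℝ} (hf : f none = 0)
    (hL : ∀ x y : S, f (some x) - f (some y) ≤ L) (h1 : ∃ x, 0 ≤ f (some x))
    (h2 : ∃ x, f (some x) ≤ 0) (a b : Option S) : f a - f b ≤ L := by
  obtain ⟨x, hx⟩ := h1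
  obtain ⟨y, hy⟩ := h2
  cases a with
  | none => cases b with
    | none => have := hL x x; rw [hf]; linarith
    | some b => have := hL x b; rw [hf]; linarith
  | some a => cases b with
    | none => have := hL a y; rw [hf]; linarith
    | some b => exact hL a b

/-- As long as the image of `f` takes both signs, the killed chain contracts the oscillation of `f`
on `S`: a function of one sign before the last step has an image of one sign, so the images of
`f` take both signs at all earlier times. -/
lemma killedStep_pow_sub_le [Nontrivial S] (hδ0 : 0 ≤ δ) (hδ : δ * meshBound Q p₀ ≤ 1 / 2)
    {f : Bdd (Option S)} {L : ℝ} (hf : f none = 0) (hL : ∀ x y : S, f (some x) - f (some y) ≤ L)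
    (n : ℕ) (h1 : ∃ x, 0 ≤ (killedStep hA δ ^ n) f (some x))
    (h2 : ∃ x, (killedStep hA δ ^ n) f (some x) ≤ 0) (x y : S) :
    (killedStep hA δ ^ n) f (some x) - (killedStep hA δ ^ n) f (some y) ≤
      (1 - δ * ((lam Q).toReal + (infKill p₀).toReal)) ^ n * L := by
  induction n generalizing x y with
  | zero => simpa using hL x y
  | succ n ih =>
    rw [eulerStep_pow_succ] at h1 h2 ⊢
    have hg : (killedStep hA δ ^ n) f none = 0 := by rw [killedStep_pow_none, hf]
    have h1' := exists_nonneg_of_killedStep hA hδ0 hδ hg h1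
    have h2' : ∃ x, (killedStep hA δ ^ n) f (some x) ≤ 0 := by
      obtain ⟨z, hz⟩ := exists_nonneg_of_killedStep hA hδ0 hδ
        (f := -(killedStep hA δ ^ n) f) (neg_eq_zero.2 hg) (by
          obtain ⟨z, hz⟩ := h2
          exact ⟨z, by rw [map_neg]; exact neg_nonneg.2 hz⟩)
      exact ⟨z, neg_nonneg.1 hz⟩
    rw [pow_succ', mul_assoc]
    exact killedStep_sub_le hA hδ0 hδ (sub_le_of_both_signs hg (ih h1' h2') h1' h2') x y

/-- Extension of a bounded function on `S` by zero at the cemetery. -/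
def extendZero (φ : Bdd S) : Bdd (Option S) :=
  Bdd.mk (fun o => o.elim 0 φ) ‖φ‖ fun o => by
    cases o with
    | none => simp
    | some x => exact φ.abs_apply_le x

@[simp] lemma extendZero_none (φ : Bdd S) : extendZero φ none = 0 := rfl
@[simp] lemma extendZero_some (φ : Bdd S) (x : S) : extendZero φ (some x) = φ x := rfl

/-- The indicator of non-absorption. -/
abbrev alive (S : Type*) : Bdd (Option S) := extendZero 1

lemma killedStep_alive (x : S) : killedStep hA δ (alive S) (some x) = 1 - δ * p₀ x := by
  rw [killedStep_some]; simp; ring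

lemma killedStep_ge (hδ0 : 0 ≤ δ) (hδ : δ * meshBound Q p₀ ≤ 1 / 2) {h : Bdd (Option S)} {a : ℝ}
    (ha : 0 ≤ a) (h0 : h none = 0) (hh : ∀ x : S, a ≤ h (some x)) (x : S) :
    a * (1 - δ * (supKill p₀).toReal) ≤ killedStep hA δ h (some x) := by
  have h1 := eulerStep_mono (exitRate_killedRate_le hA) hδ0
    ((mul_killedBound_le hδ0 hδ).trans (by norm_num)) (f := a • alive S) (g := h) (fun o => by
      cases o with
      | none => simp [h0]
      | some x => simpa using hh x) (some x)
  rw [map_smul, Bdd.smul_apply, killedStep_alive hA] at h1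
  refine le_trans ?_ h1
  have := mul_le_mul_of_nonneg_left (kill_le hA x) hδ0
  exact mul_le_mul_of_nonneg_left (by linarith) ha

lemma mul_supKill_le (hδ0 : 0 ≤ δ) (hδ : δ * meshBound Q p₀ ≤ 1 / 2) :
    δ * (supKill p₀).toReal ≤ 1 / 2 := by
  refine le_trans (mul_le_mul_of_nonneg_left ?_ hδ0) hδ
  rw [meshBound]
  linarith [ENNReal.toReal_nonneg (a := supRate Q), ENNReal.toReal_nonneg (a := supKill p₀)]

lemma killedStep_pow_alive_ge (hδ0 : 0 ≤ δ) (hδ : δ * meshBound Q p₀ ≤ 1 / 2) (n : ℕ) (x : S) :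
    (1 - δ * (supKill p₀).toReal) ^ n ≤ (killedStep hA δ ^ n) (alive S) (some x) := by
  have h1 := mul_supKill_le hδ0 hδ
  induction n generalizing x with
  | zero => simp
  | succ n ih =>
    rw [eulerStep_pow_succ, pow_succ]
    exact killedStep_ge hA hδ0 hδ (pow_nonneg (by linarith) n)
      (by rw [killedStep_pow_none]; rfl) ih x

/-- The survival probabilities from any two points are comparable, uniformly in time. The constant
`r` solves `(sup p₀ - inf p₀) = r ρ`, the equilibrium between the rate at which different killing
rates separate the survival probabilities and the rate of the contraction. -/
lemma killedStep_pow_alive_sub_le [Nontrivial S] (hδ0 : 0 ≤ δ) (hδ : δ * meshBound Q p₀ ≤ 1 / 2)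
    {r : ℝ} (hr0 : 0 ≤ r)
    (hr : (supKill p₀).toReal - (infKill p₀).toReal ≤ r * rho Q p₀) (n : ℕ) (x y z : S) :
    (killedStep hA δ ^ n) (alive S) (some x) - (killedStep hA δ ^ n) (alive S) (some y) ≤
      r * (killedStep hA δ ^ n) (alive S) (some z) := by
  have h1 := mul_supKill_le hδ0 hδ
  induction n generalizing x y z with
  | zero => simpa using hr0
  | succ n ih =>
    rw [eulerStep_pow_succ]
    set h := (killedStep hA δ ^ n) (alive S) with hh
    have hn : h none = 0 := by rw [hh, killedStep_pow_none]; rfl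
    have hnn : ∀ x : S, 0 ≤ h (some x) := fun x =>
      (pow_nonneg (by linarith) n).trans (killedStep_pow_alive_ge hA hδ0 hδ n x)
    have hbdd : BddBelow (Set.range fun x : S => h (some x)) :=
      ⟨0, by rintro _ ⟨x, rfl⟩; exact hnn x⟩
    set a := ⨅ x : S, h (some x) with ha
    have ha0 : 0 ≤ a := le_ciInf hnn
    have hax : ∀ x : S, a ≤ h (some x) := fun x => ciInf_le hbdd x
    have hra : ∀ x : S, h (some x) - a ≤ r * a := fun x => by
      have h2 : ∀ z : S, h (some x) - a ≤ r * h (some z) := fun z => by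
        have : h (some x) - r * h (some z) ≤ a := le_ciInf fun y => by linarith [ih x y z]
        linarith
      rw [ha, Real.mul_iInf_of_nonneg hr0]
      exact le_ciInf h2
    have hw := killedStep_sub_le hA hδ0 hδ (f := h - a • alive S) (L := r * a) (fun b c => by
      have hb : ∀ o, 0 ≤ (h - a • alive S) o ∧ (h - a • alive S) o ≤ r * a := fun o => by
        cases o with
        | none => simpa [hn] using mul_nonneg hr0 ha0
        | some x => simpa using ⟨hax x, by linarith [hra x]⟩
      linarith [(hb b).2, (hb c).1]) x y
    rw [map_sub, map_smul] at hw
    simp only [Bdd.sub_apply, Bdd.smul_apply, killedStep_alive hA] at hw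
    have hz := killedStep_ge hA hδ0 hδ ha0 hn hax z
    have hz' := mul_le_mul_of_nonneg_left hz hr0
    have hpx := infKill_le (p₀ := p₀) x
    have hpy := kill_le hA y
    have h3 : a * δ * (p₀ y - p₀ x) ≤ a * δ * (r * rho Q p₀) :=
      mul_le_mul_of_nonneg_left (by linarith) (mul_nonneg ha0 hδ0)
    rw [rho] at h3
    linarith

lemma abs_killedStep_pow_le (hδ0 : 0 ≤ δ) (hδ : δ * meshBound Q p₀ ≤ 1 / 2) (n : ℕ)
    {φ : Bdd S} (hφ : ∀ x, |φ x| ≤ 1) (x : S) :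
    |(killedStep hA δ ^ n) (extendZero φ) (some x)| ≤ (killedStep hA δ ^ n) (alive S) (some x) := by
  have hΛ := (mul_killedBound_le hδ0 hδ).trans (show (1 / 2 : ℝ) ≤ 1 by norm_num)
  rw [abs_le]
  constructor
  · have := eulerStep_pow_mono (exitRate_killedRate_le hA) hδ0 hΛ (f := -alive S)
      (g := extendZero φ) (fun o => by
        cases o with
        | none => change -(0 : ℝ) ≤ 0; simp
        | some x => exact (abs_le.1 (hφ x)).1) n (some x)
    rwa [map_neg] at this
  · exact eulerStep_pow_mono (exitRate_killedRate_le hA) hδ0 hΛ (f := extendZero φ)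
      (g := alive S) (fun o => by
        cases o with
        | none => exact le_rfl
        | some x => exact (abs_le.1 (hφ x)).2) n (some x)

lemma half_le_killedStep (hδ0 : 0 ≤ δ) (hδ : δ * meshBound Q p₀ ≤ 1 / 2)
    {h : Bdd (Option S)} (hh : ∀ o, 0 ≤ h o) (o : Option S) : h o / 2 ≤ killedStep hA δ h o := by
  have hq := exitRate_killedRate_le hA
  have h1 : killedStep hA δ h o = (1 - δ * (exitRate (killedRate Q p₀) o).toReal) * h o +
        δ * ∑' z, offRate (killedRate Q p₀) o z * h z := by
    change h o + δ * jumpGen _ _ hq h o = _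
    rw [jumpGen_apply']; ring
  have h2 : 0 ≤ δ * ∑' z, offRate (killedRate Q p₀) o z * h z :=
    mul_nonneg hδ0 (tsum_nonneg fun z => mul_nonneg (offRate_nonneg _ _ _) (hh z))
  have h3 : δ * (exitRate (killedRate Q p₀) o).toReal ≤ 1 / 2 :=
    (mul_le_mul_of_nonneg_left (exitRate_toReal_le hq _) hδ0).trans (mul_killedBound_le hδ0 hδ)
  have h4 := mul_le_mul_of_nonneg_right h3 (hh o)
  linarith

end KilledContraction

/-! ### The conditioned semigroup -/

section Conditioned

variable {S : Type*} {Q : S → S → ℝ≥0} {p₀ : S → ℝ≥0} (hA : BoundedRates Q p₀)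

/-- Semigroup of the killed chain. -/
abbrev killedSemigroup (t : ℝ) : Bdd (Option S) →L[ℝ] Bdd (Option S) :=
  jumpSemigroup (exitRate_killedRate_le hA) t

lemma killedSemigroup_none (t : ℝ) (f : Bdd (Option S)) : killedSemigroup hA t f none = f none := by
  refine tendsto_nhds_unique (tendsto_eulerStep_pow (exitRate_killedRate_le hA) t f none) ?_
  simp_rw [killedStep_pow_none hA]
  exact tendsto_const_nhds

lemma eventually_mesh_meshBound (t : ℝ) : ∀ᶠ n : ℕ in atTop, t / n * meshBound Q p₀ ≤ 1 / 2 :=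
  eventually_mesh_le _ (by norm_num)

lemma tendsto_one_sub_mesh_pow (t c : ℝ) :
    Tendsto (fun n : ℕ => (1 - t / n * c) ^ n) atTop (𝓝 (Real.exp (-c * t))) := by
  refine (Real.tendsto_one_add_div_pow_exp (-c * t)).congr fun n => ?_
  ring

lemma killedSemigroup_alive_ge {t : ℝ} (ht : 0 ≤ t) (x : S) :
    Real.exp (-(supKill p₀).toReal * t) ≤ killedSemigroup hA t (alive S) (some x) := by
  refine le_of_tendsto_of_tendsto (tendsto_one_sub_mesh_pow t _)
    (tendsto_eulerStep_pow (exitRate_killedRate_le hA) t _ _) ?_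
  filter_upwards [eventually_mesh_meshBound (Q := Q) (p₀ := p₀) t] with n hn
  exact killedStep_pow_alive_ge hA (by positivity) hn n x

/-- Restriction to `S` of a function on `Option S`. -/
def restrictSome (g : Bdd (Option S)) : Bdd S :=
  Bdd.mk (fun x => g (some x)) ‖g‖ fun _ => g.abs_apply_le _

lemma extendZero_restrictSome {g : Bdd (Option S)} (hg : g none = 0) :
    extendZero (restrictSome g) = g := by
  ext o
  cases o with
  | none => exact hg.symm
  | some x => rfl

variable [MeasurableSpace S] [DiscreteMeasurableSpace S]

lemma integrable_some (g : Bdd (Option S)) (μ : Measure S) [IsFiniteMeasure μ] :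
    Integrable (fun x => g (some x)) μ :=
  (restrictSome g).integrable μ

/-- `μ K φ / μ K 1` for an operator `K` acting on functions that vanish at the cemetery. -/
def normalizedMean (K : Bdd (Option S) →L[ℝ] Bdd (Option S)) (μ : Measure S) (φ : Bdd S) : ℝ :=
  (∫ x, K (extendZero φ) (some x) ∂μ) / ∫ x, K (alive S) (some x) ∂μ

lemma le_integral_of_forall_le {μ : Measure S} [IsProbabilityMeasure μ] {g : Bdd (Option S)} {a : ℝ}
    (h : ∀ x : S, a ≤ g (some x)) : a ≤ ∫ x, g (some x) ∂μ := by
  simpa using integral_mono (integrable_const a) (integrable_some g μ) h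

lemma integral_le_of_forall_le {μ : Measure S} [IsProbabilityMeasure μ] {g : Bdd (Option S)} {a : ℝ}
    (h : ∀ x : S, g (some x) ≤ a) : ∫ x, g (some x) ∂μ ≤ a := by
  simpa using integral_mono (integrable_some g μ) (integrable_const a) h

lemma exists_signs_of_integral_eq_zero {μ : Measure S} [IsProbabilityMeasure μ]
    {g : Bdd (Option S)} (h : ∫ x, g (some x) ∂μ = 0) :
    (∃ x, 0 ≤ g (some x)) ∧ ∃ x, g (some x) ≤ 0 := by
  obtain ⟨x, hx⟩ := exists_integral_le (integrable_some g μ)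
  obtain ⟨y, hy⟩ := exists_le_integral (integrable_some g μ)
  exact ⟨⟨x, h ▸ hx⟩, ⟨y, h ▸ hy⟩⟩

/-- The centred image `K ^ n (φ - c)`, where `c` is the normalized mean of `K ^ n φ` under `μ`: it
has integral zero, hence takes both signs, hence has small oscillation. -/
lemma centred_killedStep [Nontrivial S] {δ : ℝ} (hδ0 : 0 ≤ δ) (hδ : δ * meshBound Q p₀ ≤ 1 / 2)
    (n : ℕ) (μ : Measure S) [IsProbabilityMeasure μ] {φ : Bdd S} (hφ : ∀ x, |φ x| ≤ 1)
    {g : Bdd (Option S)} (hg : g = (killedStep hA δ ^ n) (extendZero φ) -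
      normalizedMean (killedStep hA δ ^ n) μ φ • (killedStep hA δ ^ n) (alive S)) :
    ∫ x, g (some x) ∂μ = 0 ∧ (∀ x y : S, g (some x) - g (some y) ≤
      (1 - δ * ((lam Q).toReal + (infKill p₀).toReal)) ^ n * 2) ∧
      ∀ x : S, |g (some x)| ≤ (1 - δ * ((lam Q).toReal + (infKill p₀).toReal)) ^ n * 2 := by
  have h1 := mul_supKill_le hδ0 hδ
  have hpos : 0 < ∫ x, (killedStep hA δ ^ n) (alive S) (some x) ∂μ :=
    (pow_pos (show (0 : ℝ) < 1 - δ * (supKill p₀).toReal by linarith) n).trans_le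
      (le_integral_of_forall_le (killedStep_pow_alive_ge hA hδ0 hδ n))
  set c := normalizedMean (killedStep hA δ ^ n) μ φ with hc
  have hg0 : ∫ x, g (some x) ∂μ = 0 := by
    rw [hg]
    simp only [Bdd.sub_apply, Bdd.smul_apply]
    rw [integral_sub (integrable_some _ μ) ((integrable_some _ μ).const_mul c),
      integral_const_mul, hc, normalizedMean, div_mul_cancel₀ _ hpos.ne', sub_self]
  have hgf : g = (killedStep hA δ ^ n) (extendZero φ - c • alive S) := by
    rw [hg, map_sub, map_smul]
  obtain ⟨hs1, hs2⟩ := exists_signs_of_integral_eq_zero hg0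
  have hf0 : (extendZero φ - c • alive S) none = 0 := by simp
  have hosc : ∀ x y : S, g (some x) - g (some y) ≤
      (1 - δ * ((lam Q).toReal + (infKill p₀).toReal)) ^ n * 2 := by
    rw [hgf] at hs1 hs2 ⊢
    refine killedStep_pow_sub_le hA hδ0 hδ hf0 (fun x y => ?_) n hs1 hs2
    have := abs_le.1 (hφ x); have := abs_le.1 (hφ y)
    simp; linarith
  refine ⟨hg0, hosc, fun x => ?_⟩
  obtain ⟨y, hy⟩ := hs1
  obtain ⟨z, hz⟩ := hs2
  rw [abs_le]
  constructor <;> linarith [hosc y x, hosc x z]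

/-- Difference of a normalized mean and a constant, in terms of the centred function. -/
lemma normalizedMean_sub_const {K : Bdd (Option S) →L[ℝ] Bdd (Option S)} (ν : Measure S)
    [IsProbabilityMeasure ν] (φ : Bdd S) (c : ℝ) (h : 0 < ∫ x, K (alive S) (some x) ∂ν) :
    normalizedMean K ν φ - c = (∫ x, (K (extendZero φ) - c • K (alive S)) (some x) ∂ν) /
      ∫ x, K (alive S) (some x) ∂ν := by
  simp only [Bdd.sub_apply, Bdd.smul_apply]
  rw [integral_sub (integrable_some _ ν) ((integrable_some _ ν).const_mul _), integral_const_mul,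
    sub_div, mul_div_cancel_right₀ _ h.ne']
  rfl

lemma abs_normalizedMean_sub_le [Nontrivial S] {δ : ℝ} (hδ0 : 0 ≤ δ)
    (hδ : δ * meshBound Q p₀ ≤ 1 / 2) (n : ℕ) (μ ν : Measure S) [IsProbabilityMeasure μ]
    [IsProbabilityMeasure ν] {φ : Bdd S} (hφ : ∀ x, |φ x| ≤ 1) :
    |normalizedMean (killedStep hA δ ^ n) ν φ - normalizedMean (killedStep hA δ ^ n) μ φ| ≤
      (1 - δ * ((lam Q).toReal + (infKill p₀).toReal)) ^ n * 2 /
        (1 - δ * (supKill p₀).toReal) ^ n := by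
  have h1 := mul_supKill_le hδ0 hδ
  have h2 : 0 < (1 - δ * (supKill p₀).toReal) ^ n := pow_pos (by linarith) n
  have h3 : (1 - δ * (supKill p₀).toReal) ^ n ≤
      ∫ x, (killedStep hA δ ^ n) (alive S) (some x) ∂ν :=
    le_integral_of_forall_le (killedStep_pow_alive_ge hA hδ0 hδ n)
  obtain ⟨-, -, hg⟩ := centred_killedStep hA hδ0 hδ n μ hφ rfl
  rw [normalizedMean_sub_const ν φ _ (h2.trans_le h3), abs_div, abs_of_pos (h2.trans_le h3)]
  refine div_le_div₀ ((abs_nonneg _).trans (hg (Classical.arbitrary S))) ?_ h2 h3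
  rw [abs_le]
  exact ⟨le_integral_of_forall_le fun x => (abs_le.1 (hg x)).1,
    integral_le_of_forall_le fun x => (abs_le.1 (hg x)).2⟩

lemma tendsto_integral_killedStep_pow {t : ℝ} (ht : 0 ≤ t) (f : Bdd (Option S)) (μ : Measure S)
    [IsProbabilityMeasure μ] :
    Tendsto (fun n : ℕ => ∫ x, (killedStep hA (t / n) ^ n) f (some x) ∂μ) atTop
      (𝓝 (∫ x, killedSemigroup hA t f (some x) ∂μ)) := by
  refine tendsto_integral_filter_of_dominated_convergence (fun _ => ‖f‖) ?_ ?_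
    (integrable_const _) (ae_of_all _ fun x => tendsto_eulerStep_pow _ t f _)
  · exact Eventually.of_forall fun n => Measurable.of_discrete.aestronglyMeasurable
  · filter_upwards [eventually_mesh_meshBound (Q := Q) (p₀ := p₀) t] with n hn
    refine ae_of_all _ fun x => eulerStep_pow_abs_le _ (by positivity) ?_ f.abs_apply_le n _
    exact (mul_killedBound_le (by positivity) hn).trans (by norm_num)

lemma integral_alive_pos {t : ℝ} (ht : 0 ≤ t) (μ : Measure S) [IsProbabilityMeasure μ] :
    0 < ∫ x, killedSemigroup hA t (alive S) (some x) ∂μ :=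
  (Real.exp_pos _).trans_le (le_integral_of_forall_le (killedSemigroup_alive_ge hA ht))

lemma tendsto_normalizedMean {t : ℝ} (ht : 0 ≤ t) (μ : Measure S) [IsProbabilityMeasure μ]
    (φ : Bdd S) : Tendsto (fun n : ℕ => normalizedMean (killedStep hA (t / n) ^ n) μ φ) atTop
      (𝓝 (normalizedMean (killedSemigroup hA t) μ φ)) :=
  (tendsto_integral_killedStep_pow hA ht _ μ).div (tendsto_integral_killedStep_pow hA ht _ μ)
    (integral_alive_pos hA ht μ).ne'

/-- The conditioned semigroup contracts at rate `ρ`: the killed chain contracts oscillations at rate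
`lam + inf p₀`, and the survival probability decays at rate at most `sup p₀`. -/
theorem abs_condMean_sub_le [Nontrivial S] {t : ℝ} (ht : 0 ≤ t) (μ ν : Measure S)
    [IsProbabilityMeasure μ] [IsProbabilityMeasure ν] {φ : Bdd S} (hφ : ∀ x, |φ x| ≤ 1) :
    |normalizedMean (killedSemigroup hA t) ν φ - normalizedMean (killedSemigroup hA t) μ φ| ≤
      2 * Real.exp (-rho Q p₀ * t) := by
  have h1 := ((tendsto_normalizedMean hA ht ν φ).sub (tendsto_normalizedMean hA ht μ φ)).abs
  have h2 := ((tendsto_one_sub_mesh_pow t ((lam Q).toReal + (infKill p₀).toReal)).mul_const 2).div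
    (tendsto_one_sub_mesh_pow t (supKill p₀).toReal) (Real.exp_ne_zero _)
  have h3 : Real.exp (-((lam Q).toReal + (infKill p₀).toReal) * t) * 2 /
      Real.exp (-(supKill p₀).toReal * t) = 2 * Real.exp (-rho Q p₀ * t) := by
    rw [mul_comm, mul_div_assoc, ← Real.exp_sub, rho]
    congr 2; ring
  rw [h3] at h2
  refine le_of_tendsto_of_tendsto h1 h2 ?_
  filter_upwards [eventually_mesh_meshBound (Q := Q) (p₀ := p₀) t] with n hn
  exact abs_normalizedMean_sub_le hA (by positivity) hn n μ ν hφ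

lemma measurableEmbedding_some : MeasurableEmbedding (some : S → Option S) where
  injective := Option.some_injective S
  measurable := Measurable.of_discrete
  measurableSet_image' := fun _ _ => MeasurableSet.of_discrete

variable [Countable S]

lemma integral_killed (hA : BoundedRates Q p₀) {t : ℝ} (ht : 0 ≤ t) (μ : Measure S)
    [IsProbabilityMeasure μ] (f : Bdd (Option S)) :
    ∫ o, f o ∂chainLawFrom (killedRate Q p₀) t (μ.map some) =
      ∫ x, killedSemigroup hA t f (some x) ∂μ := by
  have : IsProbabilityMeasure (μ.map some) :=
    Measure.isProbabilityMeasure_map Measurable.of_discrete.aemeasurable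
  rw [integral_chainLawFrom (exitRate_killedRate_le hA) f ht,
    measurableEmbedding_some.integral_map]

theorem integral_condLaw {t : ℝ} (ht : 0 ≤ t) (μ : Measure S) [IsProbabilityMeasure μ]
    (φ : Bdd S) :
    ∫ x, φ x ∂condLaw Q p₀ t μ = normalizedMean (killedSemigroup hA t) μ φ := by
  have hm : IsProbabilityMeasure (μ.map (some : S → Option S)) :=
    Measure.isProbabilityMeasure_map Measurable.of_discrete.aemeasurable
  have hP := isProbabilityMeasure_chainLawFrom (exitRate_killedRate_le hA) ht (μ.map some)
  set m := chainLawFrom (killedRate Q p₀) t (μ.map some) with hmdef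
  have h1 : m.real {none}ᶜ = ∫ x, killedSemigroup hA t (alive S) (some x) ∂μ := by
    rw [← integral_killed hA ht, ← integral_indicator_one MeasurableSet.of_discrete]
    refine integral_congr_ae (ae_of_all _ fun o => ?_)
    cases o <;> simp
  have h2 : ∫ x, φ x ∂condLaw Q p₀ t μ =
      ∫ o, extendZero φ o ∂(cond m {none}ᶜ) := by
    calc ∫ x, φ x ∂condLaw Q p₀ t μ = ∫ x, extendZero φ (some x) ∂condLaw Q p₀ t μ := rfl
      _ = ∫ o, extendZero φ o ∂((condLaw Q p₀ t μ).map some) :=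
          (measurableEmbedding_some.integral_map _).symm
      _ = ∫ o in Set.range some, extendZero φ o ∂(cond m {none}ᶜ) := by
          rw [condLaw, measurableEmbedding_some.map_comap]
      _ = _ := by
          refine setIntegral_eq_integral_of_forall_compl_eq_zero fun o ho => ?_
          cases o with
          | none => rfl
          | some x => exact absurd ⟨x, rfl⟩ ho
  rw [h2, ProbabilityTheory.cond, integral_smul_measure,
    setIntegral_eq_integral_of_forall_compl_eq_zero, integral_killed hA ht, normalizedMean, ← h1,
    ENNReal.toReal_inv, smul_eq_mul, measureReal_def]
  · rw [div_eq_inv_mul]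
  · intro o ho
    cases o with
    | none => rfl
    | some x => simp at ho

theorem isProbabilityMeasure_condLaw (hA : BoundedRates Q p₀) {t : ℝ} (ht : 0 ≤ t) (μ : Measure S)
    [IsProbabilityMeasure μ] : IsProbabilityMeasure (condLaw Q p₀ t μ) := by
  have h1 := integral_condLaw hA ht μ 1
  rw [normalizedMean, div_self (integral_alive_pos hA ht μ).ne'] at h1
  constructor
  simp only [Bdd.one_apply, integral_const, smul_eq_mul, mul_one] at h1
  rw [measureReal_def, ENNReal.toReal_eq_one_iff] at h1
  exact h1

lemma normalizedMean_condLaw {s : ℝ} (hs : 0 ≤ s) (t : ℝ) (μ : Measure S)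
    [IsProbabilityMeasure μ] (φ : Bdd S) :
    normalizedMean (killedSemigroup hA t) (condLaw Q p₀ s μ) φ =
      normalizedMean (killedSemigroup hA (s + t)) μ φ := by
  have key : ∀ ψ : Bdd S, ∫ x, killedSemigroup hA t (extendZero ψ) (some x) ∂condLaw Q p₀ s μ =
      (∫ x, killedSemigroup hA (s + t) (extendZero ψ) (some x) ∂μ) /
        ∫ x, killedSemigroup hA s (alive S) (some x) ∂μ := fun ψ => by
    have := integral_condLaw hA hs μ (restrictSome (killedSemigroup hA t (extendZero ψ)))
    rw [normalizedMean, extendZero_restrictSome (by rw [killedSemigroup_none]; rfl)] at this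
    simp_rw [jumpSemigroup_add]
    exact this
  rw [normalizedMean, key, key, div_div_div_cancel_right₀ (integral_alive_pos hA hs μ).ne']
  rfl

/-! ### Quasi-stationary distributions -/

lemma IsQSD.normalizedMean_eq {ν : Measure S} (hν : IsQSD Q p₀ ν) {t : ℝ} (ht : 0 ≤ t)
    (φ : Bdd S) : normalizedMean (killedSemigroup hA t) ν φ = ∫ x, φ x ∂ν := by
  have := hν.1
  rw [← integral_condLaw hA ht, hν.2 t ht]

lemma tendsto_two_mul_exp_neg {ρ : ℝ} (hρ : 0 < ρ) :
    Tendsto (fun t : ℝ => 2 * Real.exp (-ρ * t)) atTop (𝓝 0) := by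
  have h1 : Tendsto (fun t : ℝ => -ρ * t) atTop atBot :=
    tendsto_id.const_mul_atTop_of_neg (neg_lt_zero.2 hρ)
  simpa using (Real.tendsto_exp_atBot.comp h1).const_mul 2

theorem IsQSD.unique [Nontrivial S] (hA : BoundedRates Q p₀) (hρ : 0 < rho Q p₀) {ν ν' : Measure S}
    (hν : IsQSD Q p₀ ν) (hν' : IsQSD Q p₀ ν') : ν = ν' := by
  have := hν.1
  have := hν'.1
  refine ext_of_integral_bdd fun φ hφ => ?_
  rw [← sub_eq_zero, ← abs_nonpos_iff]
  refine ge_of_tendsto (tendsto_two_mul_exp_neg hρ) ?_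
  filter_upwards [eventually_ge_atTop 0] with t ht
  rw [← hν.normalizedMean_eq hA ht, ← hν'.normalizedMean_eq hA ht]
  exact abs_condMean_sub_le hA ht ν' ν hφ

theorem exists_isQSD [Nontrivial S] (hA : BoundedRates Q p₀) (hρ : 0 < rho Q p₀) :
    ∃ ν : Measure S, IsQSD Q p₀ ν := by
  obtain ⟨x⟩ : Nonempty S := inferInstance
  set μ : ℕ → Measure S := fun n => condLaw Q p₀ n (Measure.dirac x) with hμ
  have hμP : ∀ n, IsProbabilityMeasure (μ n) := fun n =>
    isProbabilityMeasure_condLaw hA (Nat.cast_nonneg n) _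
  have hlim0 : Tendsto (fun n : ℕ => 2 * Real.exp (-rho Q p₀ * n)) atTop (𝓝 0) :=
    (tendsto_two_mul_exp_neg hρ).comp tendsto_natCast_atTop_atTop
  -- the law at time `s + n` is the image under `T_n` of the law at time `s`
  have hshift : ∀ (s : ℝ), 0 ≤ s → ∀ (n : ℕ) (f : Bdd S), (∀ x, |f x| ≤ 1) →
      |normalizedMean (killedSemigroup hA (s + n)) (Measure.dirac x) f - ∫ x, f x ∂μ n| ≤
        2 * Real.exp (-rho Q p₀ * n) := fun s hs n f hf => by
    have := isProbabilityMeasure_condLaw hA hs (Measure.dirac x)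
    rw [integral_condLaw hA (Nat.cast_nonneg n), ← normalizedMean_condLaw hA hs n]
    exact abs_condMean_sub_le hA (Nat.cast_nonneg n) _ _ hf
  obtain ⟨ν, hν, hlim⟩ := exists_limit_of_cauchy_tv μ hlim0 fun f hf m n hnm => by
    have h1 := hshift ((m - n : ℕ) : ℝ) (Nat.cast_nonneg _) n f hf
    rwa [← Nat.cast_add, Nat.sub_add_cancel hnm, ← integral_condLaw hA (Nat.cast_nonneg m)] at h1
  refine ⟨ν, hν, fun t ht => ?_⟩
  have := isProbabilityMeasure_condLaw hA ht ν
  refine ext_of_integral_bdd fun φ hφ => ?_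
  rw [integral_condLaw hA ht]
  have h1 : Tendsto (fun n => normalizedMean (killedSemigroup hA t) (μ n) φ) atTop
      (𝓝 (normalizedMean (killedSemigroup hA t) ν φ)) :=
    (hlim (restrictSome _)).div (hlim (restrictSome _)) (integral_alive_pos hA ht ν).ne'
  have h2 : Tendsto (fun n => normalizedMean (killedSemigroup hA t) (μ n) φ - ∫ x, φ x ∂μ n) atTop
      (𝓝 0) := by
    refine squeeze_zero_norm (fun n => ?_) hlim0
    rw [normalizedMean_condLaw hA (Nat.cast_nonneg n) t, add_comm]
    exact hshift t ht n φ hφ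
  have h3 := h1.sub h2
  simp only [sub_sub_cancel, sub_zero] at h3
  exact tendsto_nhds_unique h3 (hlim φ)

end Conditioned

/-! ### The particle system with labelled particles -/

section Labelled

variable {S : Type*} {N : ℕ} {Q : S → S → ℝ≥0} {p₀ : S → ℝ≥0}

/-- The configuration of the labelled particles `x`. -/
def toConfig (x : Fin N → S) : Config S N :=
  ⟨∑ a, Finsupp.single (x a) 1, by simp [map_sum]⟩

lemma toConfig_surjective : Function.Surjective (toConfig : (Fin N → S) → Config S N) := by
  classical
  rintro ⟨η, hη⟩
  have hcard : (Finsupp.toMultiset η).toList.length = N := by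
    rw [Multiset.length_toList, Finsupp.card_toMultiset, ← hη]
    rfl
  subst hcard
  refine ⟨fun a => (Finsupp.toMultiset η).toList[a.1], ?_⟩
  apply Subtype.ext
  have hinj : Function.Injective (Finsupp.toMultiset : (S →₀ ℕ) → Multiset S) := by
    rw [← Finsupp.coe_orderIsoMultiset]; exact Finsupp.orderIsoMultiset.injective
  apply hinj
  simp only [toConfig, map_sum, Finsupp.toMultiset_single, one_smul]
  have key : ∀ l : List S, ∑ a : Fin l.length, ({l[a.1]} : Multiset S) = (l : Multiset S) :=
      fun l => by
    conv_rhs => rw [← Multiset.sum_map_singleton (l : Multiset S), Multiset.map_coe,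
      Multiset.sum_coe, ← List.ofFn_getElem (xs := l), List.map_ofFn, List.sum_ofFn]
    rfl
  rw [key, Multiset.coe_toList]

lemma toConfig_apply (x : Fin N → S) (k : S) : (open Classical in
    (toConfig x).1 k = ∑ a, if x a = k then 1 else 0) := by
  classical
  simp [toConfig, Finsupp.finsetSum_apply, Finsupp.single_apply]

lemma toConfig_update (x : Fin N → S) (a : Fin N) (j : S) :
    (toConfig (Function.update x a j)).1 + Finsupp.single (x a) 1 =
      (toConfig x).1 + Finsupp.single j 1 := by
  classical
  have h1 : ∀ b, Finsupp.single (Function.update x a j b) 1 =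
      Function.update (fun b => (Finsupp.single (x b) 1 : S →₀ ℕ)) a (Finsupp.single j 1) b :=
    fun b => Function.apply_update (fun _ k => (Finsupp.single k 1 : S →₀ ℕ)) x a j b
  simp only [toConfig, h1]
  rw [Finset.sum_update_of_mem (Finset.mem_univ a),
    Finset.sum_eq_add_sum_sdiff_singleton_of_mem (Finset.mem_univ a)
      fun b => (Finsupp.single (x b) 1 : S →₀ ℕ)]
  abel

lemma eq_toConfig_update_iff (x : Fin N → S) (a : Fin N) (j : S) (ξ : Config S N) :
    ξ.1 + Finsupp.single (x a) 1 = (toConfig x).1 + Finsupp.single j 1 ↔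
      ξ = toConfig (Function.update x a j) := by
  rw [← toConfig_update, add_left_inj]
  exact Subtype.ext_iff.symm

lemma toConfig_update_eq_iff (x : Fin N → S) (a : Fin N) (j : S) :
    toConfig (Function.update x a j) = toConfig x ↔ j = x a := by
  rw [eq_comm, ← eq_toConfig_update_iff, add_right_inj, eq_comm,
    Finsupp.single_left_inj one_ne_zero]

/-- Sums against the jump rates of the particle system, in terms of labelled particles: particle `a`
moves on its own, or dies and jumps onto particle `b`. -/
lemma tsum_fvRate_mul (x : Fin N → S) (F : Config S N → ℝ≥0∞) :
    ∑' ξ, fvRate Q p₀ (toConfig x) ξ * F ξ =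
      ∑ a, (∑' j, (Q (x a) j : ℝ≥0∞) * F (toConfig (Function.update x a j)) +
        ∑ b, (p₀ (x a) : ℝ≥0∞) / ((N : ℝ≥0∞) - 1) *
          F (toConfig (Function.update x a (x b)))) := by
  classical
  set η := toConfig x with hη
  set c : S → S → ℝ≥0∞ := fun i j =>
    (Q i j : ℝ≥0∞) + (p₀ i : ℝ≥0∞) * ((η.1 j : ℝ≥0∞) / ((N : ℝ≥0∞) - 1)) with hc
  set G : S → ℝ≥0∞ := fun i => ∑' j, ∑' ξ : Config S N,
    (if ξ.1 + Finsupp.single i 1 = η.1 + Finsupp.single j 1 then c i j else 0) * F ξ with hG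
  have hcast : ∀ k, ((η.1 k : ℕ) : ℝ≥0∞) = ∑ a, if x a = k then 1 else 0 := fun k => by
    rw [hη, toConfig_apply]; push_cast; congr
  have h1 : ∑' ξ, fvRate Q p₀ η ξ * F ξ = ∑' i, (η.1 i : ℝ≥0∞) * G i := by
    simp only [fvRate, hG, ← ENNReal.tsum_mul_left, ← ENNReal.tsum_mul_right]
    rw [ENNReal.tsum_comm]
    refine tsum_congr fun i => ?_
    rw [ENNReal.tsum_comm]
    refine tsum_congr fun j => tsum_congr fun ξ => ?_
    split_ifs
    · rw [mul_assoc]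
    · simp
  have h2 : ∑' i, (η.1 i : ℝ≥0∞) * G i = ∑ a, G (x a) := by
    simp only [hcast, Finset.sum_mul]
    rw [Summable.tsum_finsetSum fun a _ => ENNReal.summable]
    exact Finset.sum_congr rfl fun a _ => by simp
  rw [h1, h2]
  refine Finset.sum_congr rfl fun a _ => ?_
  have h3 : G (x a) = ∑' j, c (x a) j * F (toConfig (Function.update x a j)) := by
    refine tsum_congr fun j => ?_
    rw [tsum_eq_single (toConfig (Function.update x a j)) fun ξ hξ => ?_]
    · rw [if_pos ((eq_toConfig_update_iff x a j _).2 rfl)]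
    · rw [if_neg (fun h => hξ ((eq_toConfig_update_iff x a j ξ).1 h)), zero_mul]
  rw [h3]
  simp only [hc, add_mul]
  rw [ENNReal.tsum_add]
  congr 1
  simp only [hcast, div_eq_mul_inv, Finset.sum_mul, Finset.mul_sum]
  rw [Summable.tsum_finsetSum fun a _ => ENNReal.summable]
  refine Finset.sum_congr rfl fun b _ => ?_
  rw [tsum_eq_single (x b) fun k hk => by simp [Ne.symm hk]]
  simp

/-- A bound for the total jump rates of the system of `N` particles. -/
def fvBound (N : ℕ) (Q : S → S → ℝ≥0) (p₀ : S → ℝ≥0) : ℝ≥0 :=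
  N * ((supRate Q).toNNReal + N * (supKill p₀).toNNReal)

lemma exitRate_fvRate_le (hA : BoundedRates Q p₀) (hN : 2 ≤ N) (η : Config S N) :
    exitRate (fvRate Q p₀) η ≤ fvBound N Q p₀ := by
  classical
  obtain ⟨x, rfl⟩ := toConfig_surjective η
  have h1 : exitRate (fvRate Q p₀) (toConfig x) =
      ∑' ξ, fvRate Q p₀ (toConfig x) ξ * (if ξ = toConfig x then 0 else 1) := by
    refine tsum_congr fun ξ => ?_
    split_ifs <;> simp
  have h2 : (fvBound N Q p₀ : ℝ≥0∞) = ∑ _a : Fin N, (supRate Q + ∑ _b : Fin N, supKill p₀) := by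
    simp [fvBound, ENNReal.coe_toNNReal hA.1.ne, ENNReal.coe_toNNReal hA.2.ne, mul_add]
  have h3 : 1 ≤ (N : ℝ≥0∞) - 1 :=
    ENNReal.le_sub_of_add_le_right ENNReal.one_ne_top (by norm_num; exact_mod_cast hN)
  rw [h1, tsum_fvRate_mul, h2]
  refine Finset.sum_le_sum fun a _ => add_le_add ?_ (Finset.sum_le_sum fun b _ => ?_)
  · refine le_trans (le_of_eq (tsum_congr fun j => ?_))
      (le_iSup (fun i => ∑' j, if j = i then 0 else (Q i j : ℝ≥0∞)) (x a))
    rw [toConfig_update_eq_iff]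
    split_ifs <;> simp
  · calc _ ≤ (p₀ (x a) : ℝ≥0∞) / 1 * 1 := by
          gcongr
          split_ifs <;> simp
      _ ≤ _ := by simpa [supKill] using le_iSup (fun i => (p₀ i : ℝ≥0∞)) (x a)

/-- The generator of the particle system. -/
abbrev fvGen (hA : BoundedRates Q p₀) (hN : 2 ≤ N) : Bdd (Config S N) →L[ℝ] Bdd (Config S N) :=
  jumpGen (fvRate Q p₀) (fvBound N Q p₀) (exitRate_fvRate_le hA hN)

/-- The rate of the particle system at which particle `a` at `i` dies and jumps onto a given other
particle. -/
def rebirthRate (N : ℕ) (p₀ : S → ℝ≥0) (i : S) : ℝ := p₀ i / ((N : ℝ) - 1)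

lemma rebirthRate_nonneg (hN : 2 ≤ N) (i : S) : 0 ≤ rebirthRate N p₀ i := by
  have : (2 : ℝ) ≤ N := by exact_mod_cast hN
  exact div_nonneg (p₀ i).2 (by linarith)

lemma ofReal_rebirthRate (hN : 2 ≤ N) (i : S) :
    ENNReal.ofReal (rebirthRate N p₀ i) = (p₀ i : ℝ≥0∞) / ((N : ℝ≥0∞) - 1) := by
  have : (2 : ℝ) ≤ N := by exact_mod_cast hN
  rw [rebirthRate, ENNReal.ofReal_div_of_pos (by linarith), ENNReal.ofReal_coe_nnreal,
    ENNReal.ofReal_sub _ zero_le_one, ENNReal.ofReal_natCast, ENNReal.ofReal_one]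

lemma tsum_offRate_fvRate_mul_of_nonneg (hA : BoundedRates Q p₀) (hN : 2 ≤ N) (x : Fin N → S)
    {g : Config S N → ℝ} (hg : ∀ ξ, 0 ≤ g ξ) {C : ℝ} (hC : ∀ ξ, |g ξ| ≤ C)
    (h0 : g (toConfig x) = 0) :
    ∑' ξ, offRate (fvRate Q p₀) (toConfig x) ξ * g ξ =
      ∑ a, (∑' j, offQ Q (x a) j * g (toConfig (Function.update x a j)) +
        ∑ b, rebirthRate N p₀ (x a) * g (toConfig (Function.update x a (x b)))) := by
  classical
  have hq := exitRate_fvRate_le hA hN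
  have hs : ∀ a, Summable fun j => offQ Q (x a) j * g (toConfig (Function.update x a j)) :=
    fun a => summable_mul_of_bdd (summable_offQ hA _) (offQ_nonneg Q _) fun _ => hC _
  have hn1 : ∀ a j, 0 ≤ offQ Q (x a) j * g (toConfig (Function.update x a j)) :=
    fun a j => mul_nonneg (offQ_nonneg Q _ _) (hg _)
  have hn2 : ∀ a b, 0 ≤ rebirthRate N p₀ (x a) * g (toConfig (Function.update x a (x b))) :=
    fun a b => mul_nonneg (rebirthRate_nonneg hN _) (hg _)
  have hn3 : ∀ a, 0 ≤ ∑' j, offQ Q (x a) j * g (toConfig (Function.update x a j)) +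
        ∑ b, rebirthRate N p₀ (x a) * g (toConfig (Function.update x a (x b))) :=
    fun a => add_nonneg (tsum_nonneg (hn1 a)) (Finset.sum_nonneg fun b _ => hn2 a b)
  rw [← ENNReal.ofReal_eq_ofReal_iff
    (tsum_nonneg fun ξ => mul_nonneg (offRate_nonneg _ _ _) (hg ξ))
    (Finset.sum_nonneg fun a _ => hn3 a)]
  have hL : ENNReal.ofReal (∑' ξ, offRate (fvRate Q p₀) (toConfig x) ξ * g ξ) =
      ∑' ξ, fvRate Q p₀ (toConfig x) ξ * ENNReal.ofReal (g ξ) := by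
    rw [ENNReal.ofReal_tsum_of_nonneg (fun ξ => mul_nonneg (offRate_nonneg _ _ _) (hg ξ))
      (summable_mul_of_bdd (summable_offRate hq _) (offRate_nonneg _ _) hC)]
    refine tsum_congr fun ξ => ?_
    rw [ENNReal.ofReal_mul (offRate_nonneg _ _ _), offRate,
      ENNReal.ofReal_toReal (offRate_ne_top hq _ ξ)]
    split_ifs with h
    · rw [h, h0]; simp
    · rfl
  rw [hL, tsum_fvRate_mul, ENNReal.ofReal_sum_of_nonneg fun a _ => hn3 a]
  refine Finset.sum_congr rfl fun a _ => ?_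
  rw [ENNReal.ofReal_add (tsum_nonneg (hn1 a)) (Finset.sum_nonneg fun b _ => hn2 a b),
    ENNReal.ofReal_tsum_of_nonneg (hn1 a) (hs a), ENNReal.ofReal_sum_of_nonneg fun b _ => hn2 a b]
  congr 1
  · refine tsum_congr fun j => ?_
    rw [ENNReal.ofReal_mul (offQ_nonneg _ _ _)]
    by_cases h : j = x a
    · rw [(toConfig_update_eq_iff x a j).2 h, h0]; simp
    · simp [offQ, h]
  · refine Finset.sum_congr rfl fun b _ => ?_
    rw [ENNReal.ofReal_mul (rebirthRate_nonneg hN _), ofReal_rebirthRate hN]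

lemma fvGen_apply (hA : BoundedRates Q p₀) (hN : 2 ≤ N) (f : Bdd (Config S N)) (x : Fin N → S) :
    fvGen hA hN f (toConfig x) =
      ∑ a, (∑' j, offQ Q (x a) j * (f (toConfig (Function.update x a j)) - f (toConfig x)) +
        ∑ b, rebirthRate N p₀ (x a) *
          (f (toConfig (Function.update x a (x b))) - f (toConfig x))) := by
  have hq := exitRate_fvRate_le hA hN
  set g : Config S N → ℝ := fun ξ => f ξ - f (toConfig x) with hg
  have hgC : ∀ ξ, |g ξ| ≤ 2 * ‖f‖ := fun ξ => abs_sub_le_two_norm f _ _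
  have hpC : ∀ ξ, |max (g ξ) 0| ≤ 2 * ‖f‖ := fun ξ => by
    rw [abs_of_nonneg (le_max_right _ _)]
    exact max_le ((le_abs_self _).trans (hgC ξ)) (by positivity)
  have hnC : ∀ ξ, |max (-g ξ) 0| ≤ 2 * ‖f‖ := fun ξ => by
    rw [abs_of_nonneg (le_max_right _ _)]
    exact max_le ((neg_le_abs _).trans (hgC ξ)) (by positivity)
  have hsplit : ∀ ξ, g ξ = max (g ξ) 0 - max (-g ξ) 0 := fun ξ => by
    rcases le_total (g ξ) 0 with h | h
    · rw [max_eq_right h, max_eq_left (by linarith)]; ring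
    · rw [max_eq_left h, max_eq_right (by linarith)]; ring
  have hp := tsum_offRate_fvRate_mul_of_nonneg hA hN x (fun ξ => le_max_right (g ξ) 0) hpC
    (by simp [hg])
  have hn := tsum_offRate_fvRate_mul_of_nonneg hA hN x (fun ξ => le_max_right (-g ξ) 0) hnC
    (by simp [hg])
  have hoff := fun i => summable_offQ hA i
  have e1 : fvGen hA hN f (toConfig x) =
      ∑' ξ, offRate (fvRate Q p₀) (toConfig x) ξ * max (g ξ) 0 -
      ∑' ξ, offRate (fvRate Q p₀) (toConfig x) ξ * max (-g ξ) 0 := by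
    rw [jumpGen_apply, ← (summable_mul_of_bdd (summable_offRate hq _) (offRate_nonneg _ _)
      hpC).tsum_sub (summable_mul_of_bdd (summable_offRate hq _) (offRate_nonneg _ _) hnC)]
    refine tsum_congr fun ξ => ?_
    rw [← mul_sub, ← hsplit]
  rw [e1, hp, hn, ← Finset.sum_sub_distrib]
  refine Finset.sum_congr rfl fun a _ => ?_
  rw [add_sub_add_comm, ← Finset.sum_sub_distrib,
    ← (summable_mul_of_bdd (hoff (x a)) (offQ_nonneg Q _) fun j =>
      hpC (toConfig (Function.update x a j))).tsum_sub
      (summable_mul_of_bdd (hoff (x a)) (offQ_nonneg Q _) fun j =>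
      hnC (toConfig (Function.update x a j)))]
  congr 1
  · refine tsum_congr fun j => ?_
    rw [← mul_sub, ← hsplit]
  · refine Finset.sum_congr rfl fun b _ => ?_
    rw [← mul_sub, ← hsplit]

end Labelled

/-! ### Contraction for the particle system -/

section ParticleContraction

variable {S : Type*} {N : ℕ} {Q : S → S → ℝ≥0} {p₀ : S → ℝ≥0}

/-- A bound for the rates of the couplings of the system of `N` particles. -/
def fvMesh (N : ℕ) (Q : S → S → ℝ≥0) (p₀ : S → ℝ≥0) : ℝ :=
  4 * (N : ℝ) ^ 2 * ((supRate Q).toReal + (supKill p₀).toReal)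

/-- Euler step of the particle system. -/
abbrev fvStep (hA : BoundedRates Q p₀) (hN : 2 ≤ N) (δ : ℝ) :
    Bdd (Config S N) →L[ℝ] Bdd (Config S N) :=
  eulerStep (exitRate_fvRate_le hA hN) δ

/-- Moving one particle changes `f` by at most `L`. -/
def LipschitzInParticles (f : Bdd (Config S N)) (L : ℝ) : Prop :=
  ∀ (x : Fin N → S) (a : Fin N) (s : S),
    f (toConfig x) - f (toConfig (Function.update x a s)) ≤ L

lemma LipschitzInParticles.abs_sub_le {f : Bdd (Config S N)} {L : ℝ}
    (hf : LipschitzInParticles f L) (x : Fin N → S) (a : Fin N) (s : S) :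
    |f (toConfig (Function.update x a s)) - f (toConfig x)| ≤ L := by
  rw [abs_sub_le_iff]
  refine ⟨?_, hf x a s⟩
  have := hf (Function.update x a s) a (x a)
  rwa [Function.update_idem, Function.update_eq_self] at this

lemma LipschitzInParticles.update_sub_update_le {f : Bdd (Config S N)} {L : ℝ}
    (hf : LipschitzInParticles f L) (x : Fin N → S) (a : Fin N) (s s' : S) :
    f (toConfig (Function.update x a s)) - f (toConfig (Function.update x a s')) ≤ L := by
  have := hf (Function.update x a s) a s'
  rwa [Function.update_idem] at this

/-- Any two configurations differ by at most `N` moves. -/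
lemma LipschitzInParticles.sub_le {f : Bdd (Config S N)} {L : ℝ}
    (hf : LipschitzInParticles f L) (η ξ : Config S N) : f η - f ξ ≤ N * L := by
  classical
  obtain ⟨x, rfl⟩ := toConfig_surjective η
  obtain ⟨y, rfl⟩ := toConfig_surjective ξ
  have key : ∀ s : Finset (Fin N),
      f (toConfig x) - f (toConfig fun i => if i ∈ s then y i else x i) ≤ s.card * L := by
    intro s
    induction s using Finset.induction_on with
    | empty => simp
    | insert a s ha ih =>
      have h1 : (fun i => if i ∈ insert a s then y i else x i) =
          Function.update (fun i => if i ∈ s then y i else x i) a (y a) := by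
        ext i
        by_cases hi : i = a
        · subst hi; simp
        · simp [hi]
      rw [h1, Finset.card_insert_of_notMem ha]
      have := hf (fun i => if i ∈ s then y i else x i) a (y a)
      push_cast
      linarith
  simpa using key Finset.univ

lemma card_erase_univ_sub_one (hN : 2 ≤ N) (a : Fin N) :
    ((Finset.univ.erase a).card : ℝ) = N - 1 := by
  rw [Finset.card_erase_of_mem (Finset.mem_univ a), Finset.card_univ, Fintype.card_fin,
    Nat.cast_sub (by omega), Nat.cast_one]

lemma sub_one_mul_rebirthRate (hN : 2 ≤ N) (i : S) : ((N : ℝ) - 1) * rebirthRate N p₀ i = p₀ i := by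
  have : (2 : ℝ) ≤ N := by exact_mod_cast hN
  rw [rebirthRate, mul_div_cancel₀]
  linarith

variable (hA : BoundedRates Q p₀) (hN : 2 ≤ N)

/-- The part of the generator of the particle system that moves particle `a`. -/
def particleGen (Q : S → S → ℝ≥0) (p₀ : S → ℝ≥0) (f : Bdd (Config S N)) (x : Fin N → S)
    (a : Fin N) : ℝ :=
  ∑' j, offQ Q (x a) j * (f (toConfig (Function.update x a j)) - f (toConfig x)) +
    ∑ b, rebirthRate N p₀ (x a) * (f (toConfig (Function.update x a (x b))) - f (toConfig x))

lemma particleGen_eq_erase (f : Bdd (Config S N)) (x : Fin N → S) (a : Fin N) :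
    particleGen Q p₀ f x a =
    ∑' j, offQ Q (x a) j * (f (toConfig (Function.update x a j)) - f (toConfig x)) +
    ∑ b ∈ Finset.univ.erase a, rebirthRate N p₀ (x a) *
      (f (toConfig (Function.update x a (x b))) - f (toConfig x)) := by
  rw [particleGen, ← Finset.add_sum_erase _ _ (Finset.mem_univ a), Function.update_eq_self]
  simp

lemma fvStep_apply (δ : ℝ) (f : Bdd (Config S N)) (x : Fin N → S) :
    fvStep hA hN δ f (toConfig x) = f (toConfig x) + δ * ∑ a, particleGen Q p₀ f x a :=
  congrArg (fun c => f (toConfig x) + δ * c) (fvGen_apply hA hN f x)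

/-- The particle in which the two systems differ: its two versions meet at rate `lam + inf p₀`. -/
lemma particleGen_sub_le_self (hA : BoundedRates Q p₀) (hN : 2 ≤ N)
    {f : Bdd (Config S N)} {L : ℝ} (hf : LipschitzInParticles f L) (x : Fin N → S) (a : Fin N)
    {s : S} (hs : s ≠ x a) :
    particleGen Q p₀ f x a - particleGen Q p₀ f (Function.update x a s) a ≤
      -((lam Q).toReal + (infKill p₀).toReal) * L +
        (4 * (supRate Q).toReal + 3 * (supKill p₀).toReal) *
          (L - (f (toConfig x) - f (toConfig (Function.update x a s)))) := by
  have hN' : (2 : ℝ) ≤ N := by exact_mod_cast hN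
  have hE : 0 ≤ L - (f (toConfig x) - f (toConfig (Function.update x a s))) :=
    sub_nonneg.2 (hf x a s)
  set D := f (toConfig x) - f (toConfig (Function.update x a s)) with hD
  rw [particleGen_eq_erase, particleGen_eq_erase]
  simp only [Function.update_self, Function.update_idem]
  have h1 := coupling_tsum hA (i := x a) (i' := s) hs.symm
    (v := fun j => f (toConfig (Function.update x a j))) (fun j => f.abs_apply_le _)
    (fun j k => hf.update_sub_update_le x a j k)
  simp only [Function.update_eq_self, ← hD] at h1
  have h2 : ∑ b ∈ Finset.univ.erase a, rebirthRate N p₀ (x a) *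
        (f (toConfig (Function.update x a (x b))) - f (toConfig x)) -
      ∑ b ∈ Finset.univ.erase a, rebirthRate N p₀ s *
        (f (toConfig (Function.update x a (Function.update x a s b))) -
          f (toConfig (Function.update x a s))) ≤
      -(infKill p₀).toReal * L + 3 * (supKill p₀).toReal * (L - D) := by
    rw [← Finset.sum_sub_distrib]
    have hm : ∀ i : S, (infKill p₀).toReal / (N - 1) ≤ rebirthRate N p₀ i := fun i =>
      div_le_div_of_nonneg_right (infKill_le i) (by linarith)
    have hM : ∀ i : S, rebirthRate N p₀ i ≤ (supKill p₀).toReal / (N - 1) := fun i =>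
      div_le_div_of_nonneg_right (kill_le hA i) (by linarith)
    have hterm : ∀ b ∈ Finset.univ.erase a, rebirthRate N p₀ (x a) *
        (f (toConfig (Function.update x a (x b))) - f (toConfig x)) -
        rebirthRate N p₀ s *
        (f (toConfig (Function.update x a (Function.update x a s b))) -
          f (toConfig (Function.update x a s))) ≤
        (-(infKill p₀).toReal * L + 3 * (supKill p₀).toReal * (L - D)) / (N - 1) := by
      intro b hb
      rw [Function.update_of_ne (Finset.ne_of_mem_erase hb)]
      have hx := hf.update_sub_update_le x a (x a) (x b)
      rw [Function.update_eq_self] at hx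
      have h3 := coupling_scalar (div_nonneg ENNReal.toReal_nonneg (by linarith))
        (hm (x a)) (hm s) (hf.update_sub_update_le x a (x b) s) hx (hf x a s)
      have h4 := mul_le_mul_of_nonneg_right (add_le_add (add_le_add (hM (x a)) (hM s))
        ((hm s).trans (hM s))) hE
      refine h3.trans ((add_le_add le_rfl h4).trans (le_of_eq ?_))
      ring
    refine (Finset.sum_le_card_nsmul _ _ _ hterm).trans (le_of_eq ?_)
    rw [nsmul_eq_mul, card_erase_univ_sub_one hN, mul_div_cancel₀]
    linarith
  linarith

/-- The other particles move together in both systems. The only loss comes from jumps onto the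
particle in which the systems differ. -/
lemma particleGen_sub_le_of_ne (hA : BoundedRates Q p₀) (hN : 2 ≤ N)
    {f : Bdd (Config S N)} {L : ℝ} (hf : LipschitzInParticles f L) (x : Fin N → S)
    {a b : Fin N} (hb : b ≠ a) (s : S) :
    particleGen Q p₀ f x b - particleGen Q p₀ f (Function.update x a s) b ≤
      rebirthRate N p₀ (x b) * L +
        ((supRate Q).toReal + N * rebirthRate N p₀ (x b)) *
          (L - (f (toConfig x) - f (toConfig (Function.update x a s)))) := by
  have hE : 0 ≤ L - (f (toConfig x) - f (toConfig (Function.update x a s))) :=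
    sub_nonneg.2 (hf x a s)
  have hL0 : 0 ≤ L := by simpa using hf x a (x a)
  set D := f (toConfig x) - f (toConfig (Function.update x a s)) with hD
  have hcomm : ∀ j, Function.update (Function.update x a s) b j =
      Function.update (Function.update x b j) a s := fun j => Function.update_comm hb.symm _ _ _
  have hr := rebirthRate_nonneg (p₀ := p₀) hN (x b)
  unfold particleGen
  rw [Function.update_of_ne hb]
  have s1 : Summable fun j => offQ Q (x b) j *
      (f (toConfig (Function.update x b j)) - f (toConfig x)) :=
    summable_mul_of_bdd (summable_offQ hA _) (offQ_nonneg Q _) fun _ => abs_sub_le_two_norm f _ _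
  have s2 : Summable fun j => offQ Q (x b) j *
      (f (toConfig (Function.update (Function.update x a s) b j)) -
        f (toConfig (Function.update x a s))) :=
    summable_mul_of_bdd (summable_offQ hA _) (offQ_nonneg Q _) fun _ => abs_sub_le_two_norm f _ _
  have h1 : ∑' j, offQ Q (x b) j *
        (f (toConfig (Function.update x b j)) - f (toConfig x)) -
      ∑' j, offQ Q (x b) j * (f (toConfig (Function.update (Function.update x a s) b j)) -
        f (toConfig (Function.update x a s))) ≤ (supRate Q).toReal * (L - D) := by
    rw [← s1.tsum_sub s2]
    calc _ ≤ ∑' j, offQ Q (x b) j * (L - D) := by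
          refine (s1.sub s2).tsum_le_tsum (fun j => ?_) ((summable_offQ hA _).mul_right _)
          rw [← mul_sub]
          refine mul_le_mul_of_nonneg_left ?_ (offQ_nonneg _ _ _)
          have := hf (Function.update x b j) a s
          rw [hcomm]; linarith
      _ ≤ _ := by
          rw [tsum_mul_right]
          exact mul_le_mul_of_nonneg_right (tsum_offQ_le hA _) hE
  have h2 : ∑ c, rebirthRate N p₀ (x b) *
        (f (toConfig (Function.update x b (x c))) - f (toConfig x)) -
      ∑ c, rebirthRate N p₀ (x b) *
        (f (toConfig (Function.update (Function.update x a s) b (Function.update x a s c))) -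
        f (toConfig (Function.update x a s))) ≤
      ∑ c, rebirthRate N p₀ (x b) * ((if c = a then L else 0) + (L - D)) := by
    rw [← Finset.sum_sub_distrib]
    refine Finset.sum_le_sum fun c _ => ?_
    rw [← mul_sub]
    refine mul_le_mul_of_nonneg_left ?_ hr
    rw [hcomm]
    split_ifs with hc
    · subst hc
      rw [Function.update_self]
      have h3 := hf.update_sub_update_le x b (x c) s
      have h4 := hf (Function.update x b s) c s
      linarith
    · rw [Function.update_of_ne hc]
      have := hf (Function.update x b (x c)) a s
      linarith
  have h3 : ∑ c, rebirthRate N p₀ (x b) * ((if c = a then L else 0) + (L - D)) =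
      rebirthRate N p₀ (x b) * L + N * rebirthRate N p₀ (x b) * (L - D) := by
    rw [← Finset.mul_sum, Finset.sum_add_distrib, Finset.sum_ite_eq', Finset.sum_const,
      Finset.card_univ, Fintype.card_fin]
    simp only [Finset.mem_univ, if_true, nsmul_eq_mul]
    ring
  linarith

/-- One step of the particle system contracts Lipschitz constants by `1 - δ ρ`. -/
lemma LipschitzInParticles.fvStep [Nontrivial S] {δ : ℝ} (hδ0 : 0 ≤ δ)
    (hδ : δ * fvMesh N Q p₀ ≤ 1 / 2) {f : Bdd (Config S N)} {L : ℝ}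
    (hf : LipschitzInParticles f L) :
    LipschitzInParticles (fvStep hA hN δ f) ((1 - δ * rho Q p₀) * L) := by
  intro x a s
  have hN' : (2 : ℝ) ≤ N := by exact_mod_cast hN
  have hL0 : 0 ≤ L := by simpa using hf x a (x a)
  have hQ := ENNReal.toReal_nonneg (a := supRate Q)
  have hp := ENNReal.toReal_nonneg (a := supKill p₀)
  have hps := infKill_le_supKill hA
  have hδQ := mul_nonneg hδ0 hQ
  have hδp := mul_nonneg hδ0 hp
  have hNN : (4 : ℝ) ≤ (N : ℝ) ^ 2 := by nlinarith
  have hNN' : (N : ℝ) ≤ (N : ℝ) ^ 2 := by nlinarith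
  have hδ' : δ * (((N : ℝ) + 3) * ((supRate Q).toReal + (supKill p₀).toReal)) ≤ 1 / 2 := by
    refine le_trans (mul_le_mul_of_nonneg_left ?_ hδ0) hδ
    rw [fvMesh]
    exact mul_le_mul_of_nonneg_right (by linarith) (by linarith)
  by_cases hs : s = x a
  · subst hs
    rw [Function.update_eq_self, sub_self]
    refine mul_nonneg ?_ hL0
    have h1 := mul_le_mul_of_nonneg_left (lam_le_two_supRate hA) hδ0
    have h2 := mul_nonneg hδ0 (sub_nonneg.2 hps)
    rw [rho]
    nlinarith
  · have hE : 0 ≤ L - (f (toConfig x) - f (toConfig (Function.update x a s))) :=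
      sub_nonneg.2 (hf x a s)
    rw [fvStep_apply, fvStep_apply]
    set D := f (toConfig x) - f (toConfig (Function.update x a s)) with hD
    have h1 := particleGen_sub_le_self hA hN hf x a hs
    have h2 : ∀ b ∈ Finset.univ.erase a,
        particleGen Q p₀ f x b - particleGen Q p₀ f (Function.update x a s) b ≤
        ((supKill p₀).toReal * L + (N - 1) * (supRate Q).toReal * (L - D) +
          N * (supKill p₀).toReal * (L - D)) / (N - 1) := by
      intro b hb
      rw [le_div_iff₀ (by linarith)]
      have h3 := mul_le_mul_of_nonneg_right
        (particleGen_sub_le_of_ne hA hN hf x (Finset.ne_of_mem_erase hb) s)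
        (show (0 : ℝ) ≤ N - 1 by linarith)
      have h4 := sub_one_mul_rebirthRate (p₀ := p₀) hN (x b)
      have h5 := kill_le hA (x b)
      have h6 := mul_le_mul_of_nonneg_right h5 hL0
      have h7 := mul_le_mul_of_nonneg_right h5 (mul_nonneg (show (0 : ℝ) ≤ N by linarith) hE)
      rw [← h4] at h6 h7
      linarith
    have h3 := Finset.sum_le_card_nsmul _ _ _ h2
    rw [nsmul_eq_mul, card_erase_univ_sub_one hN, mul_div_cancel₀ _ (by linarith),
      Finset.sum_sub_distrib] at h3
    have h4 : ∑ b, particleGen Q p₀ f x b - ∑ b, particleGen Q p₀ f (Function.update x a s) b ≤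
        -rho Q p₀ * L +
          ((N : ℝ) + 3) * ((supRate Q).toReal + (supKill p₀).toReal) * (L - D) := by
      rw [← Finset.add_sum_erase _ _ (Finset.mem_univ a),
        ← Finset.add_sum_erase _ (fun b => particleGen Q p₀ f (Function.update x a s) b)
          (Finset.mem_univ a), rho]
      linarith
    have h5 := mul_le_mul_of_nonneg_left h4 hδ0
    have h6 := mul_le_mul_of_nonneg_right hδ' hE
    linarith

lemma LipschitzInParticles.fvStep_pow [Nontrivial S] {δ : ℝ} (hδ0 : 0 ≤ δ)
    (hδ : δ * fvMesh N Q p₀ ≤ 1 / 2) {f : Bdd (Config S N)} {L : ℝ}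
    (hf : LipschitzInParticles f L) (n : ℕ) :
    LipschitzInParticles ((FlemingViot.fvStep hA hN δ ^ n) f) ((1 - δ * rho Q p₀) ^ n * L) := by
  induction n with
  | zero => simpa using hf
  | succ n ih =>
    rw [eulerStep_pow_succ, pow_succ', mul_assoc]
    exact ih.fvStep hA hN hδ0 hδ

/-- Semigroup of the particle system. -/
abbrev fvSemigroup (t : ℝ) : Bdd (Config S N) →L[ℝ] Bdd (Config S N) :=
  jumpSemigroup (exitRate_fvRate_le hA hN) t

lemma LipschitzInParticles.fvSemigroup [Nontrivial S] {t : ℝ} (ht : 0 ≤ t) {f : Bdd (Config S N)}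
    {L : ℝ} (hf : LipschitzInParticles f L) :
    LipschitzInParticles (fvSemigroup hA hN t f) (Real.exp (-rho Q p₀ * t) * L) := by
  intro x a s
  refine le_of_tendsto_of_tendsto
    ((tendsto_eulerStep_pow (exitRate_fvRate_le hA hN) t f _).sub
      (tendsto_eulerStep_pow (exitRate_fvRate_le hA hN) t f _))
    ((tendsto_one_sub_mesh_pow t (rho Q p₀)).mul_const L) ?_
  filter_upwards [eventually_mesh_le (t := t) (fvMesh N Q p₀) (show (0 : ℝ) < 1 / 2 by norm_num)]
    with n hn
  exact hf.fvStep_pow hA hN (by positivity) hn n x a s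

/-! ### The invariant law of the particle system -/

lemma fvSemigroup_sub_le [Nontrivial S] {t : ℝ} (ht : 0 ≤ t) {f : Bdd (Config S N)}
    (hf : ∀ η, |f η| ≤ 1) (η ξ : Config S N) :
    |fvSemigroup hA hN t f η - fvSemigroup hA hN t f ξ| ≤ N * (2 * Real.exp (-rho Q p₀ * t)) := by
  have h1 : LipschitzInParticles f 2 := fun x a s => by
    have := abs_le.1 (hf (toConfig x))
    have := abs_le.1 (hf (toConfig (Function.update x a s)))
    linarith
  have h2 := (h1.fvSemigroup hA hN ht).sub_le
  rw [abs_sub_le_iff, mul_comm (2 : ℝ)]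
  exact ⟨h2 η ξ, h2 ξ η⟩

variable [Countable S]

instance {N : ℕ} : Countable (Config S N) :=
  inferInstanceAs (Countable {η : S →₀ ℕ // η.degree = N})

instance [Nonempty S] {N : ℕ} : Nonempty (Config S N) :=
  let ⟨s⟩ := ‹Nonempty S›
  ⟨toConfig fun _ => s⟩

lemma IsInvariantLaw.integral_eq {ν : Measure (Config S N)} (hν : IsInvariantLaw Q p₀ ν) {t : ℝ}
    (ht : 0 ≤ t) (f : Bdd (Config S N)) : ∫ η, fvSemigroup hA hN t f η ∂ν = ∫ η, f η ∂ν := by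
  have := hν.1
  conv_rhs => rw [← hν.2 t ht]
  exact (integral_chainLawFrom _ f ht ν).symm

lemma abs_integral_sub_integral_le {E : Type*} [MeasurableSpace E] [DiscreteMeasurableSpace E]
    {μ ν : Measure E} [IsProbabilityMeasure μ] [IsProbabilityMeasure ν] {f : Bdd E} {C : ℝ}
    (h : ∀ x y, |f x - f y| ≤ C) : |∫ x, f x ∂μ - ∫ x, f x ∂ν| ≤ C := by
  obtain ⟨x, hx⟩ := exists_integral_le (f.integrable μ)
  obtain ⟨x', hx'⟩ := exists_le_integral (f.integrable μ)
  obtain ⟨y, hy⟩ := exists_integral_le (f.integrable ν)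
  obtain ⟨y', hy'⟩ := exists_le_integral (f.integrable ν)
  have h1 := abs_le.1 (h x y')
  have h2 := abs_le.1 (h x' y)
  rw [abs_le]
  constructor <;> linarith [h1.2, h2.1]

lemma tendsto_mul_two_mul_exp_neg {ρ : ℝ} (hρ : 0 < ρ) (c : ℝ) :
    Tendsto (fun t : ℝ => c * (2 * Real.exp (-ρ * t))) atTop (𝓝 0) := by
  simpa using (tendsto_two_mul_exp_neg hρ).const_mul c

theorem IsInvariantLaw.unique [Nontrivial S] (hA : BoundedRates Q p₀) (hN : 2 ≤ N)
    (hρ : 0 < rho Q p₀) {ν ν' : Measure (Config S N)}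
    (hν : IsInvariantLaw Q p₀ ν) (hν' : IsInvariantLaw Q p₀ ν') : ν = ν' := by
  have := hν.1
  have := hν'.1
  refine ext_of_integral_bdd fun f hf => ?_
  rw [← sub_eq_zero, ← abs_nonpos_iff]
  refine ge_of_tendsto (tendsto_mul_two_mul_exp_neg hρ N) ?_
  filter_upwards [eventually_ge_atTop 0] with t ht
  rw [← hν.integral_eq hA hN ht, ← hν'.integral_eq hA hN ht]
  exact abs_integral_sub_integral_le (fvSemigroup_sub_le hA hN ht hf)

theorem exists_isInvariantLaw [Nontrivial S] (hA : BoundedRates Q p₀) (hN : 2 ≤ N)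
    (hρ : 0 < rho Q p₀) : ∃ ν : Measure (Config S N), IsInvariantLaw Q p₀ ν := by
  obtain ⟨η⟩ : Nonempty (Config S N) := inferInstance
  have hq := exitRate_fvRate_le (Q := Q) (p₀ := p₀) hA hN
  set μ : ℕ → Measure (Config S N) := fun n => chainLaw (fvRate Q p₀) n η with hμ
  have hμP : ∀ n, IsProbabilityMeasure (μ n) := fun n =>
    isProbabilityMeasure_chainLaw hq (Nat.cast_nonneg n) η
  have hμi : ∀ n (f : Bdd (Config S N)), ∫ ξ, f ξ ∂μ n = fvSemigroup hA hN n f η := fun n f =>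
    integral_chainLaw hq f (Nat.cast_nonneg n) η
  have hlim0 : Tendsto (fun n : ℕ => N * (2 * Real.exp (-rho Q p₀ * n))) atTop (𝓝 0) :=
    (tendsto_mul_two_mul_exp_neg hρ N).comp tendsto_natCast_atTop_atTop
  -- `P_{s + n} f = P_s (P_n f)` is an average of values of `P_n f`
  have hshift : ∀ (s : ℝ), 0 ≤ s → ∀ (n : ℕ) (f : Bdd (Config S N)), (∀ x, |f x| ≤ 1) →
      |fvSemigroup hA hN (s + n) f η - fvSemigroup hA hN n f η| ≤
        N * (2 * Real.exp (-rho Q p₀ * n)) := fun s hs n f hf => by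
    have h1 := isProbabilityMeasure_chainLaw hq hs η
    have h2 := abs_integral_sub_integral_le (μ := chainLaw (fvRate Q p₀) s η)
      (ν := Measure.dirac η) (fvSemigroup_sub_le hA hN (Nat.cast_nonneg n) hf)
    rw [integral_chainLaw hq _ hs, integral_dirac, ← jumpSemigroup_add] at h2
    exact h2
  obtain ⟨ν, hν, hlim⟩ := exists_limit_of_cauchy_tv μ hlim0 fun f hf m n hnm => by
    have h1 := hshift ((m - n : ℕ) : ℝ) (Nat.cast_nonneg _) n f hf
    rwa [← Nat.cast_add, Nat.sub_add_cancel hnm, ← hμi, ← hμi] at h1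
  refine ⟨ν, hν, fun t ht => ?_⟩
  have := isProbabilityMeasure_chainLawFrom hq ht ν
  refine ext_of_integral_bdd fun f hf => ?_
  rw [integral_chainLawFrom hq f ht]
  have h2 : Tendsto (fun n => ∫ ξ, fvSemigroup hA hN t f ξ ∂μ n - ∫ ξ, f ξ ∂μ n) atTop (𝓝 0) := by
    refine squeeze_zero_norm (fun n => ?_) hlim0
    rw [hμi, hμi, ← jumpSemigroup_add, add_comm]
    exact hshift t ht n f hf
  have h3 := (hlim (fvSemigroup hA hN t f)).sub h2
  simp only [sub_sub_cancel, sub_zero] at h3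
  exact tendsto_nhds_unique h3 (hlim f)

end ParticleContraction

/-! ### Bias of the particle system -/

section Bias

variable {S : Type*} {N : ℕ} {Q : S → S → ℝ≥0} {p₀ : S → ℝ≥0}

/-- Effect of a jump of one particle on a quotient of means, to first order in the jump. Here
`H` and `H'` are the means of the survival probability before and after the jump. -/
lemma abs_quotient_sub_linear_le {G H H' d N ω r : ℝ} (hN : 0 < N) (hH : 0 < H) (hH' : 0 < H')
    (hd' : H' = H + N⁻¹ * d) (hG : |G| ≤ ω) (hd : |d| ≤ r * H') :
    |N⁻¹ * G / H' - N⁻¹ * G / H| ≤ ω * r / (N ^ 2 * H) := by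
  have h1 : N⁻¹ * G / H' - N⁻¹ * G / H = -(G * (d / H')) / (N ^ 2 * H) := by
    have : d = N * (H' - H) := by rw [hd']; field_simp; ring
    rw [this]
    field_simp
    ring
  rw [h1, abs_div, abs_neg, abs_mul, abs_div, abs_of_pos hH',
    abs_of_pos (show 0 < N ^ 2 * H by positivity)]
  refine div_le_div_of_nonneg_right ?_ (by positivity)
  exact mul_le_mul hG ((div_le_iff₀ hH').2 hd) (by positivity) ((abs_nonneg _).trans hG)

lemma abs_killedGen_le (hA : BoundedRates Q p₀) {g : Bdd (Option S)} {ω : ℝ} (hg0 : g none = 0)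
    (hosc : ∀ x y : S, |g (some x) - g (some y)| ≤ ω) (hg : ∀ x : S, |g (some x)| ≤ ω) (x : S) :
    |killedGen hA g (some x)| ≤ ((supRate Q).toReal + (supKill p₀).toReal) * ω := by
  have hω : 0 ≤ ω := (abs_nonneg _).trans (hg x)
  rw [killedGen_some, hg0, zero_sub]
  have h1 := abs_tsum_mul_le (f := fun j => g (some j) - g (some x)) (summable_offQ hA x)
    (offQ_nonneg Q x) (fun j => hosc j x)
  have h2 := mul_le_mul_of_nonneg_right (tsum_offQ_le hA x) hω
  have h3 : |(p₀ x : ℝ) * -g (some x)| ≤ (supKill p₀).toReal * ω := by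
    rw [abs_mul, abs_neg, abs_of_nonneg (NNReal.coe_nonneg _)]
    exact mul_le_mul (kill_le hA x) (hg x) (abs_nonneg _) ENNReal.toReal_nonneg
  exact (abs_add_le _ _).trans (by linarith)

lemma abs_mean_le {x : Fin N → S} (hN : 2 ≤ N) {v : S → ℝ} {C : ℝ} (h : ∀ k, |v k| ≤ C) :
    |(N : ℝ)⁻¹ * ∑ a, v (x a)| ≤ C := by
  have hN' : (0 : ℝ) < N := by positivity
  rw [abs_mul, abs_of_pos (inv_pos.2 hN'), inv_mul_le_iff₀ hN']
  refine (Finset.abs_sum_le_sum_abs _ _).trans ((Finset.sum_le_card_nsmul _ _ _ fun a _ =>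
    h (x a)).trans ?_)
  simp

/-- The action of the generator of the particle system on a quotient of means, to first order in
`1 / N`, for one particle. -/
lemma abs_particleGen_sub_linear_le (hA : BoundedRates Q p₀) (hN : 2 ≤ N) {F : Bdd (Config S N)}
    {x : Fin N → S} {v : S → ℝ} {C e : ℝ} (hv : ∀ j, |v j| ≤ C) {a : Fin N}
    (he : ∀ j, |F (toConfig (Function.update x a j)) - F (toConfig x) - v j| ≤ e) :
    |particleGen Q p₀ F x a - (∑' j, offQ Q (x a) j * v j +
      ∑ b ∈ Finset.univ.erase a, rebirthRate N p₀ (x a) * v (x b))| ≤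
      ((supRate Q).toReal + (supKill p₀).toReal) * e := by
  have he0 : 0 ≤ e := (abs_nonneg _).trans (he (x a))
  have s1 : Summable fun j => offQ Q (x a) j *
      (F (toConfig (Function.update x a j)) - F (toConfig x)) :=
    summable_mul_of_bdd (summable_offQ hA _) (offQ_nonneg Q _) fun _ => abs_sub_le_two_norm F _ _
  have s2 := summable_mul_of_bdd (summable_offQ hA (x a)) (offQ_nonneg Q _) hv
  rw [particleGen_eq_erase, add_sub_add_comm, ← s1.tsum_sub s2, ← Finset.sum_sub_distrib]
  simp only [← mul_sub]
  have h1 := (abs_tsum_mul_le (summable_offQ hA (x a)) (offQ_nonneg Q _) he).trans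
    (mul_le_mul_of_nonneg_right (tsum_offQ_le hA (x a)) he0)
  have h2 : |∑ b ∈ Finset.univ.erase a, rebirthRate N p₀ (x a) *
      (F (toConfig (Function.update x a (x b))) - F (toConfig x) - v (x b))| ≤
      (supKill p₀).toReal * e := by
    refine (Finset.abs_sum_le_sum_abs _ _).trans ((Finset.sum_le_card_nsmul _ _
      (rebirthRate N p₀ (x a) * e) fun b _ => ?_).trans ?_)
    · rw [abs_mul, abs_of_nonneg (rebirthRate_nonneg hN _)]
      exact mul_le_mul_of_nonneg_left (he _) (rebirthRate_nonneg hN _)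
    · rw [nsmul_eq_mul, card_erase_univ_sub_one hN, ← mul_assoc, sub_one_mul_rebirthRate hN]
      exact mul_le_mul_of_nonneg_right (kill_le hA _) he0
  exact (abs_add_le _ _).trans (by linarith)

/-- On a function `g` with mean zero, the linearized generator of the particle system is the
generator of the killed chain up to a term of order `1 / N`, which comes from the fact that a dying
particle does not jump onto itself. -/
lemma sum_linear_eq (hA : BoundedRates Q p₀) (hN : 2 ≤ N) {g : Bdd (Option S)} (hg0 : g none = 0)
    {x : Fin N → S} (hmean : ∑ a, g (some (x a)) = 0) :
    ∑ a, (∑' j, offQ Q (x a) j * (g (some j) - g (some (x a))) +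
      ∑ b ∈ Finset.univ.erase a, rebirthRate N p₀ (x a) * (g (some (x b)) - g (some (x a)))) =
    ∑ a, killedGen hA g (some (x a)) - ∑ a, rebirthRate N p₀ (x a) * g (some (x a)) := by
  rw [← Finset.sum_sub_distrib]
  refine Finset.sum_congr rfl fun a _ => ?_
  have h1 : ∑ b ∈ Finset.univ.erase a, rebirthRate N p₀ (x a) *
      (g (some (x b)) - g (some (x a))) = -(N * rebirthRate N p₀ (x a) * g (some (x a))) := by
    have := Finset.add_sum_erase Finset.univ (fun b => rebirthRate N p₀ (x a) *
      (g (some (x b)) - g (some (x a)))) (Finset.mem_univ a)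
    simp only [sub_self, mul_zero, zero_add] at this
    rw [this, ← Finset.mul_sum, Finset.sum_sub_distrib, hmean, Finset.sum_const, Finset.card_univ,
      Fintype.card_fin, nsmul_eq_mul]
    ring
  rw [h1, killedGen_some, hg0]
  have := sub_one_mul_rebirthRate (p₀ := p₀) hN (x a)
  rw [← this]
  ring

variable [MeasurableSpace S]

lemma emp_toConfig (x : Fin N → S) :
    emp (toConfig x) = (N : ℝ≥0∞)⁻¹ • ∑ a, Measure.dirac (x a) := by
  have h : ∑ k ∈ (toConfig x).1.support, ((toConfig x).1 k : ℝ≥0∞) • Measure.dirac k =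
      (toConfig x).1.sum fun k n => (n : ℝ≥0∞) • Measure.dirac k := rfl
  rw [emp, h, toConfig]
  congr 1
  rw [← Finsupp.sum_finsetSum_index (by simp) (by intros; push_cast; rw [add_smul])]
  refine Finset.sum_congr rfl fun a _ => ?_
  rw [Finsupp.sum_single_index] <;> simp

lemma isProbabilityMeasure_emp (hN : 2 ≤ N) (η : Config S N) : IsProbabilityMeasure (emp η) := by
  obtain ⟨x, rfl⟩ := toConfig_surjective η
  rw [emp_toConfig]
  constructor
  simp only [Measure.smul_apply, Measure.finsetSum_apply, measure_univ, Finset.sum_const,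
    Finset.card_univ, Fintype.card_fin, nsmul_eq_mul, mul_one, smul_eq_mul]
  exact ENNReal.inv_mul_cancel (by exact_mod_cast (by omega : N ≠ 0)) (ENNReal.natCast_ne_top N)

variable [DiscreteMeasurableSpace S]

lemma integral_emp (x : Fin N → S) (ψ : Bdd S) :
    ∫ k, ψ k ∂emp (toConfig x) = (N : ℝ)⁻¹ * ∑ a, ψ (x a) := by
  rw [emp_toConfig, integral_smul_measure,
    integral_finsetSum_measure fun a _ => ψ.integrable (Measure.dirac (x a))]
  simp [integral_dirac]

lemma integral_emp_some (x : Fin N → S) (g : Bdd (Option S)) :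
    ∫ k, g (some k) ∂emp (toConfig x) = (N : ℝ)⁻¹ * ∑ a, g (some (x a)) :=
  integral_emp x (restrictSome g)

lemma integral_emp_update_some (x : Fin N → S) (a : Fin N) (j : S) (g : Bdd (Option S)) :
    ∫ k, g (some k) ∂emp (toConfig (Function.update x a j)) =
      ∫ k, g (some k) ∂emp (toConfig x) + (N : ℝ)⁻¹ * (g (some j) - g (some (x a))) := by
  rw [integral_emp_some, integral_emp_some]
  have h1 : ∀ b, g (some (Function.update x a j b)) =
      Function.update (fun b => g (some (x b))) a (g (some j)) b :=
    fun b => Function.apply_update (fun _ k => g (some k)) x a j b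
  simp only [h1]
  rw [Finset.sum_update_of_mem (Finset.mem_univ a),
    Finset.sum_eq_add_sum_sdiff_singleton_of_mem (Finset.mem_univ a) fun b => g (some (x b))]
  ring

variable (hA : BoundedRates Q p₀)

lemma abs_normalizedMean_le_one {δ : ℝ} (hδ0 : 0 ≤ δ) (hδ : δ * meshBound Q p₀ ≤ 1 / 2) (n : ℕ)
    {φ : Bdd S} (hφ : ∀ x, |φ x| ≤ 1) (μ : Measure S) [IsProbabilityMeasure μ] :
    |normalizedMean (killedStep hA δ ^ n) μ φ| ≤ 1 := by
  rw [normalizedMean, abs_div]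
  refine div_le_one_of_le₀ ?_ (abs_nonneg _)
  refine (abs_integral_le_integral_abs).trans (le_trans ?_ (le_abs_self _))
  exact integral_mono (integrable_some _ μ).abs (integrable_some _ μ)
    (abs_killedStep_pow_le hA hδ0 hδ n hφ)

/-- The discrete-time nonlinear flow, as a function of the initial configuration:
`η ↦ m(η) K ^ n φ / m(η) K ^ n 1`. -/
def empFlow (hN : 2 ≤ N) {δ : ℝ} (hδ0 : 0 ≤ δ) (hδ : δ * meshBound Q p₀ ≤ 1 / 2) {φ : Bdd S}
    (hφ : ∀ x, |φ x| ≤ 1) (n : ℕ) : Bdd (Config S N) :=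
  Bdd.mk (fun η => normalizedMean (killedStep hA δ ^ n) (emp η) φ) 1 fun η =>
    have := isProbabilityMeasure_emp hN η
    abs_normalizedMean_le_one hA hδ0 hδ n hφ (emp η)

/-- One step of the particle system follows one step of the nonlinear flow up to errors of order
`δ / N` and `δ ^ 2`. -/
lemma abs_fvStep_empFlow_sub_le [Nontrivial S] (hN : 2 ≤ N) {δ : ℝ} (hδ0 : 0 ≤ δ)
    (hδ : δ * meshBound Q p₀ ≤ 1 / 2) {φ : Bdd S} (hφ : ∀ x, |φ x| ≤ 1) {r : ℝ} (hr0 : 0 ≤ r)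
    (hr : (supKill p₀).toReal - (infKill p₀).toReal ≤ r * rho Q p₀) (n : ℕ) (η : Config S N) :
    |fvStep hA hN δ (empFlow hA hN hδ0 hδ hφ n) η - empFlow hA hN hδ0 hδ hφ (n + 1) η| ≤
      δ * ((1 - δ * ((lam Q).toReal + (infKill p₀).toReal)) ^ n /
        (1 - δ * (supKill p₀).toReal) ^ n) *
      (2 * ((supRate Q).toReal + (supKill p₀).toReal) * r / N + 4 * (supKill p₀).toReal / N +
        4 * δ * ((supRate Q).toReal + (supKill p₀).toReal) *
          ((supRate Q).toReal * r + (supKill p₀).toReal)) := by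
  have hN' : (2 : ℝ) ≤ N := by exact_mod_cast hN
  have hN0 : (0 : ℝ) < N := by linarith
  have hQ0 := ENNReal.toReal_nonneg (a := supRate Q)
  have hp0 := ENNReal.toReal_nonneg (a := supKill p₀)
  obtain ⟨x, rfl⟩ := toConfig_surjective η
  have hμP := isProbabilityMeasure_emp hN (toConfig x)
  set μ := emp (toConfig x) with hμ
  set F := empFlow hA hN hδ0 hδ hφ n with hF
  set D := (supRate Q).toReal + (supKill p₀).toReal with hD
  set c := normalizedMean (killedStep hA δ ^ n) μ φ with hc
  set h := (killedStep hA δ ^ n) (alive S) with hh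
  set g := (killedStep hA δ ^ n) (extendZero φ) - c • h with hg
  set q := (1 - δ * ((lam Q).toReal + (infKill p₀).toReal)) ^ n with hq
  set β := (1 - δ * (supKill p₀).toReal) ^ n with hβdef
  set ω := q * 2 with hω
  have hβ : 0 < β := pow_pos (by linarith [mul_supKill_le hδ0 hδ]) n
  obtain ⟨hg0, hosc, hgω⟩ := centred_killedStep hA hδ0 hδ n μ hφ hg
  have hosc' : ∀ y z : S, |g (some y) - g (some z)| ≤ ω := fun y z =>
    abs_sub_le_iff.2 ⟨hosc y z, hosc z y⟩
  have hω0 : 0 ≤ ω := (abs_nonneg _).trans (hgω (x ⟨0, by omega⟩))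
  have hgn : g none = 0 := by
    rw [hg, Bdd.sub_apply, Bdd.smul_apply, hh, killedStep_pow_none, killedStep_pow_none]; simp
  have hhn : h none = 0 := by rw [hh, killedStep_pow_none]; rfl
  have hhβ : ∀ y : S, β ≤ h (some y) := killedStep_pow_alive_ge hA hδ0 hδ n
  have hhr : ∀ y z w : S, h (some y) - h (some z) ≤ r * h (some w) :=
    killedStep_pow_alive_sub_le hA hδ0 hδ hr0 hr n
  -- comparison of the survival probability with its mean under any law
  have hhr' : ∀ (ν : Measure S) [IsProbabilityMeasure ν] (y z : S),
      |h (some y) - h (some z)| ≤ r * ∫ w, h (some w) ∂ν := fun ν _ y z => by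
    have key : ∀ y z : S, h (some y) - h (some z) ≤ r * ∫ w, h (some w) ∂ν := fun y z => by
      have := le_integral_of_forall_le (μ := ν) (g := r • h) (a := h (some y) - h (some z))
        fun w => hhr y z w
      simpa only [Bdd.smul_apply, integral_const_mul] using this
    exact abs_sub_le_iff.2 ⟨key y z, key z y⟩
  set H := ∫ w, h (some w) ∂μ with hH
  have hHβ : β ≤ H := le_integral_of_forall_le hhβ
  have hH0 : 0 < H := hβ.trans_le hHβ
  -- first-order expansion of the jumps
  have hjump : ∀ a j, |F (toConfig (Function.update x a j)) - F (toConfig x) -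
      (N : ℝ)⁻¹ * (g (some j) - g (some (x a))) / H| ≤ ω * r / ((N : ℝ) ^ 2 * H) := fun a j => by
    have hνP := isProbabilityMeasure_emp hN (toConfig (Function.update x a j))
    have hH' : 0 < ∫ w, h (some w) ∂emp (toConfig (Function.update x a j)) :=
      hβ.trans_le (le_integral_of_forall_le hhβ)
    have e1 : F (toConfig (Function.update x a j)) - F (toConfig x) =
        (N : ℝ)⁻¹ * (g (some j) - g (some (x a))) /
          ∫ w, h (some w) ∂emp (toConfig (Function.update x a j)) := by
      have := normalizedMean_sub_const (K := killedStep hA δ ^ n)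
        (emp (toConfig (Function.update x a j))) φ c hH'
      rw [← hg, integral_emp_update_some, ← hμ, hg0, zero_add] at this
      exact this
    rw [e1]
    exact abs_quotient_sub_linear_le hN0 hH0 hH' (integral_emp_update_some x a j h) (hosc' _ _)
      (hhr' _ _ _)
  have hgmean : ∑ a, g (some (x a)) = 0 := by
    rw [hμ, integral_emp_some] at hg0
    exact (mul_eq_zero.1 hg0).resolve_left (by positivity)
  have hgen : |∑ a, particleGen Q p₀ F x a - (N : ℝ)⁻¹ * (∑ a, killedGen hA g (some (x a)) -
      ∑ a, rebirthRate N p₀ (x a) * g (some (x a))) / H| ≤ D * ω * r / (N * H) := by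
    have e1 : (N : ℝ)⁻¹ * (∑ a, killedGen hA g (some (x a)) -
        ∑ a, rebirthRate N p₀ (x a) * g (some (x a))) / H =
        ∑ a, (∑' j, offQ Q (x a) j * ((N : ℝ)⁻¹ * (g (some j) - g (some (x a))) / H) +
          ∑ b ∈ Finset.univ.erase a, rebirthRate N p₀ (x a) *
            ((N : ℝ)⁻¹ * (g (some (x b)) - g (some (x a))) / H)) := by
      rw [← sum_linear_eq hA hN hgn hgmean, mul_div_right_comm, Finset.mul_sum]
      refine Finset.sum_congr rfl fun a _ => ?_
      rw [mul_add, ← tsum_mul_left, Finset.mul_sum]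
      congr 1
      · exact tsum_congr fun j => by ring
      · exact Finset.sum_congr rfl fun b _ => by ring
    rw [e1, ← Finset.sum_sub_distrib]
    refine (Finset.abs_sum_le_sum_abs _ _).trans ((Finset.sum_le_card_nsmul _ _
      (D * (ω * r / ((N : ℝ) ^ 2 * H))) fun a _ => ?_).trans (le_of_eq ?_))
    · refine abs_particleGen_sub_linear_le hA hN
        (v := fun j => (N : ℝ)⁻¹ * (g (some j) - g (some (x a))) / H)
        (C := (N : ℝ)⁻¹ * ω / H) (fun j => ?_) (hjump a)
      rw [abs_div, abs_mul, abs_of_pos hH0, abs_of_pos (inv_pos.2 hN0)]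
      gcongr
      exact hosc' _ _
    · rw [Finset.card_univ, Fintype.card_fin, nsmul_eq_mul]
      field_simp
  set A := (N : ℝ)⁻¹ * ∑ a, killedGen hA g (some (x a)) with hAdef
  set R := ∑ a, rebirthRate N p₀ (x a) * g (some (x a)) with hRdef
  have hA1 : |A| ≤ D * ω := abs_mean_le (v := fun k => killedGen hA g (some k)) hN
    (abs_killedGen_le hA hgn hosc' hgω)
  have hR1 : |R| ≤ 2 * (supKill p₀).toReal * ω := by
    refine (Finset.abs_sum_le_sum_abs _ _).trans ((Finset.sum_le_card_nsmul _ _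
      ((supKill p₀).toReal / (N - 1) * ω) fun a _ => ?_).trans ?_)
    · rw [abs_mul, abs_of_nonneg (rebirthRate_nonneg hN _)]
      exact mul_le_mul (div_le_div_of_nonneg_right (kill_le hA _) (by linarith)) (hgω _)
        (abs_nonneg _) (div_nonneg hp0 (by linarith))
    · rw [Finset.card_univ, Fintype.card_fin, nsmul_eq_mul]
      have h2 : (N : ℝ) * ((supKill p₀).toReal / (N - 1) * ω) =
          (N / (N - 1)) * ((supKill p₀).toReal * ω) := by ring
      have h3 : (N : ℝ) / (N - 1) ≤ 2 := by rw [div_le_iff₀ (by linarith)]; linarith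
      rw [h2, mul_assoc]
      exact mul_le_mul_of_nonneg_right h3 (by positivity)
  -- the increment of the nonlinear flow
  set H₁ := ∫ w, killedStep hA δ h (some w) ∂μ with hH₁
  have hH₁half : H / 2 ≤ H₁ := by
    rw [hH, ← integral_div]
    refine integral_mono ((integrable_some h μ).div_const 2) (integrable_some _ μ) fun w => ?_
    refine half_le_killedStep hA hδ0 hδ (fun o => ?_) (some w)
    cases o with
    | none => exact hhn.ge
    | some y => exact hβ.le.trans (hhβ y)
  have hH₁0 : 0 < H₁ := by linarith
  have hstep : empFlow hA hN hδ0 hδ hφ (n + 1) (toConfig x) - F (toConfig x) = δ * A / H₁ := by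
    have e1 := normalizedMean_sub_const (K := killedStep hA δ ^ (n + 1)) μ φ c
      (by rw [eulerStep_pow_succ]; exact hH₁0)
    rw [eulerStep_pow_succ, eulerStep_pow_succ, ← map_smul, ← map_sub, ← hh, ← hg] at e1
    refine e1.trans ?_
    congr 1
    rw [hμ, integral_emp_some, hAdef, Finset.mul_sum, Finset.mul_sum, Finset.mul_sum]
    have e2 : ∀ a, killedStep hA δ g (some (x a)) =
      g (some (x a)) + δ * killedGen hA g (some (x a)) := fun a => rfl
    simp only [e2, mul_add, Finset.sum_add_distrib]
    rw [← Finset.mul_sum, hgmean, mul_zero, zero_add]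
    exact Finset.sum_congr rfl fun a _ => by ring
  have hHdiff : |H₁ - H| ≤ δ * (((supRate Q).toReal * r + (supKill p₀).toReal) * H) := by
    have e1 : H₁ - H = δ * ∫ w, killedGen hA h (some w) ∂μ := by
      rw [← integral_const_mul, hH₁, hH, ← integral_sub (integrable_some _ μ) (integrable_some _ μ)]
      refine integral_congr_ae (ae_of_all _ fun w => ?_)
      change h (some w) + δ * killedGen hA h (some w) - h (some w) = _
      ring
    have e2 : ∀ w : S, |killedGen hA h (some w)| ≤
        ((supRate Q).toReal * (r * H)) + (supKill p₀).toReal * h (some w) := fun w => by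
      have hw := hβ.le.trans (hhβ w)
      rw [killedGen_some, hhn, zero_sub]
      have h1 := abs_tsum_mul_le (f := fun j => h (some j) - h (some w)) (summable_offQ hA w)
        (offQ_nonneg Q w) (fun j => hhr' μ j w)
      have h2 := mul_le_mul_of_nonneg_right (tsum_offQ_le hA w)
        (show 0 ≤ r * H by positivity)
      have h3 : |(p₀ w : ℝ) * -h (some w)| ≤ (supKill p₀).toReal * h (some w) := by
        rw [abs_mul, abs_neg, abs_of_nonneg (NNReal.coe_nonneg (p₀ w)), abs_of_nonneg hw]
        exact mul_le_mul_of_nonneg_right (kill_le hA w) hw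
      exact (abs_add_le _ _).trans (by linarith)
    rw [e1, abs_mul, abs_of_nonneg hδ0]
    refine mul_le_mul_of_nonneg_left ?_ hδ0
    have e3 : Integrable (fun w => (supRate Q).toReal * (r * H) +
        (supKill p₀).toReal * h (some w)) μ :=
      (integrable_const _).add ((integrable_some h μ).const_mul _)
    refine abs_integral_le_integral_abs.trans ((integral_mono (integrable_some _ μ).abs
      e3 e2).trans (le_of_eq ?_))
    rw [integral_add (integrable_const _) ((integrable_some h μ).const_mul _), integral_const,
      probReal_univ, integral_const_mul (supKill p₀).toReal fun w => h (some w), ← hH, one_smul]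
    ring
  have hquot : |A / H - A / H₁| ≤
      D * ω * (2 * δ * ((supRate Q).toReal * r + (supKill p₀).toReal)) / H := by
    have e1 : A / H - A / H₁ = A * ((H₁ - H) / H₁) / H := by field_simp
    rw [e1, abs_div, abs_mul, abs_div, abs_of_pos hH0, abs_of_pos hH₁0]
    refine div_le_div_of_nonneg_right ?_ hH0.le
    refine mul_le_mul hA1 ?_ (by positivity) (by positivity)
    rw [div_le_iff₀ hH₁0]
    refine hHdiff.trans ?_
    have h0 : 0 ≤ δ * ((supRate Q).toReal * r + (supKill p₀).toReal) := by positivity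
    nlinarith [mul_le_mul_of_nonneg_left hH₁half h0]
  have hωH : ω / H ≤ 2 * (q / β) := by
    rw [hω, mul_comm q 2, mul_div_assoc]
    have hq0 : 0 ≤ q := by linarith
    gcongr
  have hfinal : fvStep hA hN δ F (toConfig x) - empFlow hA hN hδ0 hδ hφ (n + 1) (toConfig x) =
      δ * ((∑ a, particleGen Q p₀ F x a - (N : ℝ)⁻¹ * (∑ a, killedGen hA g (some (x a)) - R) / H) +
        (A / H - A / H₁) - R / (N * H)) := by
    rw [fvStep_apply]
    have : empFlow hA hN hδ0 hδ hφ (n + 1) (toConfig x) = F (toConfig x) + δ * A / H₁ := by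
      linarith
    rw [this, hAdef]
    field_simp
    ring
  rw [hfinal, abs_mul, abs_of_nonneg hδ0, mul_assoc]
  refine mul_le_mul_of_nonneg_left ?_ hδ0
  have hRH : |R / (N * H)| ≤ 2 * (supKill p₀).toReal * ω / (N * H) := by
    rw [abs_div, abs_of_pos (show 0 < N * H by positivity)]
    gcongr
  refine (abs_sub _ _).trans ((add_le_add ((abs_add_le _ _).trans (add_le_add hgen hquot))
    hRH).trans ?_)
  calc D * ω * r / (N * H) +
        D * ω * (2 * δ * ((supRate Q).toReal * r + (supKill p₀).toReal)) / H +
        2 * (supKill p₀).toReal * ω / (N * H) =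
      (ω / H) * (D * r / N + 2 * (supKill p₀).toReal / N +
        2 * δ * D * ((supRate Q).toReal * r + (supKill p₀).toReal)) := by
        field_simp
        ring
    _ ≤ (2 * (q / β)) * (D * r / N + 2 * (supKill p₀).toReal / N +
        2 * δ * D * ((supRate Q).toReal * r + (supKill p₀).toReal)) := by
        refine mul_le_mul_of_nonneg_right hωH ?_
        positivity
    _ = _ := by ring

end Bias

section BiasVariance

variable {S : Type*} {N : ℕ} {Q : S → S → ℝ≥0} {p₀ : S → ℝ≥0}

lemma mul_fvBound_le (hN : 2 ≤ N) {δ : ℝ} (hδ0 : 0 ≤ δ) (hδ : δ * fvMesh N Q p₀ ≤ 1 / 2) :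
    δ * fvBound N Q p₀ ≤ 1 := by
  refine le_trans (mul_le_mul_of_nonneg_left ?_ hδ0) (hδ.trans (by norm_num))
  have hN' : (2 : ℝ) ≤ N := by exact_mod_cast hN
  have hQ := ENNReal.toReal_nonneg (a := supRate Q)
  have hp := ENNReal.toReal_nonneg (a := supKill p₀)
  have h1 : (fvBound N Q p₀ : ℝ) =
      N * ((supRate Q).toReal + N * (supKill p₀).toReal) := by
    simp only [fvBound, NNReal.coe_mul, NNReal.coe_add, NNReal.coe_natCast]
    rfl
  rw [h1, fvMesh]
  have h2 : (N : ℝ) ≤ (N : ℝ) ^ 2 := by nlinarith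
  nlinarith [mul_le_mul_of_nonneg_right h2 hQ, mul_nonneg (sq_nonneg (N : ℝ)) hQ,
    mul_nonneg (sq_nonneg (N : ℝ)) hp]

lemma mul_meshBound_le (hN : 2 ≤ N) {δ : ℝ} (hδ0 : 0 ≤ δ) (hδ : δ * fvMesh N Q p₀ ≤ 1 / 2) :
    δ * meshBound Q p₀ ≤ 1 / 2 := by
  refine le_trans (mul_le_mul_of_nonneg_left ?_ hδ0) hδ
  have hN' : (2 : ℝ) ≤ N := by exact_mod_cast hN
  have hQ := ENNReal.toReal_nonneg (a := supRate Q)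
  have hp := ENNReal.toReal_nonneg (a := supKill p₀)
  rw [meshBound, fvMesh]
  have h2 : (1 : ℝ) ≤ (N : ℝ) ^ 2 := by nlinarith
  nlinarith [mul_le_mul_of_nonneg_right h2 hQ, mul_le_mul_of_nonneg_right h2 hp]

lemma rho_le_two_supRate [Nontrivial S] (hA : BoundedRates Q p₀) :
    rho Q p₀ ≤ 2 * (supRate Q).toReal := by
  rw [rho]
  linarith [lam_le_two_supRate hA, infKill_le_supKill hA]

/-- A geometric sum of the ratio of the contraction of the killed chain to its survival
probability. -/
lemma rho_mul_sum_le [Nontrivial S] (hA : BoundedRates Q p₀) {δ : ℝ} (hδ0 : 0 ≤ δ)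
    (hδ : δ * meshBound Q p₀ ≤ 1 / 2) (hρ : 0 < rho Q p₀) (n : ℕ) :
    rho Q p₀ * (δ * ∑ k ∈ Finset.range n, (1 - δ * ((lam Q).toReal + (infKill p₀).toReal)) ^ k /
      (1 - δ * (supKill p₀).toReal) ^ k) ≤ 1 := by
  have h1 := mul_supKill_le hδ0 hδ
  have h2 := mul_le_mul_of_nonneg_left (lam_le_two_supRate hA) hδ0
  have h3 := mul_le_mul_of_nonneg_left (infKill_le_supKill hA) hδ0
  have hQ := mul_nonneg hδ0 (ENNReal.toReal_nonneg (a := supRate Q))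
  have hp := mul_nonneg hδ0 (ENNReal.toReal_nonneg (a := supKill p₀))
  rw [meshBound] at hδ
  set θ := (1 - δ * ((lam Q).toReal + (infKill p₀).toReal)) / (1 - δ * (supKill p₀).toReal) with hθ
  have hθ0 : 0 ≤ θ := div_nonneg (by linarith) (by linarith)
  have hθ1 : δ * rho Q p₀ ≤ 1 - θ := by
    have : 1 - θ = δ * rho Q p₀ / (1 - δ * (supKill p₀).toReal) := by
      rw [hθ, eq_div_iff (by linarith), sub_mul, div_mul_cancel₀ _ (by linarith), rho]
      ring
    rw [this]
    exact le_div_self (by positivity) (by linarith) (by linarith)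
  simp only [← div_pow, ← hθ]
  have h4 := mul_neg_geom_sum θ n
  have h5 : 0 ≤ ∑ k ∈ Finset.range n, θ ^ k := Finset.sum_nonneg fun k _ => pow_nonneg hθ0 k
  have h6 := mul_le_mul_of_nonneg_right hθ1 h5
  have h7 := pow_nonneg hθ0 n
  linarith

/-! ### Variance of the particle system -/

/-- The variance created in one step is at most the squared size of the jumps times their rate. -/
lemma fvStep_mul_self_sub_le (hA : BoundedRates Q p₀) (hN : 2 ≤ N) {δ : ℝ} (hδ0 : 0 ≤ δ)
    {f : Bdd (Config S N)} {L : ℝ} (hf : LipschitzInParticles f L) (η : Config S N) :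
    fvStep hA hN δ (f * f) η - fvStep hA hN δ f η * fvStep hA hN δ f η ≤
      δ * (N * (((supRate Q).toReal + (supKill p₀).toReal) * L ^ 2)) := by
  obtain ⟨x, rfl⟩ := toConfig_surjective η
  set c := f (toConfig x) with hc
  set g := f - c • (1 : Bdd (Config S N)) with hg
  have hgx : g (toConfig x) = 0 := by simp [hg, hc]
  have hfg : f * f = g * g + (2 * c) • f - (c * c) • (1 : Bdd (Config S N)) := by
    ext ξ
    simp only [hg, Bdd.mul_apply, Bdd.add_apply, Bdd.sub_apply, Bdd.smul_apply, Bdd.one_apply]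
    ring
  have h1 : fvStep hA hN δ (g * g) (toConfig x) ≤
      δ * (N * (((supRate Q).toReal + (supKill p₀).toReal) * L ^ 2)) := by
    rw [fvStep_apply, Bdd.mul_apply, hgx, mul_zero, zero_add]
    refine mul_le_mul_of_nonneg_left ((Finset.sum_le_card_nsmul _ _ _ fun a _ => ?_).trans_eq
      (by rw [Finset.card_univ, Fintype.card_fin, nsmul_eq_mul])) hδ0
    have h2 := abs_particleGen_sub_linear_le hA hN (F := g * g) (x := x) (v := fun _ => 0) (C := 0)
      (e := L ^ 2) (by simp) (a := a) fun j => by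
        rw [Bdd.mul_apply, Bdd.mul_apply, hgx, mul_zero, sub_zero, sub_zero, abs_mul_self, ← sq,
          ← sq_abs]
        refine pow_le_pow_left₀ (abs_nonneg _) ?_ 2
        simpa [hg] using hf.abs_sub_le x a j
    simp only [mul_zero, tsum_zero, Finset.sum_const_zero, add_zero, sub_zero] at h2
    exact (le_abs_self _).trans h2
  have h3 : fvStep hA hN δ (f * f) (toConfig x) = fvStep hA hN δ (g * g) (toConfig x) +
      2 * c * fvStep hA hN δ f (toConfig x) - c * c := by
    rw [hfg, map_sub, map_add, map_smul, map_smul, eulerStep_one]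
    simp
  rw [h3]
  nlinarith [sq_nonneg (fvStep hA hN δ f (toConfig x) - c)]

/-- The variance after `n` steps is the telescoping sum of the variances created in each of them;
the contraction of Lipschitz constants makes it bounded in `n`. -/
lemma fvStep_pow_mul_self_sub_le [Nontrivial S] (hA : BoundedRates Q p₀) (hN : 2 ≤ N) {δ : ℝ}
    (hδ0 : 0 ≤ δ) (hδ : δ * fvMesh N Q p₀ ≤ 1 / 2) {f : Bdd (Config S N)} {L : ℝ}
    (hf : LipschitzInParticles f L) (n : ℕ) (η : Config S N) :
    (fvStep hA hN δ ^ n) (f * f) η - (fvStep hA hN δ ^ n) f η * (fvStep hA hN δ ^ n) f η ≤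
      δ * (N * (((supRate Q).toReal + (supKill p₀).toReal) * L ^ 2)) *
        ∑ k ∈ Finset.range n, ((1 - δ * rho Q p₀) ^ 2) ^ k := by
  induction n generalizing η with
  | zero => simp
  | succ n ih =>
    set u := (fvStep hA hN δ ^ n) f with hu
    have h1 := eulerStep_pow_le (exitRate_fvRate_le hA hN) hδ0 (mul_fvBound_le hN hδ0 hδ)
      (f := (fvStep hA hN δ ^ n) (f * f) - u * u) ih 1 η
    have h2 := fvStep_mul_self_sub_le hA hN hδ0 (hf.fvStep_pow hA hN hδ0 hδ n) η
    rw [pow_one, map_sub, Bdd.sub_apply] at h1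
    rw [eulerStep_pow_succ, eulerStep_pow_succ, Finset.sum_range_succ, ← hu]
    rw [← hu] at h2
    refine le_trans (le_of_eq ?_) ((add_le_add h1 h2).trans (le_of_eq ?_))
    · ring
    · rw [pow_right_comm]
      ring

/-- The variance of a Lipschitz function of the particle system, uniformly in time. -/
theorem fvSemigroup_mul_self_sub_le [Nontrivial S] (hA : BoundedRates Q p₀) (hN : 2 ≤ N)
    (hρ : 0 < rho Q p₀) {t : ℝ} (ht : 0 ≤ t) {f : Bdd (Config S N)} {L : ℝ}
    (hf : LipschitzInParticles f L) (η : Config S N) :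
    fvSemigroup hA hN t (f * f) η - fvSemigroup hA hN t f η * fvSemigroup hA hN t f η ≤
      N * (((supRate Q).toReal + (supKill p₀).toReal) * L ^ 2) / (2 * rho Q p₀) := by
  have hq := exitRate_fvRate_le (Q := Q) (p₀ := p₀) hA hN
  have hQ0 := ENNReal.toReal_nonneg (a := supRate Q)
  have hp0 := ENNReal.toReal_nonneg (a := supKill p₀)
  have hlim0 : Tendsto (fun n : ℕ => 2 - t / n * rho Q p₀) atTop (𝓝 (2 - 0 * rho Q p₀)) :=
    ((tendsto_const_div_atTop_nhds_zero_nat t).mul_const _).const_sub 2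
  have h1 := (hlim0.const_mul (rho Q p₀)).mul ((tendsto_eulerStep_pow hq t (f * f) η).sub
    ((tendsto_eulerStep_pow hq t f η).mul (tendsto_eulerStep_pow hq t f η)))
  rw [zero_mul, sub_zero] at h1
  rw [le_div_iff₀' (by positivity), mul_comm 2]
  refine le_of_tendsto h1 ?_
  filter_upwards [eventually_mesh_le (t := t) (fvMesh N Q p₀) (show (0 : ℝ) < 1 / 2 by norm_num),
    eventually_mesh_le (t := t) (rho Q p₀) one_pos] with n hn hn'
  set δ := t / n with hδ
  have hδ0 : 0 ≤ δ := by positivity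
  have h2 := fvStep_pow_mul_self_sub_le hA hN hδ0 hn hf n η
  have h3 := mul_neg_geom_sum ((1 - δ * rho Q p₀) ^ 2) n
  have h4 : 0 ≤ ((1 - δ * rho Q p₀) ^ 2) ^ n := by positivity
  set V := N * (((supRate Q).toReal + (supKill p₀).toReal) * L ^ 2) with hV
  have hV0 : 0 ≤ V := by positivity
  have h5 : 0 ≤ rho Q p₀ * (2 - δ * rho Q p₀) := mul_nonneg hρ.le (by linarith)
  refine (mul_le_mul_of_nonneg_left h2 h5).trans ?_
  have h6 : rho Q p₀ * (2 - δ * rho Q p₀) *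
      (δ * V * ∑ k ∈ Finset.range n, ((1 - δ * rho Q p₀) ^ 2) ^ k) =
      V * ((1 - (1 - δ * rho Q p₀) ^ 2) * ∑ k ∈ Finset.range n, ((1 - δ * rho Q p₀) ^ 2) ^ k) := by
    ring
  rw [h6, h3]
  nlinarith

/-! ### Uniform propagation of chaos -/

variable [MeasurableSpace S] [DiscreteMeasurableSpace S]

lemma abs_integral_le_one (μ : Measure S) [IsProbabilityMeasure μ] {φ : Bdd S}
    (hφ : ∀ x, |φ x| ≤ 1) : |∫ k, φ k ∂μ| ≤ 1 := by
  refine abs_integral_le_integral_abs.trans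
    ((integral_mono (φ.integrable _).abs (integrable_const 1) hφ).trans ?_)
  simp

lemma abs_integral_emp_le (hN : 2 ≤ N) {φ : Bdd S} (hφ : ∀ x, |φ x| ≤ 1) (η : Config S N) :
    |∫ k, φ k ∂emp η| ≤ 1 :=
  have := isProbabilityMeasure_emp hN η
  abs_integral_le_one _ hφ

/-- The function `η ↦ m(η)(φ)`. -/
def empMean (hN : 2 ≤ N) {φ : Bdd S} (hφ : ∀ x, |φ x| ≤ 1) : Bdd (Config S N) :=
  Bdd.mk (fun η => ∫ k, φ k ∂emp η) 1 (abs_integral_emp_le hN hφ)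

lemma empFlow_zero (hA : BoundedRates Q p₀) (hN : 2 ≤ N) {δ : ℝ} (hδ0 : 0 ≤ δ)
    (hδ : δ * meshBound Q p₀ ≤ 1 / 2) {φ : Bdd S} (hφ : ∀ x, |φ x| ≤ 1) :
    empFlow hA hN hδ0 hδ hφ 0 = empMean hN hφ := by
  ext η
  have := isProbabilityMeasure_emp hN η
  change (∫ k, φ k ∂emp η) / ∫ _, (1 : ℝ) ∂emp η = ∫ k, φ k ∂emp η
  simp

/-- The distance between the mean of the particle system and the nonlinear flow is at most the sum
of the one-step errors, since the steps of the particle system do not expand the supremum norm. -/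
lemma abs_fvStep_pow_empMean_sub_le [Nontrivial S] (hA : BoundedRates Q p₀) (hN : 2 ≤ N)
    {δ : ℝ} (hδ0 : 0 ≤ δ) (hδ : δ * fvMesh N Q p₀ ≤ 1 / 2) {φ : Bdd S} (hφ : ∀ x, |φ x| ≤ 1)
    {r : ℝ} (hr0 : 0 ≤ r) (hr : (supKill p₀).toReal - (infKill p₀).toReal ≤ r * rho Q p₀)
    (hρ : 0 < rho Q p₀) (n : ℕ) (η : Config S N) :
    rho Q p₀ * |(fvStep hA hN δ ^ n) (empMean hN hφ) η -
      normalizedMean (killedStep hA δ ^ n) (emp η) φ| ≤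
      2 * ((supRate Q).toReal + (supKill p₀).toReal) * r / N + 4 * (supKill p₀).toReal / N +
        4 * δ * ((supRate Q).toReal + (supKill p₀).toReal) *
          ((supRate Q).toReal * r + (supKill p₀).toReal) := by
  have hδ' := mul_meshBound_le hN hδ0 hδ
  have hQ0 := ENNReal.toReal_nonneg (a := supRate Q)
  have hp0 := ENNReal.toReal_nonneg (a := supKill p₀)
  set e := 2 * ((supRate Q).toReal + (supKill p₀).toReal) * r / N + 4 * (supKill p₀).toReal / N +
        4 * δ * ((supRate Q).toReal + (supKill p₀).toReal) *
          ((supRate Q).toReal * r + (supKill p₀).toReal) with he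
  have he0 : 0 ≤ e := by positivity
  set θ : ℕ → ℝ := fun k => (1 - δ * ((lam Q).toReal + (infKill p₀).toReal)) ^ k /
      (1 - δ * (supKill p₀).toReal) ^ k with hθ
  have key : ∀ η, |((fvStep hA hN δ ^ n) (empMean hN hφ) - empFlow hA hN hδ0 hδ' hφ n) η| ≤
      (δ * ∑ k ∈ Finset.range n, θ k) * e := by
    induction n with
    | zero =>
      intro η
      rw [empFlow_zero, pow_zero]
      simp
    | succ n ih =>
      intro η
      have h1 := eulerStep_pow_abs_le (exitRate_fvRate_le hA hN) hδ0 (mul_fvBound_le hN hδ0 hδ) ih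
        1 η
      have h2 := abs_fvStep_empFlow_sub_le hA hN hδ0 hδ' hφ hr0 hr n η
      rw [pow_one, map_sub, Bdd.sub_apply, ← eulerStep_pow_succ] at h1
      rw [Finset.sum_range_succ, Bdd.sub_apply]
      refine (abs_sub_le _ (fvStep hA hN δ (empFlow hA hN hδ0 hδ' hφ n) η) _).trans
        ((add_le_add h1 h2).trans (le_of_eq ?_))
      ring
  calc _ ≤ rho Q p₀ * ((δ * ∑ k ∈ Finset.range n, θ k) * e) :=
        mul_le_mul_of_nonneg_left (key η) hρ.le
    _ = (rho Q p₀ * (δ * ∑ k ∈ Finset.range n, θ k)) * e := by ring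
    _ ≤ 1 * e := mul_le_mul_of_nonneg_right (rho_mul_sum_le hA hδ0 hδ' hρ n) he0
    _ = e := one_mul e

/-- The bias of the particle system is of order `1 / N`, uniformly in time. -/
theorem abs_fvSemigroup_empMean_sub_le [Nontrivial S] (hA : BoundedRates Q p₀) (hN : 2 ≤ N)
    (hρ : 0 < rho Q p₀) {t : ℝ} (ht : 0 ≤ t) {φ : Bdd S} (hφ : ∀ x, |φ x| ≤ 1) (η : Config S N) :
    |fvSemigroup hA hN t (empMean hN hφ) η - normalizedMean (killedSemigroup hA t) (emp η) φ| ≤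
      (2 * ((supRate Q).toReal + (supKill p₀).toReal) * (supKill p₀).toReal / rho Q p₀ ^ 2 +
        4 * (supKill p₀).toReal / rho Q p₀) / N := by
  have := isProbabilityMeasure_emp hN η
  have hN' : (2 : ℝ) ≤ N := by exact_mod_cast hN
  set r := (supKill p₀).toReal / rho Q p₀ with hr
  have hr0 : 0 ≤ r := div_nonneg ENNReal.toReal_nonneg hρ.le
  have hr1 : (supKill p₀).toReal - (infKill p₀).toReal ≤ r * rho Q p₀ := by
    rw [hr, div_mul_cancel₀ _ hρ.ne']
    linarith [ENNReal.toReal_nonneg (a := infKill p₀)]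
  have h1 := (((tendsto_eulerStep_pow (exitRate_fvRate_le hA hN) t (empMean hN hφ) η).sub
    (tendsto_normalizedMean hA ht (emp η) φ)).abs).const_mul (rho Q p₀)
  have h2 : Tendsto (fun n : ℕ =>
      2 * ((supRate Q).toReal + (supKill p₀).toReal) * r / N + 4 * (supKill p₀).toReal / N +
        4 * (t / n) * ((supRate Q).toReal + (supKill p₀).toReal) *
          ((supRate Q).toReal * r + (supKill p₀).toReal)) atTop
      (𝓝 (2 * ((supRate Q).toReal + (supKill p₀).toReal) * r / N + 4 * (supKill p₀).toReal / N +
        4 * 0 * ((supRate Q).toReal + (supKill p₀).toReal) *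
          ((supRate Q).toReal * r + (supKill p₀).toReal))) :=
    Tendsto.const_add _ ((((tendsto_const_div_atTop_nhds_zero_nat t).const_mul 4).mul_const
      _).mul_const _)
  have h3 := le_of_tendsto_of_tendsto h1 h2 (by
    filter_upwards [eventually_mesh_le (t := t) (fvMesh N Q p₀) (show (0 : ℝ) < 1 / 2 by norm_num)]
      with n hn
    exact abs_fvStep_pow_empMean_sub_le hA hN (by positivity) hn hφ hr0 hr1 hρ n η)
  rw [← le_div_iff₀' hρ] at h3
  refine h3.trans (le_of_eq ?_)
  rw [hr]
  field_simp
  ring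

lemma empMean_lipschitzInParticles (hN : 2 ≤ N) {φ : Bdd S} (hφ : ∀ x, |φ x| ≤ 1) :
    LipschitzInParticles (empMean hN hφ) (2 / N) := fun x a s => by
  have hN' : (2 : ℝ) ≤ N := by exact_mod_cast hN
  have h1 : ∫ k, φ k ∂emp (toConfig (Function.update x a s)) =
      ∫ k, φ k ∂emp (toConfig x) + (N : ℝ)⁻¹ * (φ s - φ (x a)) :=
    integral_emp_update_some x a s (extendZero φ)
  change ∫ k, φ k ∂emp (toConfig x) - ∫ k, φ k ∂emp (toConfig (Function.update x a s)) ≤ 2 / N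
  rw [h1, div_eq_inv_mul]
  have h2 : φ (x a) - φ s ≤ 2 := by
    linarith [(abs_le.1 (hφ (x a))).2, (abs_le.1 (hφ s)).1]
  have h3 := mul_le_mul_of_nonneg_left h2 (show (0 : ℝ) ≤ (N : ℝ)⁻¹ by positivity)
  linarith

end BiasVariance

/-- The mean distance to `u` is at most the standard deviation plus the bias. -/
lemma Bdd.integral_abs_sub_le {E : Type*} [MeasurableSpace E] [DiscreteMeasurableSpace E]
    (f : Bdd E) (μ : Measure E) [IsProbabilityMeasure μ] (u : ℝ) :
    ∫ x, |f x - u| ∂μ ≤ √(∫ x, (f * f) x ∂μ - (∫ x, f x ∂μ) * ∫ x, f x ∂μ) +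
      |∫ x, f x ∂μ - u| := by
  have hf : MemLp (fun x => f x) 2 μ :=
    MemLp.of_bound Measurable.of_discrete.aestronglyMeasurable ‖f‖ (ae_of_all _ f.abs_apply_le)
  set c := ∫ x, f x ∂μ with hc
  have hY : MemLp (fun x => |f x - c|) 2 μ := (hf.sub (memLp_const c)).norm
  have h1 : ∫ x, |f x - u| ∂μ ≤ ∫ x, (|f x - c| + |c - u|) ∂μ :=
    integral_mono ((f.integrable μ).sub (integrable_const u)).abs
      ((hY.integrable one_le_two).add (integrable_const _)) fun x => abs_sub_le _ _ _
  rw [integral_add (hY.integrable one_le_two) (integrable_const _), integral_const, probReal_univ,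
    one_smul] at h1
  -- the variance of `|f - c|` is nonnegative, so its squared mean is at most the variance of `f`
  have h2 := variance_nonneg (fun x => |f x - c|) μ
  have h3 := variance_eq_integral (μ := μ) hf.aestronglyMeasurable.aemeasurable
  rw [variance_eq_sub hY] at h2
  rw [variance_eq_sub hf] at h3
  simp only [Pi.pow_apply, sq_abs, ← hc] at h2 h3
  refine h1.trans (add_le_add (Real.le_sqrt_of_sq_le ?_) le_rfl)
  have h4 : ∫ x, (f * f) x ∂μ = ∫ x, f x ^ 2 ∂μ :=
    integral_congr_ae (ae_of_all _ fun x => (sq _).symm)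
  rw [h4]
  linarith

/-! ### The constants -/

section Constants

variable {S : Type*} {Q : S → S → ℝ≥0} {p₀ : S → ℝ≥0}

/-- Up to the trivial bound `2`, the sum of the standard deviation and the bias is at most
`K₀ / N ^ γ`. With `w = B C / (√2 ρ √N)`, the right-hand side is
`2 (B + ρ) / B * w ^ (ρ / (B + ρ))`. If `1 ≤ w`, it exceeds `2`; otherwise it exceeds
`2 (B + ρ) / B * w = √2 C (1 + B / ρ) / √N`, whose terms dominate those
on the left-hand side. -/
lemma min_two_le_mul_rpow {q p ρ B C n : ℝ} (hq : 0 < q) (hp : 0 ≤ p) (hρ : 0 < ρ)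
    (hρq : ρ ≤ 2 * q) (hB : B = q + 2 * p)
    (hC : C = √(2 * (q + p) / ρ) + 2 * p / B + 2 * p * √(2 / (B * ρ))) (hn : 2 ≤ n) :
    min 2 (√(2 * (q + p) / (ρ * n)) + (2 * (q + p) * p / ρ ^ 2 + 4 * p / ρ) / n) ≤
      2 * ((B + ρ) / B) * (B * C / (√2 * ρ)) ^ (ρ / (B + ρ)) / n ^ (ρ / (2 * (B + ρ))) := by
  have hB0 : 0 < B := by linarith
  have hn0 : 0 < n := by linarith
  have hs2 : 0 < √2 := by positivity
  set a := √(2 * (q + p) / ρ) with ha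
  have ha0 : 0 < a := Real.sqrt_pos.2 (by positivity)
  have hC0 : a ≤ C := by
    rw [hC]
    have : 0 ≤ 2 * p / B := by positivity
    have : 0 ≤ 2 * p * √(2 / (B * ρ)) := by positivity
    linarith
  set m := √n with hm
  have hm0 : 0 < m := Real.sqrt_pos.2 hn0
  have hmm : m * m = n := Real.mul_self_sqrt hn0.le
  set w := B * C / (√2 * ρ) / m with hw
  have hCpos : 0 < C := ha0.trans_le hC0
  have hw0 : 0 < w := by positivity
  have hrhs : 2 * ((B + ρ) / B) * (B * C / (√2 * ρ)) ^ (ρ / (B + ρ)) / n ^ (ρ / (2 * (B + ρ))) =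
      2 * ((B + ρ) / B) * w ^ (ρ / (B + ρ)) := by
    have hmn : m ^ (ρ / (B + ρ)) = n ^ (ρ / (2 * (B + ρ))) := by
      rw [hm, Real.sqrt_eq_rpow n, ← Real.rpow_mul hn0.le]
      congr 1
      field_simp
    rw [hw, Real.div_rpow (by positivity) hm0.le, hmn, mul_div_assoc]
  rw [hrhs]
  have hα0 : 0 ≤ ρ / (B + ρ) := by positivity
  have hα1 : ρ / (B + ρ) ≤ 1 := (div_le_one (by positivity)).2 (by linarith)
  have hBρ : 1 ≤ (B + ρ) / B := (one_le_div hB0).2 (by linarith)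
  rcases le_or_gt 1 w with h1w | hw1
  · refine (min_le_left _ _).trans ?_
    have h1 := Real.one_le_rpow h1w hα0
    nlinarith
  · refine (min_le_right _ _).trans ?_
    have h1 : w ≤ w ^ (ρ / (B + ρ)) := by
      simpa using Real.rpow_le_rpow_of_exponent_ge hw0 hw1.le hα1
    refine le_trans ?_ (mul_le_mul_of_nonneg_left h1 (by positivity))
    have hs : √2 * √2 = 2 := Real.mul_self_sqrt (by norm_num)
    have h2w : 2 * ((B + ρ) / B) * w = √2 * C * (1 + B / ρ) / m := by
      rw [hw]
      field_simp
      rw [sq, hs]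
      ring
    have hstd : √(2 * (q + p) / (ρ * n)) = a / m := by
      rw [ha, hm, ← Real.sqrt_div (by positivity)]
      congr 1
      field_simp
    have hsqrt2 : 1 ≤ √2 := by
      rw [Real.one_le_sqrt]; norm_num
    have hmge : √2 ≤ m := Real.sqrt_le_sqrt hn
    set b := √(2 / (B * ρ)) with hb
    have hb0 : 0 < b := Real.sqrt_pos.2 (by positivity)
    have hbb : b * b = 2 / (B * ρ) := Real.mul_self_sqrt (by positivity)
    -- `w < 1` says that `n` is not too small, namely `q + p ≤ 2 √(B ρ n)`
    have hDm : q + p ≤ √2 * (B * b * ρ) * m := by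
      have h3 : B * a < √2 * ρ * m := by
        have h4 : B * C < √2 * ρ * m := by
          rw [hw, div_div, div_lt_one (by positivity)] at hw1
          exact hw1
        exact (mul_le_mul_of_nonneg_left hC0 hB0.le).trans_lt h4
      have h5 : (q + p) * (q + p) ≤ (√2 * (B * b * ρ) * m) * (√2 * (B * b * ρ) * m) := by
        have haa : a * a = 2 * (q + p) / ρ := Real.mul_self_sqrt (by positivity)
        have h6 : (B * a) * (B * a) ≤ (√2 * ρ * m) * (√2 * ρ * m) :=
          mul_self_le_mul_self (by positivity) h3.le
        have h7 : (B * a) * (B * a) = B * B * (2 * (q + p) / ρ) := by rw [← haa]; ring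
        have h8 : (√2 * ρ * m) * (√2 * ρ * m) = 2 * ρ * ρ * n := by
          rw [← hmm]
          calc _ = (√2 * √2) * ρ * ρ * (m * m) := by ring
            _ = _ := by rw [hs]
        have h9 : (√2 * (B * b * ρ) * m) * (√2 * (B * b * ρ) * m) = 4 * B * ρ * n := by
          calc _ = (√2 * √2) * (b * b) * (B * B * ρ * ρ) * (m * m) := by ring
            _ = _ := by rw [hs, hbb, hmm]; field_simp; ring
        rw [h7, h8, mul_div_assoc', div_le_iff₀ hρ] at h6
        rw [h9]
        -- `h6` reads `B² (q + p) ≤ ρ³ n`; multiply by `q + p ≤ B` and use `ρ ≤ 2 B`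
        have h10 : q + p ≤ B := by linarith
        have h11 : ρ * ρ ≤ (2 * B) * (2 * B) :=
          mul_self_le_mul_self hρ.le (by linarith)
        have h12 : B * B * ((q + p) * (q + p)) ≤ B * B * (4 * B * ρ * n) := by
          have h13 : B * B * (q + p) ≤ ρ * ρ * ρ * n := by linarith
          have h14 := mul_le_mul h13 h10 (by positivity) (by positivity)
          have h15 := mul_le_mul_of_nonneg_right h11 (show 0 ≤ ρ * n * B by positivity)
          linarith
        exact le_of_mul_le_mul_left h12 (by positivity)
      exact (mul_self_le_mul_self_iff (by positivity) (by positivity)).2 h5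
    rw [h2w, hstd, ← hmm, div_mul_eq_div_div, ← add_div]
    refine div_le_div_of_nonneg_right ?_ hm0.le
    have t1 : a ≤ √2 * a := le_mul_of_one_le_left ha0.le hsqrt2
    have t2 : 4 * p / ρ / m ≤ √2 * (2 * p / B) * (B / ρ) := by
      have : √2 * (2 * p / B) * (B / ρ) = √2 * (2 * p) / ρ := by field_simp
      rw [this, div_div, div_le_div_iff₀ (by positivity) hρ]
      have : 4 * p = √2 * (2 * p) * √2 := by
        calc 4 * p = 2 * (2 * p) := by ring
          _ = (√2 * √2) * (2 * p) := by rw [hs]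
          _ = _ := by ring
      rw [this]
      have h0 : 0 ≤ √2 * (2 * p) * ρ := by positivity
      nlinarith [mul_le_mul_of_nonneg_left hmge h0]
    have t3 : 2 * (q + p) * p / ρ ^ 2 / m ≤ √2 * (2 * p * b) * (B / ρ) := by
      rw [div_div, div_le_iff₀ (by positivity)]
      have : √2 * (2 * p * b) * (B / ρ) * (ρ ^ 2 * m) = 2 * p * (√2 * (B * b * ρ) * m) := by
        field_simp
      rw [this]
      nlinarith [mul_le_mul_of_nonneg_left hDm (show 0 ≤ 2 * p by positivity)]
    have t4 : 0 ≤ √2 * (2 * p / B) + √2 * (2 * p * b) + √2 * a * (B / ρ) := by positivity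
    rw [add_div, hC]
    linarith

lemma supRate_pos [Nontrivial S] (hA : BoundedRates Q p₀) (hρ : 0 < rho Q p₀) :
    0 < (supRate Q).toReal := by
  linarith [rho_le_two_supRate hA]

lemma constB_pos [Nontrivial S] (hA : BoundedRates Q p₀) (hρ : 0 < rho Q p₀) :
    0 < constB Q p₀ := by
  have := supRate_pos hA hρ
  have := ENNReal.toReal_nonneg (a := supKill p₀)
  rw [constB]
  positivity

lemma gammaExp_pos [Nontrivial S] (hA : BoundedRates Q p₀) (hρ : 0 < rho Q p₀) :
    0 < gammaExp Q p₀ := by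
  have := constB_pos hA hρ
  rw [gammaExp]
  positivity

lemma constK_pos [Nontrivial S] (hA : BoundedRates Q p₀) (hρ : 0 < rho Q p₀) :
    0 < constK Q p₀ := by
  have hB := constB_pos hA hρ
  have hQ := supRate_pos hA hρ
  have hp := ENNReal.toReal_nonneg (a := supKill p₀)
  have hC : 0 < constC Q p₀ := by
    rw [constC]
    positivity
  rw [constK]
  positivity

end Constants

/-! ### The bounds for the particle system -/

section Chaos

variable {S : Type*} {N : ℕ} {Q : S → S → ℝ≥0} {p₀ : S → ℝ≥0} [Countable S] [Nontrivial S]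
  [MeasurableSpace S] [DiscreteMeasurableSpace S]

/-- Uniform propagation of chaos for a fixed starting configuration. The value of a bounded test
function under the two probability measures differs by at most `2`, which is what makes the bound
hold for small `N`. -/
theorem integral_abs_empMean_sub_le (hA : BoundedRates Q p₀) (hρ : 0 < rho Q p₀) (hN : 2 ≤ N)
    {t : ℝ} (ht : 0 ≤ t) {φ : Bdd S} (hφ : ∀ x, |φ x| ≤ 1) (η : Config S N) :
    ∫ ξ, |empMean hN hφ ξ - normalizedMean (killedSemigroup hA t) (emp η) φ| ∂(fvLaw Q p₀ t η) ≤
      constK Q p₀ / (N : ℝ) ^ gammaExp Q p₀ := by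
  have hN' : (2 : ℝ) ≤ N := by exact_mod_cast hN
  have hq := exitRate_fvRate_le (Q := Q) (p₀ := p₀) hA hN
  have hP : IsProbabilityMeasure (fvLaw Q p₀ t η) := isProbabilityMeasure_chainLaw hq ht η
  have hμP := isProbabilityMeasure_emp hN η
  have hp0 := ENNReal.toReal_nonneg (a := supKill p₀)
  have hQ0 := supRate_pos hA hρ
  set u := normalizedMean (killedSemigroup hA t) (emp η) φ with hu
  have hu1 : |u| ≤ 1 := by
    have hc := isProbabilityMeasure_condLaw hA ht (emp η)
    rw [hu, ← integral_condLaw hA ht]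
    exact abs_integral_le_one _ hφ
  refine le_trans (le_min ?_ ?_) (min_two_le_mul_rpow hQ0 hp0 hρ (rho_le_two_supRate hA)
    rfl rfl hN')
  · have h1 : ∫ ξ, |empMean hN hφ ξ - u| ∂(fvLaw Q p₀ t η) ≤ ∫ _, (2 : ℝ) ∂(fvLaw Q p₀ t η) :=
      integral_mono (((empMean hN hφ).integrable _).sub (integrable_const u)).abs
        (integrable_const 2) fun ξ => (abs_sub _ _).trans
          ((add_le_add (abs_integral_emp_le hN hφ ξ) hu1).trans_eq one_add_one_eq_two)
    simpa using h1
  · refine ((empMean hN hφ).integral_abs_sub_le (fvLaw Q p₀ t η) u).trans ?_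
    have e1 : ∀ f : Bdd (Config S N), ∫ ξ, f ξ ∂(fvLaw Q p₀ t η) = fvSemigroup hA hN t f η :=
      fun f => integral_chainLaw hq f ht η
    rw [e1, e1]
    refine add_le_add (Real.sqrt_le_sqrt ?_) (abs_fvSemigroup_empMean_sub_le hA hN hρ ht hφ η)
    refine (fvSemigroup_mul_self_sub_le hA hN hρ ht (empMean_lipschitzInParticles hN hφ)
      η).trans (le_of_eq ?_)
    field_simp

/-- The bound for the invariant law is the limit `t → ∞` of the bounds at time `t`. -/
theorem integral_abs_empMean_sub_qsd_le (hA : BoundedRates Q p₀) (hρ : 0 < rho Q p₀) (hN : 2 ≤ N)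
    {φ : Bdd S} (hφ : ∀ x, |φ x| ≤ 1) {νN : Measure (Config S N)} {νqs : Measure S}
    (hνN : IsInvariantLaw Q p₀ νN) (hνqs : IsQSD Q p₀ νqs) :
    ∫ ξ, |empMean hN hφ ξ - ∫ k, φ k ∂νqs| ∂νN ≤ constK Q p₀ / (N : ℝ) ^ gammaExp Q p₀ := by
  have := hνN.1
  have := hνqs.1
  have hq := exitRate_fvRate_le (Q := Q) (p₀ := p₀) hA hN
  set c := ∫ k, φ k ∂νqs with hc
  set f : Bdd (Config S N) := Bdd.mk (fun ξ => |empMean hN hφ ξ - c|) (1 + |c|) fun ξ => by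
    rw [abs_abs]
    exact (abs_sub _ _).trans (add_le_add (abs_integral_emp_le hN hφ ξ) le_rfl) with hf
  have hlim := (tendsto_two_mul_exp_neg hρ).const_add (constK Q p₀ / (N : ℝ) ^ gammaExp Q p₀)
  rw [add_zero] at hlim
  refine ge_of_tendsto hlim ?_
  filter_upwards [eventually_ge_atTop 0] with t ht
  have h1 : ∀ η, fvSemigroup hA hN t f η ≤
      constK Q p₀ / (N : ℝ) ^ gammaExp Q p₀ + 2 * Real.exp (-rho Q p₀ * t) := fun η => by
    have hP : IsProbabilityMeasure (fvLaw Q p₀ t η) := isProbabilityMeasure_chainLaw hq ht η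
    have hμP := isProbabilityMeasure_emp hN η
    set u := normalizedMean (killedSemigroup hA t) (emp η) φ with hu
    have hint : Integrable (fun ξ => |empMean hN hφ ξ - u|) (fvLaw Q p₀ t η) :=
      (((empMean hN hφ).integrable _).sub (integrable_const u)).abs
    have h2 : |u - c| ≤ 2 * Real.exp (-rho Q p₀ * t) := by
      rw [hu, hc, ← hνqs.normalizedMean_eq hA ht φ]
      exact abs_condMean_sub_le hA ht νqs (emp η) hφ
    have h3 : ∫ ξ, f ξ ∂(fvLaw Q p₀ t η) ≤
        ∫ ξ, (|empMean hN hφ ξ - u| + 2 * Real.exp (-rho Q p₀ * t)) ∂(fvLaw Q p₀ t η) :=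
      integral_mono (f.integrable _) (hint.add (integrable_const _)) fun ξ =>
        (abs_sub_le _ u _).trans (add_le_add le_rfl h2)
    rw [integral_add hint (integrable_const _), integral_const, probReal_univ, one_smul] at h3
    rw [← integral_chainLaw hq f ht η]
    exact h3.trans (add_le_add (integral_abs_empMean_sub_le hA hρ hN ht hφ η) le_rfl)
  have h4 : ∫ ξ, f ξ ∂νN ≤
      ∫ _, (constK Q p₀ / (N : ℝ) ^ gammaExp Q p₀ + 2 * Real.exp (-rho Q p₀ * t)) ∂νN := by
    rw [← hνN.integral_eq hA hN ht f]
    exact integral_mono ((fvSemigroup hA hN t f).integrable _) (integrable_const _) h1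
  rwa [integral_const, probReal_univ, one_smul] at h4

end Chaos

end FlemingViot

end

theorem mainTheorem6 {S : Type*} [Countable S] [Nontrivial S] [MeasurableSpace S]
    [DiscreteMeasurableSpace S] (Q : S → S → ℝ≥0) (p₀ : S → ℝ≥0)
    (hA : BoundedRates Q p₀) (hρ : 0 < rho Q p₀) :
    -- the explicit constants are positive
    0 < constK Q p₀ ∧ 0 < gammaExp Q p₀ ∧
    -- the laws involved are probability measures
    (∀ μ : Measure S, IsProbabilityMeasure μ → ∀ t : ℝ, 0 ≤ t →
      IsProbabilityMeasure (condLaw Q p₀ t μ)) ∧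
    (∀ N : ℕ, 2 ≤ N → ∀ (η : Config S N) (t : ℝ), 0 ≤ t →
      IsProbabilityMeasure (fvLaw Q p₀ t η)) ∧
    -- the bound, uniform in time, in the test function, in `η` and in `N`
    (∀ N : ℕ, 2 ≤ N → ∀ (η : Config S N) (t : ℝ), 0 ≤ t →
      ∀ φ : S → ℝ, (∀ k, |φ k| ≤ 1) →
        ∫ ξ, |∫ k, φ k ∂(emp ξ) - ∫ k, φ k ∂(condLaw Q p₀ t (emp η))| ∂(fvLaw Q p₀ t η)
          ≤ constK Q p₀ / (N : ℝ) ^ gammaExp Q p₀) ∧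
    -- under the invariant law, the empirical measure is close to the quasi-stationary distribution
    (∃! νqs : Measure S, IsQSD Q p₀ νqs) ∧
    (∀ N : ℕ, 2 ≤ N →
      (∃! νN : Measure (Config S N), IsInvariantLaw Q p₀ νN) ∧
      ∀ (νN : Measure (Config S N)) (νqs : Measure S),
        IsInvariantLaw Q p₀ νN → IsQSD Q p₀ νqs →
        ∀ φ : S → ℝ, (∀ k, |φ k| ≤ 1) →
          ∫ ξ, |∫ k, φ k ∂(emp ξ) - ∫ k, φ k ∂νqs| ∂νN
            ≤ constK Q p₀ / (N : ℝ) ^ gammaExp Q p₀) := by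
  refine ⟨constK_pos hA hρ, gammaExp_pos hA hρ,
    fun μ _ t ht => isProbabilityMeasure_condLaw hA ht μ,
    fun N hN η t ht => isProbabilityMeasure_chainLaw (exitRate_fvRate_le hA hN) ht η,
    fun N hN η t ht φ hφ => ?_, ?_, fun N hN => ⟨?_, fun νN νqs hνN hνqs φ hφ => ?_⟩⟩
  · have := isProbabilityMeasure_emp hN η
    have h := integral_abs_empMean_sub_le hA hρ hN ht (φ := Bdd.mk φ 1 hφ) hφ η
    rw [← integral_condLaw hA ht] at h
    exact h
  · obtain ⟨ν, hν⟩ := exists_isQSD hA hρ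
    exact ⟨ν, hν, fun ν' hν' => hν'.unique hA hρ hν⟩
  · obtain ⟨ν, hν⟩ := exists_isInvariantLaw hA hN hρ
    exact ⟨ν, hν, fun ν' hν' => hν'.unique hA hN hρ hν⟩
  · exact integral_abs_empMean_sub_qsd_le hA hρ hN (φ := Bdd.mk φ 1 hφ) hφ hνN hνqs
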